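/- Let $\mathrm{SU}(2)$ act on the spin-$j$ space $V_j$ ($j\in\{0,\tfrac12,1,\dots\}$, orthonormal basis $|j,m\rangle$) by the Wigner rotation operators $D^j(g)$, and let $J_z,J_+,J_-$ be the angular momentum operators on $V_j$. For a finite subgroup $\mathsf G\subset\mathrm{SU}(2)$ and a $2$-dimensional complex representation $\lambda$ of $\mathsf G$, a spin-$j$ code transforming in $\lambda$ is a $2$-dimensional subspace $K\subset V_j$ that is preserved by all $D^j(g)$, $g\in\mathsf G$, and on which they act as a representation isomorphic to $\lambda$. The rank-1 Knill–Laflamme conditions for $K$ say that for each $J_\alpha\in\{J_z,J_+,J_-\}$ there is a constant $C_\alpha$ with $\langle u|J_\alpha|v\rangle=C_\alpha\langle u|v\rangle$ for all $u,v\in K$. Say that $(\mathsf G,\lambda)$ has automatic rank-1 protection if, for every $j$, every spin-$j$ code transforming in $\lambda$ satisfies the rank-1 Knill–Laflamme conditions. Let $2\mathrm I=\langle \mathsf X,\mathsf Z,\mathsf F,\mathsf\Phi\rangle\subset\mathrm{SU}(2)$, where, with $\varphi=(1+\sqrt5)/2$, $$\mathsf X=-i\begin{pmatrix}0&1\\1&0\end{pmatrix},\quad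 \mathsf Z=-i\begin{pmatrix}1&0\\0&-1\end{pmatrix},\quad \mathsf F=\tfrac{e^{-i\pi/4}}{\sqrt2}\begin{pmatrix}1&-i\\1&i\end{pmatrix},\quad \mathsf\Phi=\tfrac12\begin{pmatrix}\varphi+i\varphi^{-1}&1\\-1&\varphi-i\varphi^{-1}\end{pmatrix}.$$ A subgroup of $\mathrm{SU}(2)$ is called binary icosahedral if it is conjugate in $\mathrm{SU}(2)$ to $2\mathrm I$. For such a group, $\pi_2$ denotes its defining representation on $\mathbb C^2$ and $\overline{\pi_2}$ denotes $\pi_2\circ\alpha$ with $\alpha$ an automorphism of the group that is not inner. **Theorem.** The group $2\mathrm I$ has a faithful irreducible $2$-dimensional representation of the form $\overline{\pi_2}$. Let $\mathsf G$ be any finite subgroup of $\mathrm{SU}(2)$ and $\lambda$ any faithful irreducible $2$-dimensional complex representation of $\mathsf G$, with character $\chi_\lambda$. Then: 1. $(\mathsf G,\lambda)$ has automatic rank-1 protection if and only if $\mathsf G$ is binary icosahedral and $\lambda\cong\overline{\pi_2}$. 2. The quantity $$\widetilde\Gamma(g',E)=\sum_{g\in\mathsf G}\chi_\lambda^*(g)\,\chi_\lambda^*(g^{-1}g')\;gEg^{-1}$$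 vanishes for all $g'\in\mathsf G$ and all traceless $E\in\mathbb C^{2\times2}$ if and only if $\mathsf G$ is binary icosahedral and $\lambda\cong\overline{\pi_2}$. -/

import Mathlib

noncomputable section

namespace SpinCode

open Matrix Polynomial

/-! ### `SU(2)` and the binary icosahedral group -/

/-- The group `SU(2)`. -/
abbrev SU2 : Type := Matrix.specialUnitaryGroup (Fin 2) ℂ

/-- A `2 × 2` matrix of the form `(a, -b̄; b, ā)` with `|a|² + |b|² = 1` lies in `SU(2)`. -/
theorem mem_SU2 (a b : ℂ) (h : a * star a + b * star b = 1) :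
    !![a, -star b; b, star a] ∈ Matrix.specialUnitaryGroup (Fin 2) ℂ := by
  rw [Matrix.mem_specialUnitaryGroup_iff, Matrix.mem_unitaryGroup_iff']
  constructor
  · ext i j
    fin_cases i <;> fin_cases j <;>
      simp [Matrix.mul_apply, Fin.sum_univ_two, Matrix.star_apply] at h ⊢ <;>
      first
      | linear_combination h
      | ring
  · rw [Matrix.det_fin_two_of]
    linear_combination h

/-- `-i X`, with `X` the Pauli matrix. -/
def matX : Matrix (Fin 2) (Fin 2) ℂ := !![0, -Complex.I; -Complex.I, 0]

/-- `-i Z`, with `Z` the Pauli matrix. -/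
def matZ : Matrix (Fin 2) (Fin 2) ℂ := !![-Complex.I, 0; 0, Complex.I]

/-- The facet gate `(e^{-iπ/4} / √2) (1, -i; 1, i)`; note `e^{-iπ/4} / √2 = (1 - i) / 2`. -/
def matF : Matrix (Fin 2) (Fin 2) ℂ :=
  ((1 - Complex.I) / 2) • !![1, -Complex.I; 1, Complex.I]

/-- The gate `(1/2) (φ + i φ⁻¹, 1; -1, φ - i φ⁻¹)`, with `φ` the golden ratio. -/
def matPhi : Matrix (Fin 2) (Fin 2) ℂ :=
  (1 / 2 : ℂ) •
    !![(Real.goldenRatio : ℂ) + Complex.I * (Real.goldenRatio : ℂ)⁻¹, 1;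
      -1, (Real.goldenRatio : ℂ) - Complex.I * (Real.goldenRatio : ℂ)⁻¹]

theorem matX_mem : matX ∈ Matrix.specialUnitaryGroup (Fin 2) ℂ := by
  have h := mem_SU2 0 (-Complex.I) (by simp)
  convert h using 1
  simp [matX]

theorem matZ_mem : matZ ∈ Matrix.specialUnitaryGroup (Fin 2) ℂ := by
  have h := mem_SU2 (-Complex.I) 0 (by simp)
  convert h using 1
  simp [matZ]

theorem matF_mem : matF ∈ Matrix.specialUnitaryGroup (Fin 2) ℂ := by
  have hI := Complex.I_mul_I
  have h := mem_SU2 ((1 - Complex.I) / 2) ((1 - Complex.I) / 2) (by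
    simp
    linear_combination (-1 / 2 : ℂ) * hI)
  convert h using 1
  ext i j
  fin_cases i <;> fin_cases j <;> simp [matF]
  · linear_combination (-1 / 2 : ℂ) * hI
  · linear_combination (-1 / 2 : ℂ) * hI

theorem matPhi_mem : matPhi ∈ Matrix.specialUnitaryGroup (Fin 2) ℂ := by
  have hI := Complex.I_mul_I
  have hp : (Real.goldenRatio : ℂ)⁻¹ = (Real.goldenRatio : ℂ) - 1 := by
    have h1 : (Real.goldenRatio)⁻¹ = Real.goldenRatio - 1 := by
      rw [Real.inv_goldenRatio]
      linear_combination - Real.goldenRatio_add_goldenConj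
    rw [← Complex.ofReal_inv, h1, Complex.ofReal_sub, Complex.ofReal_one]
  have hs : (Real.goldenRatio : ℂ) ^ 2 = (Real.goldenRatio : ℂ) + 1 := by
    exact_mod_cast Real.goldenRatio_sq
  have hstar : star (Real.goldenRatio : ℂ) = (Real.goldenRatio : ℂ) := Complex.conj_ofReal _
  have h := mem_SU2 ((1 / 2) * ((Real.goldenRatio : ℂ) +
      Complex.I * (Real.goldenRatio : ℂ)⁻¹)) (-1 / 2) (by
    rw [hp]
    simp only [star_mul', star_add, star_sub, star_div₀, star_neg, star_one, hstar,
      star_ofNat, Complex.star_def, Complex.conj_I]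
    linear_combination (1 / 2 : ℂ) * hs -
      (1 / 4 : ℂ) * ((Real.goldenRatio : ℂ) - 1) ^ 2 * hI)
  convert h using 1
  ext i j
  fin_cases i <;> fin_cases j <;>
    simp [matPhi, -Complex.ofReal_div, -Complex.ofReal_add] <;> ring

/-- The standard binary icosahedral subgroup `2I = ⟨X, Z, F, Φ⟩` of `SU(2)`. -/
def twoI : Subgroup SU2 :=
  Subgroup.closure {⟨matX, matX_mem⟩, ⟨matZ, matZ_mem⟩, ⟨matF, matF_mem⟩, ⟨matPhi, matPhi_mem⟩}

/-- `G` is a binary icosahedral group: a conjugate of `2I` in `SU(2)`. -/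
def IsBinaryIcosahedral (G : Subgroup SU2) : Prop :=
  ∃ u : SU2, G = twoI.map (MulAut.conj u).toMonoidHom

/-- The fundamental representation `π₂` of a subgroup of `SU(2)` on `ℂ²`. -/
def fundamental (G : Subgroup SU2) : Representation ℂ G (Fin 2 → ℂ) where
  toFun g := Matrix.toLin' ((g : SU2) : Matrix (Fin 2) (Fin 2) ℂ)
  map_one' := by simp [Module.End.one_eq_id]
  map_mul' g h := by simp [Matrix.toLin'_mul, Module.End.mul_eq_comp]

/-- `lam` is (isomorphic to) `π̄₂`: the fundamental representation twisted by an automorphism of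
`G` that is outer, that is, not inner. -/
def IsPiTwoBar {G : Subgroup SU2} {V : Type*} [AddCommGroup V] [Module ℂ V]
    (lam : Representation ℂ G V) : Prop :=
  ∃ α : MulAut G, (∀ h : G, α ≠ MulAut.conj h) ∧
    Nonempty (lam.Equiv ((fundamental G).comp α.toMonoidHom))

/-! ### The spin `j` system, with `n = 2j`

The coordinate `k : Fin (n + 1)` belongs to the state `|j, m⟩` with `m = j - k`. -/

/-- The Hilbert space of spin `j = n / 2`. -/
abbrev Spin (n : ℕ) : Type := EuclideanSpace ℂ (Fin (n + 1))

/-- `J_z |j,m⟩ = m |j,m⟩`. -/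
def Jz (n : ℕ) : Matrix (Fin (n + 1)) (Fin (n + 1)) ℂ :=
  Matrix.diagonal fun k => (n : ℂ) / 2 - (k : ℕ)

/-- `J₊ |j,m⟩ = √((j - m)(j + m + 1)) |j,m+1⟩`. -/
def Jplus (n : ℕ) : Matrix (Fin (n + 1)) (Fin (n + 1)) ℂ :=
  Matrix.of fun l k =>
    if (l : ℕ) + 1 = k then ((√(((k : ℕ) : ℝ) * ((n : ℝ) - (k : ℕ) + 1)) : ℝ) : ℂ) else 0

/-- `J₋ |j,m⟩ = √((j + m)(j - m + 1)) |j,m-1⟩`. -/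
def Jminus (n : ℕ) : Matrix (Fin (n + 1)) (Fin (n + 1)) ℂ :=
  Matrix.of fun l k =>
    if (l : ℕ) = k + 1 then ((√(((n : ℝ) - (k : ℕ)) * ((k : ℕ) + 1)) : ℝ) : ℂ) else 0

/-- The Wigner rotation operator `D^j(g)`. Identify `|j, j-k⟩` with the normalized monomial
`√(n choose k) x^(n-k) y^k`; then `g = (a, b; c, d)` acts by the substitution
`x ↦ a x + c y`, `y ↦ b x + d y`. The polynomial below is the image of `x^(n-k) y^k`,
dehomogenized at `x = 1`. -/
def wignerD (n : ℕ) (g : SU2) : Matrix (Fin (n + 1)) (Fin (n + 1)) ℂ :=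
  Matrix.of fun l k =>
    ((√(n.choose k : ℝ) / √(n.choose l : ℝ) : ℝ) : ℂ) *
      ((C (g.1 0 0) + C (g.1 1 0) * X) ^ (n - (k : ℕ)) *
        (C (g.1 0 1) + C (g.1 1 1) * X) ^ (k : ℕ) : ℂ[X]).coeff l

/-- The code space `K` transforms in `lam`: the operators `D^j(g)`, `g ∈ G`, preserve `K` and
their restrictions to `K` form a representation isomorphic to `lam`. -/
def TransformsIn {G : Subgroup SU2} {V : Type*} [AddCommGroup V] [Module ℂ V]
    (lam : Representation ℂ G V) {n : ℕ} (K : Submodule ℂ (Spin n)) : Prop :=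
  ∃ e : V ≃ₗ[ℂ] K, ∀ (g : G) (v : V),
    (wignerD n (g : SU2)).toEuclideanLin (e v : Spin n) = (e (lam g v) : Spin n)

/-- The rank-1 Knill–Laflamme conditions `⟨u| J_α |v⟩ = C_α ⟨u|v⟩` on the code space `K`. -/
def RankOneKL {n : ℕ} (K : Submodule ℂ (Spin n)) : Prop :=
  ∀ J ∈ ({Jz n, Jplus n, Jminus n} : Set (Matrix (Fin (n + 1)) (Fin (n + 1)) ℂ)),
    ∃ c : ℂ, ∀ u ∈ K, ∀ v ∈ K, inner ℂ u (J.toEuclideanLin v) = c * inner ℂ u v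

/-- Automatic rank-1 protection: for every spin `j = n / 2`, every spin `j` code that transforms
in `lam` satisfies all rank-1 Knill–Laflamme conditions. -/
def AutoRankOne {G : Subgroup SU2} {V : Type*} [AddCommGroup V] [Module ℂ V]
    (lam : Representation ℂ G V) : Prop :=
  ∀ (n : ℕ) (K : Submodule ℂ (Spin n)), TransformsIn lam K → RankOneKL K

/-- `Γ̃(g', E) = ∑_{g ∈ G} conj (χ(g)) conj (χ(g⁻¹ g')) g E g⁻¹`, with `χ` the character of
`lam`. -/
def gammaTilde {G : Subgroup SU2} [Fintype G] {V : Type*} [AddCommGroup V] [Module ℂ V]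
    (lam : Representation ℂ G V) (g' : G) (E : Matrix (Fin 2) (Fin 2) ℂ) :
    Matrix (Fin 2) (Fin 2) ℂ :=
  ∑ g : G, (star (lam.character g) * star (lam.character (g⁻¹ * g'))) •
    ((g : SU2).1 * E * ((g⁻¹ : G) : SU2).1)

end SpinCode

end

noncomputable section

namespace SpinCode

open Matrix

/-! ### Arithmetic in `SU(2)` -/

/-! Put λ in unitary form Λ. Everything is decided by the averages S(E) = Σ_g |χ(g)|² g E g⁻¹ over
traceless E: each of the two conditions forces S = 0, S = 0 forces the twisted icosahedral
representation, and that representation satisfies both conditions.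

For Γ̃, take g' = 1. For automatic protection, the scalar of a Knill–Laflamme condition is invariant
under conjugating E by the group, and such conjugates average to zero. So all matrix elements of
J(E) on a code vanish, and by polarization also those between two equivariant copies of λ
(`AutoRankOne.inner_eq_zero_pair`). Such copies arise from arbitrary states by averaging over
orbits. This gives a relation Σ_k J(F_k) D(k) = 0 on a whole spin space. In degree |G| − 1 a binary
form with prescribed zeros isolates F_1 (`eq_zero_of_sum_derivForm_substForm`), and sums of the
resulting identities give S = 0.

Suppose S = 0. No noncentral element commutes with all its conjugates, for otherwise its traceless
part would be an eigenvector of S with positive eigenvalue. A commutator estimate at the element of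
largest trace then bounds all rotation angles from below, so modulo ±1 the third, fourth or fifth
power of every element is trivial. If no noncentral element had trivial fifth power, faithfulness
would force |χ|² = (tr g)² throughout, which contradicts the trace of S. So elements of trace φ (the
golden ratio) exist, and two noncommuting ones make G binary icosahedral
(`isBinaryIcosahedral_of_tr`): traces of a, b, ab determine a noncommuting pair up to conjugacy, and
2I is a maximal finite subgroup (`eq_twoI_of_le`). Finally Λ lands in SU(2) and is, up to conjugacy,
an automorphism of G; it is not inner because |χ|² differs from (tr g)².

Conversely, a non-inner automorphism exchanges the traces φ and 1 − φ, since otherwise it would be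
conjugation by an element normalizing G, hence lying in G. The adjoint actions of a and α(a) then
share only the eigenvalue 1, so every linear map from traceless matrices that intertwines Ad_g with
Ad_{α(g)} is zero (`IsBinaryIcosahedral.equivariant_eq_zero`). Both conditions are instances of
this. The automorphism itself comes from √5 ↦ −√5 on the icosians. -/

theorem SU2.inv_coe (g : SU2) : (g⁻¹).1 = star g.1 := rfl

theorem SU2.det_coe (g : SU2) : g.1 0 0 * g.1 1 1 - g.1 0 1 * g.1 1 0 = 1 := by
  have h := (Matrix.mem_specialUnitaryGroup_iff.1 g.2).2
  rwa [Matrix.det_fin_two] at h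

theorem SU2.mul_star_coe (g : SU2) : g.1 * star g.1 = 1 :=
  (Matrix.mem_unitaryGroup_iff).1 (Matrix.mem_specialUnitaryGroup_iff.1 g.2).1

theorem SU2.star_mul_coe (g : SU2) : star g.1 * g.1 = 1 :=
  (Matrix.mem_unitaryGroup_iff').1 (Matrix.mem_specialUnitaryGroup_iff.1 g.2).1

theorem SU2.inv_eq_adjugate (g : SU2) : (g⁻¹).1 = g.1.adjugate := by
  have h1 : g.1 * g.1.adjugate = 1 := by
    rw [Matrix.mul_adjugate, (Matrix.mem_specialUnitaryGroup_iff.1 g.2).2, one_smul]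
  calc (g⁻¹).1 = star g.1 * (g.1 * g.1.adjugate) := by rw [h1, mul_one]; rfl
    _ = g.1.adjugate := by rw [← mul_assoc, SU2.star_mul_coe, one_mul]

theorem SU2.coe_one_one (g : SU2) : g.1 1 1 = star (g.1 0 0) := by
  have h := congrFun (congrFun (SU2.inv_eq_adjugate g) 0) 0
  rw [Matrix.adjugate_fin_two] at h
  simpa [SU2.inv_coe, Matrix.star_apply] using h.symm

theorem SU2.coe_zero_one (g : SU2) : g.1 0 1 = -star (g.1 1 0) := by
  have h := congrFun (congrFun (SU2.inv_eq_adjugate g) 0) 1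
  rw [Matrix.adjugate_fin_two] at h
  simp only [SU2.inv_coe, Matrix.star_apply] at h
  rw [h]; simp

/-- The (real) trace of an element of `SU(2)`. -/
def SU2.tr (g : SU2) : ℝ := 2 * (g.1 0 0).re

theorem SU2.trace_coe (g : SU2) : g.1.trace = (SU2.tr g : ℂ) := by
  rw [Matrix.trace_fin_two, SU2.coe_one_one]
  apply Complex.ext <;> simp [SU2.tr] ; ring

theorem SU2.tr_eq (g : SU2) : (SU2.tr g : ℂ) = g.1 0 0 + g.1 1 1 := by
  rw [← SU2.trace_coe, Matrix.trace_fin_two]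

theorem SU2.inv_eq (g : SU2) : (g⁻¹).1 = (SU2.tr g : ℂ) • 1 - g.1 := by
  rw [SU2.inv_eq_adjugate, Matrix.adjugate_fin_two, SU2.tr_eq]
  ext i j; fin_cases i <;> fin_cases j <;> simp

theorem SU2.mul_self_coe (g : SU2) : g.1 * g.1 = (SU2.tr g : ℂ) • g.1 - 1 := by
  have h : g.1 * (g⁻¹).1 = 1 := SU2.mul_star_coe g
  rw [SU2.inv_eq, mul_sub, mul_smul_comm, mul_one] at h
  rw [← h]; abel

@[simp] theorem SU2.tr_one : SU2.tr 1 = 2 := by simp [SU2.tr]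

@[simp] theorem SU2.tr_inv (g : SU2) : SU2.tr g⁻¹ = SU2.tr g := by
  simp [SU2.tr, SU2.inv_coe, Matrix.star_apply]

theorem SU2.tr_mul_comm (g h : SU2) : SU2.tr (g * h) = SU2.tr (h * g) := by
  have : ((SU2.tr (g * h) : ℝ) : ℂ) = SU2.tr (h * g) := by
    rw [← SU2.trace_coe, ← SU2.trace_coe]
    exact Matrix.trace_mul_comm g.1 h.1
  exact_mod_cast this

@[simp] theorem SU2.tr_conj (g h : SU2) : SU2.tr (g * h * g⁻¹) = SU2.tr h := by
  rw [SU2.tr_mul_comm]; simp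

/-- Cayley–Hamilton gives h + h⁻¹ = tr(h) · 1. All later trace identities are derived from this one.
-/
theorem SU2.tr_mul_add (g h : SU2) :
    SU2.tr (g * h) + SU2.tr (g * h⁻¹) = SU2.tr g * SU2.tr h := by
  have : ((SU2.tr (g * h) + SU2.tr (g * h⁻¹) : ℝ) : ℂ) = (SU2.tr g * SU2.tr h : ℝ) := by
    push_cast
    rw [← SU2.trace_coe, ← SU2.trace_coe]
    change (g.1 * h.1).trace + (g.1 * (h⁻¹).1).trace = _
    rw [SU2.inv_eq, mul_sub, Matrix.trace_sub, mul_smul_comm, mul_one, Matrix.trace_smul,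
      SU2.trace_coe]
    simp; ring
  exact_mod_cast this

theorem SU2.normSq_add (g : SU2) : Complex.normSq (g.1 0 0) + Complex.normSq (g.1 1 0) = 1 := by
  have h := SU2.det_coe g
  rw [SU2.coe_one_one, SU2.coe_zero_one] at h
  have : ((Complex.normSq (g.1 0 0) + Complex.normSq (g.1 1 0) : ℝ) : ℂ) = 1 := by
    push_cast
    rw [← Complex.mul_conj, ← Complex.mul_conj]
    rw [← h]; simp only [Complex.star_def]; ring
  exact_mod_cast this

theorem SU2.ext_col {g h : SU2} (h0 : g.1 0 0 = h.1 0 0) (h1 : g.1 1 0 = h.1 1 0) : g = h := by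
  apply Subtype.ext
  ext i j
  fin_cases i <;> fin_cases j
  · exact h0
  · simp [SU2.coe_zero_one, h1]
  · exact h1
  · simp [SU2.coe_one_one, h0]

theorem SU2.tr_sq_le (g : SU2) : SU2.tr g ^ 2 ≤ 4 := by
  have h := SU2.normSq_add g
  rw [Complex.normSq_apply, Complex.normSq_apply] at h
  rw [SU2.tr]
  nlinarith [sq_nonneg (g.1 0 0).im, sq_nonneg (g.1 1 0).im, sq_nonneg (g.1 1 0).re]

/-- The element `-1` of `SU(2)`. -/
def SU2.negOne : SU2 :=
  ⟨-1, by
    rw [Matrix.mem_specialUnitaryGroup_iff, Matrix.mem_unitaryGroup_iff]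
    simp [Matrix.det_fin_two]⟩

@[simp] theorem SU2.negOne_coe : SU2.negOne.1 = -1 := rfl

@[simp] theorem SU2.negOne_mul_self : SU2.negOne * SU2.negOne = 1 := by
  apply Subtype.ext; simp

theorem SU2.negOne_comm (g : SU2) : SU2.negOne * g = g * SU2.negOne := by
  apply Subtype.ext; simp

@[simp] theorem SU2.tr_negOne_mul (g : SU2) : SU2.tr (SU2.negOne * g) = -SU2.tr g := by
  simp [SU2.tr]

@[simp] theorem SU2.tr_negOne : SU2.tr SU2.negOne = -2 := by
  simp [SU2.tr]

theorem SU2.negOne_ne_one : SU2.negOne ≠ 1 := by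
  intro h
  have := congrArg SU2.tr h
  norm_num at this

theorem SU2.eq_one_of_tr (g : SU2) (h : SU2.tr g = 2) : g = 1 := by
  have h1 := SU2.normSq_add g
  rw [SU2.tr] at h
  have h2 : (g.1 0 0).re = 1 := by linarith
  rw [Complex.normSq_apply, Complex.normSq_apply, h2] at h1
  have h3 : (g.1 0 0).im = 0 := by nlinarith [sq_nonneg (g.1 1 0).im, sq_nonneg (g.1 1 0).re]
  have h4 : (g.1 1 0).im = 0 := by nlinarith [sq_nonneg (g.1 0 0).im, sq_nonneg (g.1 1 0).re]
  have h5 : (g.1 1 0).re = 0 := by nlinarith [sq_nonneg (g.1 0 0).im, sq_nonneg (g.1 1 0).im]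
  apply SU2.ext_col
  · apply Complex.ext <;> simp [h2, h3]
  · apply Complex.ext <;> simp [h4, h5]

theorem SU2.eq_negOne_of_tr (g : SU2) (h : SU2.tr g = -2) : g = SU2.negOne := by
  have h1 : SU2.negOne * g = 1 := SU2.eq_one_of_tr _ (by simp [h])
  calc g = SU2.negOne * (SU2.negOne * g) := by rw [← mul_assoc]; simp
    _ = _ := by rw [h1, mul_one]

theorem SU2.tr_sq_lt (g : SU2) (h1 : g ≠ 1) (h2 : g ≠ SU2.negOne) : SU2.tr g ^ 2 < 4 := by
  refine lt_of_le_of_ne (SU2.tr_sq_le g) fun h => ?_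
  have : (SU2.tr g - 2) * (SU2.tr g + 2) = 0 := by linarith
  rcases mul_eq_zero.1 this with h' | h'
  · exact h1 (SU2.eq_one_of_tr g (by linarith))
  · exact h2 (SU2.eq_negOne_of_tr g (by linarith))

theorem SU2.eq_of_tr_mul_inv {g h : SU2} (H : SU2.tr (g * h⁻¹) = 2) : g = h :=
  mul_inv_eq_one.1 (SU2.eq_one_of_tr _ H)

/-- A difference of unit quaternions is zero or invertible. Equality in SU(2) can thus be tested by
a determinant. -/
theorem SU2.det_sub (g h : SU2) : (g.1 - h.1).det = (2 - SU2.tr (g * h⁻¹) : ℝ) := by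
  have h1 := SU2.det_coe g
  have h2 := SU2.det_coe h
  push_cast
  rw [← SU2.trace_coe]
  change _ = 2 - (g.1 * (h⁻¹).1).trace
  rw [SU2.inv_eq_adjugate, Matrix.adjugate_fin_two, Matrix.det_fin_two, Matrix.trace_fin_two]
  simp [Matrix.mul_apply, Fin.sum_univ_two]
  linear_combination h1 + h2

theorem SU2.eq_of_det_sub {g h : SU2} (H : (g.1 - h.1).det = 0) : g = h := by
  rw [SU2.det_sub] at H
  have : 2 - SU2.tr (g * h⁻¹) = 0 := by exact_mod_cast H
  exact SU2.eq_of_tr_mul_inv (by linarith)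

theorem SU2.eq_one_or_negOne_of_sq (g : SU2) (h : g * g = 1) : g = 1 ∨ g = SU2.negOne := by
  by_contra! hc
  have h1 : SU2.tr g ^ 2 - 2 = 2 := by
    have := SU2.tr_mul_add g g
    rw [h] at this; simp at this; linarith
  have := SU2.tr_sq_lt g hc.1 hc.2
  linarith

/-! ### Commutants of `2 × 2` matrices -/

/-- A matrix commuting with a non-scalar `2 × 2` matrix `A` is a polynomial in `A`. -/
theorem exists_eq_smul_add_of_commute {A B : Matrix (Fin 2) (Fin 2) ℂ}
    (hA : ∀ c : ℂ, A ≠ c • 1) (h : A * B = B * A) : ∃ p q : ℂ, B = p • A + q • 1 := by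
  have e00 := congrFun (congrFun h 0) 0
  have e01 := congrFun (congrFun h 0) 1
  have e10 := congrFun (congrFun h 1) 0
  simp only [Matrix.mul_apply, Fin.sum_univ_two] at e00 e01 e10
  by_cases h01 : A 0 1 = 0
  · by_cases h10 : A 1 0 = 0
    · have hd : A 0 0 - A 1 1 ≠ 0 := by
        intro hd
        apply hA (A 0 0)
        ext i j
        fin_cases i <;> fin_cases j <;> simp [h01, h10]
        linear_combination -hd
      have b01 : B 0 1 = 0 := by
        apply mul_left_cancel₀ hd
        rw [h01] at e01; linear_combination e01
      have b10 : B 1 0 = 0 := by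
        apply mul_left_cancel₀ hd
        rw [h10] at e10; linear_combination -e10
      refine ⟨(B 0 0 - B 1 1) / (A 0 0 - A 1 1),
        B 0 0 - (B 0 0 - B 1 1) / (A 0 0 - A 1 1) * A 0 0, ?_⟩
      ext i j
      fin_cases i <;> fin_cases j <;> simp [h01, h10, b01, b10]
      field_simp
      ring
    · refine ⟨B 1 0 / A 1 0, B 0 0 - B 1 0 / A 1 0 * A 0 0, ?_⟩
      ext i j
      fin_cases i <;> fin_cases j <;> simp
      · field_simp
        linear_combination -e00
      · field_simp
      · field_simp
        linear_combination -e10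
  · refine ⟨B 0 1 / A 0 1, B 0 0 - B 0 1 / A 0 1 * A 0 0, ?_⟩
    ext i j
    fin_cases i <;> fin_cases j <;> simp
    · field_simp
    · field_simp
      linear_combination e00
    · field_simp
      linear_combination e01

/-- A matrix commuting with two non-commuting `2 × 2` matrices is scalar. -/
theorem exists_eq_smul_one_of_commute {A B M : Matrix (Fin 2) (Fin 2) ℂ} (hAB : A * B ≠ B * A)
    (hA : M * A = A * M) (hB : M * B = B * M) : ∃ c : ℂ, M = c • 1 := by
  by_contra! hM
  obtain ⟨p, q, rfl⟩ := exists_eq_smul_add_of_commute hM hA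
  obtain ⟨r, s, rfl⟩ := exists_eq_smul_add_of_commute hM hB
  apply hAB
  simp only [mul_add, add_mul, smul_mul_assoc, mul_smul_comm, mul_one, one_mul, smul_add, smul_smul]
  simp only [mul_comm p, mul_comm q]
  abel

theorem SU2.coe_ne_smul_one {g : SU2} (h1 : g ≠ 1) (h2 : g ≠ SU2.negOne) (c : ℂ) :
    g.1 ≠ c • 1 := by
  intro h
  have hd := SU2.det_coe g
  rw [h] at hd
  simp at hd
  rcases mul_self_eq_one_iff.1 hd with rfl | rfl
  · exact h1 (Subtype.ext (by simpa using h))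
  · exact h2 (Subtype.ext (by simpa using h))

theorem SU2.ne_of_not_commute {g h : SU2} (H : g * h ≠ h * g) :
    g ≠ 1 ∧ g ≠ SU2.negOne := by
  constructor
  · rintro rfl; simp at H
  · rintro rfl; exact H (SU2.negOne_comm h)

/-- Commuting with a common element `a ≠ ±1` is transitive. -/
theorem SU2.commute_of_commute {a g h : SU2} (h1 : a ≠ 1) (h2 : a ≠ SU2.negOne)
    (hg : a * g = g * a) (hh : a * h = h * a) : g * h = h * g := by
  by_contra H
  have H' : g.1 * h.1 ≠ h.1 * g.1 := fun e => H (Subtype.ext e)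
  obtain ⟨c, hc⟩ := exists_eq_smul_one_of_commute H' (congrArg Subtype.val hg)
    (congrArg Subtype.val hh)
  exact SU2.coe_ne_smul_one h1 h2 c hc

/-- Both a and a⁻¹ are roots of the characteristic polynomial of c, so (c − a)(c − a⁻¹) = 0. One
factor is singular and therefore zero. -/
theorem SU2.eq_or_eq_inv_of_commute {a c : SU2} (h : a * c = c * a)
    (ht : SU2.tr c = SU2.tr a) : c = a ∨ c = a⁻¹ := by
  have hc := SU2.mul_self_coe c
  have ha := SU2.inv_eq a
  have hi : a.1 * (a⁻¹).1 = 1 := SU2.mul_star_coe a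
  have h' : a.1 * c.1 = c.1 * a.1 := congrArg Subtype.val h
  have h0 : (c.1 - a.1) * (c.1 - (a⁻¹).1) = 0 := by
    rw [sub_mul, mul_sub, mul_sub, hi, hc, ha, h', mul_sub, mul_smul_comm, mul_one, ht]
    abel
  have h1 := congrArg Matrix.det h0
  rw [Matrix.det_mul] at h1
  simp only [Matrix.det_zero, mul_eq_zero] at h1
  rcases h1 with h1 | h1
  · exact Or.inl (SU2.eq_of_det_sub h1)
  · exact Or.inr (SU2.eq_of_det_sub h1)

/-- Only a half turn reverses the axis of another rotation. -/
theorem SU2.tr_eq_zero_of_conj_eq_inv {a g : SU2} (h1 : a ≠ 1) (h2 : a ≠ SU2.negOne)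
    (h : g * a * g⁻¹ = a⁻¹) : SU2.tr g = 0 := by
  have e1 : g * a = a⁻¹ * g := by rw [← h]; group
  have e2 : SU2.tr (g * a) = SU2.tr g * SU2.tr a / 2 := by
    have := SU2.tr_mul_add g a
    rw [SU2.tr_mul_comm g a⁻¹, ← e1] at this
    linarith
  have e3 := SU2.tr_mul_add (g * a) a
  rw [mul_inv_cancel_right, e2, e1, mul_assoc, SU2.tr_mul_comm, mul_inv_cancel_right] at e3
  have h4 := SU2.tr_sq_lt a h1 h2
  have : SU2.tr g * (4 - SU2.tr a ^ 2) = 0 := by linear_combination 2 * e3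
  rcases mul_eq_zero.1 this with h' | h'
  · exact h'
  · linarith

/-- Fricke's formula for the trace of a commutator. -/
theorem SU2.tr_commutator (a b : SU2) : SU2.tr (a * b * a⁻¹ * b⁻¹) =
    SU2.tr a ^ 2 + SU2.tr b ^ 2 + SU2.tr (a * b) ^ 2 - SU2.tr a * SU2.tr b * SU2.tr (a * b) - 2 := by
  have e1 := SU2.tr_mul_add (a * b) (a⁻¹ * b⁻¹)
  rw [show a * b * (a⁻¹ * b⁻¹) = a * b * a⁻¹ * b⁻¹ by group,
    show a * b * (a⁻¹ * b⁻¹)⁻¹ = a * b * b * a by group, ← SU2.tr_inv (a⁻¹ * b⁻¹),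
    show (a⁻¹ * b⁻¹)⁻¹ = b * a by group, SU2.tr_mul_comm b a] at e1
  have e5 := SU2.tr_mul_add (a * b) b
  have e6 := SU2.tr_mul_add (a * b * b) a
  rw [show a * b * b * a⁻¹ = a * (b * b) * a⁻¹ by group, SU2.tr_conj] at e6
  rw [show a * b * b⁻¹ = a by group] at e5
  have e7 := SU2.tr_mul_add b b
  rw [mul_inv_cancel, SU2.tr_one] at e7
  linear_combination e1 - e6 + e7 - SU2.tr a * e5

end SpinCode

end

noncomputable section

namespace SpinCode

open Matrix

/-! ### Simultaneous conjugation in `SU(2)` -/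

/-- A normalized eigenvector for m is completed to the first column of an element of SU(2). -/
theorem SU2.exists_conj_diagonal (a : SU2) (m : ℂ) (hm : m ^ 2 - SU2.tr a * m + 1 = 0) :
    ∃ u : SU2, (u * a * u⁻¹).1 0 0 = m ∧ (u * a * u⁻¹).1 1 0 = 0 := by
  have hdet : (a.1 - m • 1).det = 0 := by
    have h1 := SU2.det_coe a
    rw [SU2.tr_eq] at hm
    rw [Matrix.det_fin_two]
    simp
    linear_combination hm + h1
  obtain ⟨v, hv0, hv⟩ := Matrix.exists_mulVec_eq_zero_iff.2 hdet
  have hv' : a.1 *ᵥ v = m • v := by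
    rw [Matrix.sub_mulVec, Matrix.smul_mulVec, Matrix.one_mulVec] at hv
    exact sub_eq_zero.1 hv
  set r : ℝ := Complex.normSq (v 0) + Complex.normSq (v 1) with hr
  have hr0 : 0 < r := by
    have h0 := Complex.normSq_nonneg (v 0)
    have h1 := Complex.normSq_nonneg (v 1)
    refine lt_of_le_of_ne (by positivity) fun h => hv0 ?_
    ext i
    fin_cases i
    · exact Complex.normSq_eq_zero.1 (show Complex.normSq (v 0) = 0 by linarith)
    · exact Complex.normSq_eq_zero.1 (show Complex.normSq (v 1) = 0 by linarith)
  set s : ℂ := (((Real.sqrt r)⁻¹ : ℝ) : ℂ) with hs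
  have hss : s * s * r = 1 := by
    rw [hs]
    norm_cast
    rw [← mul_inv, Real.mul_self_sqrt hr0.le]
    exact inv_mul_cancel₀ hr0.ne'
  have hsc : star s = s := by rw [hs]; exact Complex.conj_ofReal _
  have hs0 : s ≠ 0 := by rintro h; simp [h] at hss
  have hmem := mem_SU2 (s * v 0) (s * v 1) (by
    rw [← hss, hr, star_mul', star_mul', hsc]
    push_cast
    rw [← Complex.mul_conj, ← Complex.mul_conj]
    simp only [Complex.star_def]; ring)
  set w : SU2 := ⟨_, hmem⟩ with hw
  have hw00 : w.1 0 0 = s * v 0 := by simp [hw]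
  have hw10 : w.1 1 0 = s * v 1 := by simp [hw]
  have e0 := congrFun hv' 0
  have e1 := congrFun hv' 1
  simp only [Matrix.mulVec, dotProduct, Fin.sum_univ_two, Pi.smul_apply, smul_eq_mul] at e0 e1
  have hwd := SU2.det_coe w
  refine ⟨w⁻¹, ?_, ?_⟩
  · rw [inv_inv]
    change ((w⁻¹).1 * a.1 * w.1) 0 0 = m
    rw [SU2.inv_eq_adjugate, Matrix.adjugate_fin_two]
    simp only [Matrix.mul_apply, Fin.sum_univ_two, Matrix.of_apply, Matrix.cons_val', Matrix.cons_val_zero,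
      Matrix.cons_val_one, Matrix.empty_val', Matrix.cons_val_fin_one]
    rw [hw00, hw10] at *
    linear_combination w.1 1 1 * s * e0 - w.1 0 1 * s * e1 + m * hwd
  · rw [inv_inv]
    change ((w⁻¹).1 * a.1 * w.1) 1 0 = 0
    rw [SU2.inv_eq_adjugate, Matrix.adjugate_fin_two]
    simp only [Matrix.mul_apply, Fin.sum_univ_two, Matrix.of_apply, Matrix.cons_val', Matrix.cons_val_zero,
      Matrix.cons_val_one, Matrix.empty_val', Matrix.cons_val_fin_one]
    rw [hw00, hw10] at *
    linear_combination s * v 0 * s * e1 - s * v 1 * s * e0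

theorem SU2.exists_eigenvalue (t : ℝ) : ∃ m : ℂ, m ^ 2 - t * m + 1 = 0 := by
  obtain ⟨s, hs⟩ := IsAlgClosed.exists_pow_nat_eq ((t : ℂ) ^ 2 - 4) (n := 2) (by norm_num)
  exact ⟨(t + s) / 2, by linear_combination (1 / 4 : ℂ) * hs⟩

theorem diagonal_mul_mul_diagonal_col (x y z w : ℂ) (M : Matrix (Fin 2) (Fin 2) ℂ) :
    (!![x, 0; 0, y] * M * !![z, 0; 0, w]) 0 0 = x * M 0 0 * z ∧
      (!![x, 0; 0, y] * M * !![z, 0; 0, w]) 1 0 = y * M 1 0 * z := by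
  rw [Matrix.eta_fin_two M]
  simp [Matrix.mul_apply, Fin.sum_univ_two]

/-- Non-commuting pairs in `SU(2)` are determined up to conjugacy by the traces of `a`, `b`, `ab`. -/
theorem SU2.exists_conj_pair {a b a' b' : SU2} (ha : SU2.tr a = SU2.tr a')
    (hb : SU2.tr b = SU2.tr b') (hab : SU2.tr (a * b) = SU2.tr (a' * b'))
    (hne : a * b ≠ b * a) : ∃ u : SU2, u * a * u⁻¹ = a' ∧ u * b * u⁻¹ = b' := by
  obtain ⟨m, hm⟩ := SU2.exists_eigenvalue (SU2.tr a)
  obtain ⟨u, hu0, hu1⟩ := SU2.exists_conj_diagonal a m hm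
  obtain ⟨w, hw0, hw1⟩ := SU2.exists_conj_diagonal a' m (ha ▸ hm)
  have hd : u * a * u⁻¹ = w * a' * w⁻¹ := SU2.ext_col (hu0.trans hw0.symm) (hu1.trans hw1.symm)
  set d := u * a * u⁻¹ with hdd
  set p := u * b * u⁻¹ with hp
  set q := w * b' * w⁻¹ with hq
  have hd1 : d.1 0 1 = 0 := by rw [SU2.coe_zero_one, hu1]; simp
  have hdet := SU2.normSq_add d
  rw [hu0, hu1, map_zero, add_zero] at hdet
  have htp : SU2.tr p = SU2.tr q := by rw [hp, hq]; simp [hb]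
  have htdp : SU2.tr (d * p) = SU2.tr (d * q) := by
    have h1 : d * p = u * (a * b) * u⁻¹ := by rw [hdd, hp]; group
    have h2 : d * q = w * (a' * b') * w⁻¹ := by rw [hd, hq]; group
    rw [h1, h2, SU2.tr_conj, SU2.tr_conj, hab]
  have hdp : d * p ≠ p * d := by
    intro h
    apply hne
    have h1 : u * (a * b) * u⁻¹ = u * (b * a) * u⁻¹ := by
      calc u * (a * b) * u⁻¹ = d * p := by rw [hdd, hp]; group
        _ = p * d := h
        _ = _ := by rw [hdd, hp]; group
    exact mul_left_cancel (mul_right_cancel h1)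
  have hne := SU2.ne_of_not_commute hdp
  have hmim : m.im ≠ 0 := by
    intro h0
    have h2 := SU2.tr_sq_lt d hne.1 hne.2
    rw [SU2.tr, hu0] at h2
    rw [Complex.normSq_apply, h0] at hdet
    nlinarith
  -- The traces of p and dp give the real parts of p₀₀ and m p₀₀. Since m is not real, they
  -- determine p₀₀.
  have hp0 : p.1 0 0 = q.1 0 0 := by
    have h1 : (p.1 0 0).re = (q.1 0 0).re := by
      simp only [SU2.tr] at htp; linarith
    have h2 : (m * p.1 0 0).re = (m * q.1 0 0).re := by
      simp only [SU2.tr] at htdp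
      have e1 : (d * p).1 0 0 = m * p.1 0 0 := by
        change (d.1 * p.1) 0 0 = _
        rw [Matrix.mul_apply, Fin.sum_univ_two, hd1, hu0]; ring
      have e2 : (d * q).1 0 0 = m * q.1 0 0 := by
        change (d.1 * q.1) 0 0 = _
        rw [Matrix.mul_apply, Fin.sum_univ_two, hd1, hu0]; ring
      rw [e1, e2] at htdp
      linarith
    apply Complex.ext h1
    rw [Complex.mul_re, Complex.mul_re, h1] at h2
    exact mul_left_cancel₀ hmim (by linarith)
  have hpn := SU2.normSq_add p
  have hqn := SU2.normSq_add q
  rw [hp0] at hpn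
  have hn : Complex.normSq (p.1 1 0) = Complex.normSq (q.1 1 0) := by linarith
  have hp1 : p.1 1 0 ≠ 0 := by
    intro h0
    apply hdp
    have h01 : p.1 0 1 = 0 := by rw [SU2.coe_zero_one, h0]; simp
    apply SU2.ext_col
    · change (d.1 * p.1) 0 0 = (p.1 * d.1) 0 0
      rw [Matrix.mul_apply, Matrix.mul_apply, Fin.sum_univ_two, Fin.sum_univ_two, hd1, h01]; ring
    · change (d.1 * p.1) 1 0 = (p.1 * d.1) 1 0
      rw [Matrix.mul_apply, Matrix.mul_apply, Fin.sum_univ_two, Fin.sum_univ_two, hu1, h0]; ring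
  -- The lower left entries have equal modulus, so only a phase is left. Conjugation by diag(s̄, s)
  -- multiplies this entry by s² and fixes d.
  obtain ⟨s, hs⟩ := IsAlgClosed.exists_pow_nat_eq (q.1 1 0 / p.1 1 0) (n := 2) (by norm_num)
  have hs1 : star s * s = 1 := by
    have h1 : Complex.normSq s ^ 2 = 1 := by
      rw [← map_pow, hs, map_div₀, hn, div_self]
      rw [← hn]; exact fun h => hp1 (Complex.normSq_eq_zero.1 h)
    have h2 : Complex.normSq s = 1 := by
      have := Complex.normSq_nonneg s
      nlinarith
    rw [Complex.star_def, mul_comm, Complex.mul_conj, h2]; simp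
  have hmem := mem_SU2 (star s) 0 (by simpa using hs1)
  set c : SU2 := ⟨_, hmem⟩ with hc
  have hci : (c⁻¹).1 = !![s, 0; 0, star s] := by
    rw [SU2.inv_eq_adjugate, hc, Matrix.adjugate_fin_two]; simp
  have hcc : c.1 = !![star s, 0; 0, s] := by simp [hc]
  have hcol (g : SU2) : (c * g * c⁻¹).1 0 0 = star s * g.1 0 0 * s ∧
      (c * g * c⁻¹).1 1 0 = s * g.1 1 0 * s := by
    change (c.1 * g.1 * (c⁻¹).1) 0 0 = _ ∧ (c.1 * g.1 * (c⁻¹).1) 1 0 = _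
    rw [hci, hcc]
    exact diagonal_mul_mul_diagonal_col _ _ _ _ _
  have hcd : c * d * c⁻¹ = d := by
    apply SU2.ext_col
    · rw [(hcol d).1]
      linear_combination d.1 0 0 * hs1
    · rw [(hcol d).2, hu1]
      simp
  have hcp : c * p * c⁻¹ = q := by
    apply SU2.ext_col
    · rw [(hcol p).1, ← hp0]
      linear_combination p.1 0 0 * hs1
    · rw [(hcol p).2]
      field_simp at hs
      linear_combination hs
  refine ⟨w⁻¹ * c * u, ?_, ?_⟩
  · calc w⁻¹ * c * u * a * (w⁻¹ * c * u)⁻¹ = w⁻¹ * (c * d * c⁻¹) * w := by rw [hdd]; group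
      _ = a' := by rw [hcd, hd]; group
  · calc w⁻¹ * c * u * b * (w⁻¹ * c * u)⁻¹ = w⁻¹ * (c * p * c⁻¹) * w := by rw [hp]; group
      _ = b' := by rw [hcp, hq]; group

/-! ### Powers and traces -/

/-- An eigenvalue of g is a primitive root of unity of order `orderOf g`, so some power of it is
exp(2πi / `orderOf g`). -/
theorem SU2.exists_tr_pow_eq_cos (g : SU2) (hk : 0 < orderOf g) :
    ∃ j : ℕ, SU2.tr (g ^ j) = 2 * Real.cos (2 * Real.pi / orderOf g) := by
  obtain ⟨m, hm⟩ := SU2.exists_eigenvalue (SU2.tr g)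
  obtain ⟨u, hu0, hu1⟩ := SU2.exists_conj_diagonal g m hm
  set d := u * g * u⁻¹ with hd
  have hd1 : d.1 0 1 = 0 := by rw [SU2.coe_zero_one, hu1]; simp
  have hdj (j : ℕ) : (d ^ j).1 0 0 = m ^ j ∧ (d ^ j).1 1 0 = 0 := by
    induction j with
    | zero => simp
    | succ j ih =>
      rw [pow_succ]
      change ((d ^ j).1 * d.1) 0 0 = _ ∧ ((d ^ j).1 * d.1) 1 0 = _
      rw [Matrix.mul_apply, Matrix.mul_apply, Fin.sum_univ_two, Fin.sum_univ_two, ih.1, ih.2, hu0,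
        hu1]
      constructor <;> ring
  have hpow (j : ℕ) : d ^ j = u * g ^ j * u⁻¹ := by rw [hd, conj_pow]
  have hprim : IsPrimitiveRoot m (orderOf g) := by
    constructor
    · rw [← (hdj _).1, hpow, pow_orderOf_eq_one]; simp
    · intro l hl
      apply orderOf_dvd_of_pow_eq_one
      have h1 : d ^ l = 1 := SU2.ext_col (by rw [(hdj l).1, hl]; simp) (by rw [(hdj l).2]; simp)
      rw [hpow, conj_eq_one_iff] at h1
      exact h1
  have hexp := (Complex.isPrimitiveRoot_exp (orderOf g) hk.ne').pow_eq_one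
  have : NeZero (orderOf g) := ⟨hk.ne'⟩
  obtain ⟨j, -, hj⟩ := hprim.eq_pow_of_pow_eq_one hexp
  refine ⟨j, ?_⟩
  rw [← SU2.tr_conj u, ← hpow, SU2.tr, (hdj j).1, hj]
  rw [show 2 * (Real.pi : ℂ) * Complex.I / (orderOf g : ℂ) =
    ((2 * Real.pi / orderOf g : ℝ) : ℂ) * Complex.I by push_cast; ring,
    Complex.exp_ofReal_mul_I_re]

theorem mul_self_fin_two (M : Matrix (Fin 2) (Fin 2) ℂ) : M * M = M.trace • M - M.det • 1 := by
  ext i j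
  fin_cases i <;> fin_cases j <;>
    simp [Matrix.mul_apply, Fin.sum_univ_two, Matrix.trace_fin_two, Matrix.det_fin_two] <;> ring

/-- By Cayley–Hamilton every power is p M + q · 1. If a power of a nonscalar M is scalar, then p =
0, which is a polynomial equation between trace and determinant. -/
theorem eq_zero_of_smul_add_smul_eq {M : Matrix (Fin 2) (Fin 2) ℂ} (hM : ∀ c : ℂ, M ≠ c • 1)
    {p q c : ℂ} (h : p • M + q • 1 = c • (1 : Matrix (Fin 2) (Fin 2) ℂ)) : p = 0 := by
  by_contra hp
  apply hM (p⁻¹ * (c - q))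
  rw [mul_smul, sub_smul, ← h]
  simp [smul_smul, hp]

theorem pow_three_fin_two (M : Matrix (Fin 2) (Fin 2) ℂ) :
    M ^ 3 = (M.trace ^ 2 - M.det) • M + (-(M.trace * M.det)) • 1 := by
  rw [pow_succ, pow_two, mul_self_fin_two, sub_mul, smul_mul_assoc, mul_self_fin_two]
  simp only [smul_sub, smul_smul, sub_smul, neg_smul, smul_mul_assoc, one_mul]
  rw [pow_two]; abel

theorem pow_four_fin_two (M : Matrix (Fin 2) (Fin 2) ℂ) :
    M ^ 4 = (M.trace * (M.trace ^ 2 - 2 * M.det)) • M +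
      (-((M.trace ^ 2 - M.det) * M.det)) • 1 := by
  rw [pow_succ, pow_three_fin_two, add_mul, smul_mul_assoc, mul_self_fin_two, smul_mul_assoc, one_mul]
  module

theorem pow_five_fin_two (M : Matrix (Fin 2) (Fin 2) ℂ) :
    M ^ 5 = (M.trace ^ 4 - 3 * M.trace ^ 2 * M.det + M.det ^ 2) • M +
      (-(M.trace * (M.trace ^ 2 - 2 * M.det) * M.det)) • 1 := by
  rw [pow_succ, pow_four_fin_two, add_mul, smul_mul_assoc, mul_self_fin_two, smul_mul_assoc, one_mul]
  module

/-- `g` is one of the central elements `±1` of `SU(2)`. -/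
def SU2.IsSign (g : SU2) : Prop := g = 1 ∨ g = SU2.negOne

theorem SU2.IsSign.exists_smul {g : SU2} (h : SU2.IsSign g) : ∃ c : ℂ, g.1 = c • 1 := by
  rcases h with rfl | rfl
  · exact ⟨1, by simp⟩
  · exact ⟨-1, by simp⟩

theorem SU2.coe_pow (g : SU2) (n : ℕ) : (g ^ n).1 = g.1 ^ n := rfl

theorem SU2.tr_sq_eq_one {g : SU2} (hg : ¬ SU2.IsSign g) (h : SU2.IsSign (g ^ 3)) :
    SU2.tr g ^ 2 = 1 := by
  obtain ⟨c, hc⟩ := h.exists_smul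
  rw [SU2.coe_pow, pow_three_fin_two] at hc
  have := eq_zero_of_smul_add_smul_eq
    (SU2.coe_ne_smul_one (fun e => hg (Or.inl e)) (fun e => hg (Or.inr e))) hc
  rw [SU2.trace_coe, (Matrix.mem_specialUnitaryGroup_iff.1 g.2).2] at this
  have h2 : SU2.tr g ^ 2 - 1 = 0 := by exact_mod_cast this
  linarith

theorem SU2.tr_of_pow_four {g : SU2} (hg : ¬ SU2.IsSign g) (h : SU2.IsSign (g ^ 4)) :
    SU2.tr g = 0 ∨ SU2.tr g ^ 2 = 2 := by
  obtain ⟨c, hc⟩ := h.exists_smul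
  rw [SU2.coe_pow, pow_four_fin_two] at hc
  have := eq_zero_of_smul_add_smul_eq
    (SU2.coe_ne_smul_one (fun e => hg (Or.inl e)) (fun e => hg (Or.inr e))) hc
  rw [SU2.trace_coe, (Matrix.mem_specialUnitaryGroup_iff.1 g.2).2] at this
  have h2 : SU2.tr g * (SU2.tr g ^ 2 - 2 * 1) = 0 := by exact_mod_cast this
  rcases mul_eq_zero.1 h2 with h' | h'
  · exact Or.inl h'
  · exact Or.inr (by linarith)

theorem SU2.tr_of_pow_five {g : SU2} (hg : ¬ SU2.IsSign g) (h : SU2.IsSign (g ^ 5)) :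
    SU2.tr g ^ 4 - 3 * SU2.tr g ^ 2 + 1 = 0 := by
  obtain ⟨c, hc⟩ := h.exists_smul
  rw [SU2.coe_pow, pow_five_fin_two] at hc
  have := eq_zero_of_smul_add_smul_eq
    (SU2.coe_ne_smul_one (fun e => hg (Or.inl e)) (fun e => hg (Or.inr e))) hc
  rw [SU2.trace_coe, (Matrix.mem_specialUnitaryGroup_iff.1 g.2).2] at this
  have h2 : SU2.tr g ^ 4 - 3 * SU2.tr g ^ 2 * 1 + 1 ^ 2 = 0 := by exact_mod_cast this
  linarith

end SpinCode

end

noncomputable section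

namespace SpinCode

open Matrix

/-! ### Traces in finite subgroups of `SU(2)` -/

theorem goldenRatio_bounds : (1.618 : ℝ) < Real.goldenRatio ∧ Real.goldenRatio < 1.6181 := by
  have h := Real.goldenRatio_sq
  have h0 := Real.one_lt_goldenRatio
  constructor <;> nlinarith

/-- Every non-trivial element of `G` is a rotation by a large enough angle. -/
def TraceBounded (G : Subgroup SU2) : Prop := ∀ g ∈ G, g ≠ 1 → SU2.tr g < Real.sqrt 3

theorem exists_max_tr (G : Subgroup SU2) [Finite G] {a : SU2} (ha : a ∈ G) (ha1 : a ≠ 1) :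
    ∃ m ∈ G, m ≠ 1 ∧ ∀ g ∈ G, g ≠ 1 → SU2.tr g ≤ SU2.tr m := by
  have hf : ({g : SU2 | g ∈ G ∧ g ≠ 1}).Finite :=
    (Set.toFinite (G : Set SU2)).subset fun g hg => hg.1
  obtain ⟨m, hm, hmax⟩ := Set.exists_max_image _ SU2.tr hf ⟨a, ha, ha1⟩
  exact ⟨m, hm.1, hm.2, fun g hg hg1 => hmax g ⟨hg, hg1⟩⟩

/-- The commutator of two rotations by small angles is a rotation by a much smaller angle. If m had
too small an angle, its nontrivial commutator with a conjugate would have larger trace than m. -/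
theorem traceBounded_of_max {G : Subgroup SU2} {m h : SU2} (hm : m ∈ G) (hh : h ∈ G)
    (hmax : ∀ g ∈ G, g ≠ 1 → SU2.tr g ≤ SU2.tr m)
    (hne : m * (h * m * h⁻¹) ≠ h * m * h⁻¹ * m) : TraceBounded G := by
  intro g hg hg1
  refine lt_of_le_of_lt (hmax g hg hg1) ?_
  by_contra! hlt
  set b := h * m * h⁻¹ with hb
  have hbG : b ∈ G := G.mul_mem (G.mul_mem hh hm) (G.inv_mem hh)
  have hc1 : m * b * m⁻¹ * b⁻¹ ≠ 1 := by
    intro e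
    apply hne
    have : m * b = b * m := by
      calc m * b = (m * b * m⁻¹ * b⁻¹) * (b * m) := by group
        _ = b * m := by rw [e, one_mul]
    exact this
  have hc := hmax _ (G.mul_mem (G.mul_mem (G.mul_mem hm hbG) (G.inv_mem hm)) (G.inv_mem hbG)) hc1
  have htb : SU2.tr b = SU2.tr m := by rw [hb]; simp
  rw [SU2.tr_commutator, htb] at hc
  have h3 : Real.sqrt 3 ^ 2 = 3 := Real.sq_sqrt (by norm_num)
  have h30 : 0 ≤ Real.sqrt 3 := Real.sqrt_nonneg 3
  have hm2 := SU2.tr_sq_lt m (SU2.ne_of_not_commute hne).1 (SU2.ne_of_not_commute hne).2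
  set t := SU2.tr m
  set z := SU2.tr (m * b)
  have ht3 : 3 ≤ t ^ 2 := by nlinarith
  have ht2 : t < 2 := by nlinarith
  have ht0 : 0 ≤ t := by linarith
  -- Four times the commutator trace equals (2z − t²)² + 8 − (4 − t²)², and maximality bounds it by
  -- 4t.
  have e1 : 4 * (2 - t) ≤ (4 - t ^ 2) ^ 2 := by nlinarith [sq_nonneg (2 * z - t ^ 2)]
  have e2 : (4 - t ^ 2) ^ 2 ≤ 4 - t ^ 2 := by nlinarith
  nlinarith

theorem SU2.IsSign.mul_comm {g : SU2} (h : SU2.IsSign g) (k : SU2) : g * k = k * g := by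
  rcases h with rfl | rfl
  · simp
  · exact SU2.negOne_comm k

theorem SU2.isSign_of_sq {g : SU2} (h : g * g = 1) : SU2.IsSign g :=
  SU2.eq_one_or_negOne_of_sq g h

theorem SU2.isSign_of_pow {g : SU2} {n : ℕ} (h : g ^ (2 * n) = 1) : SU2.IsSign (g ^ n) :=
  SU2.isSign_of_sq (by rw [← pow_add, ← two_mul, h])

/-- An element of order k ≥ 12 has a nontrivial power of trace 2 cos(2π/k) ≥ 2 cos(π/6) = √3. -/
theorem TraceBounded.orderOf_le {G : Subgroup SU2} [Finite G] (hG : TraceBounded G) {g : SU2}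
    (hg : g ∈ G) : 0 < orderOf g ∧ orderOf g ≤ 11 := by
  have hk : 0 < orderOf g := by
    have := orderOf_pos (⟨g, hg⟩ : G)
    rwa [← Subgroup.orderOf_coe] at this
  refine ⟨hk, ?_⟩
  by_contra! hlt
  obtain ⟨j, hj⟩ := SU2.exists_tr_pow_eq_cos g hk
  have hk' : (12 : ℝ) ≤ orderOf g := by exact_mod_cast hlt
  have hpi := Real.pi_pos
  have hpos : 0 < 2 * Real.pi / orderOf g := by positivity
  have hle : 2 * Real.pi / orderOf g ≤ Real.pi / 6 := by
    rw [div_le_iff₀ (by positivity)]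
    nlinarith
  have h1 : Real.cos (Real.pi / 6) ≤ Real.cos (2 * Real.pi / orderOf g) :=
    Real.cos_le_cos_of_nonneg_of_le_pi hpos.le (by linarith) hle
  have h2 : Real.cos (2 * Real.pi / orderOf g) < 1 := by
    rw [← Real.cos_zero]
    exact Real.cos_lt_cos_of_nonneg_of_le_pi le_rfl (by linarith) hpos
  have hne : g ^ j ≠ 1 := by
    intro e
    rw [e, SU2.tr_one] at hj
    linarith
  have := hG _ (G.pow_mem hg j) hne
  rw [Real.cos_pi_div_six] at h1
  linarith

theorem TraceBounded.isSign_pow {G : Subgroup SU2} [Finite G] (hG : TraceBounded G)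
    (hneg : SU2.negOne ∈ G) {g : SU2} (hg : g ∈ G) :
    SU2.IsSign (g ^ 3) ∨ SU2.IsSign (g ^ 4) ∨ SU2.IsSign (g ^ 5) := by
  obtain ⟨hk0, hk⟩ := hG.orderOf_le hg
  obtain ⟨hl0, hl⟩ := hG.orderOf_le (G.mul_mem hneg hg)
  have hcomm : Commute SU2.negOne g := SU2.negOne_comm g
  have hn2 : SU2.negOne ^ 2 = 1 := by rw [pow_two]; simp
  have h1 : orderOf g ∣ 2 * orderOf (SU2.negOne * g) := by
    apply orderOf_dvd_of_pow_eq_one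
    have e := hcomm.mul_pow (2 * orderOf (SU2.negOne * g))
    rw [pow_mul SU2.negOne, hn2, one_pow, one_mul, mul_comm 2, pow_mul, pow_orderOf_eq_one,
      one_pow] at e
    rw [mul_comm 2]; exact e.symm
  have h2 : orderOf (SU2.negOne * g) ∣ 2 * orderOf g := by
    apply orderOf_dvd_of_pow_eq_one
    rw [hcomm.mul_pow, pow_mul SU2.negOne, hn2, one_pow, one_mul, mul_comm 2, pow_mul,
      pow_orderOf_eq_one, one_pow]
  have h3 : orderOf g % 2 = 1 → ¬ orderOf (SU2.negOne * g) ∣ orderOf g := by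
    intro ho hd
    have e := orderOf_dvd_iff_pow_eq_one.1 hd
    rw [hcomm.mul_pow, pow_orderOf_eq_one, mul_one, ← Nat.div_add_mod (orderOf g) 2, ho, pow_add,
      pow_mul, hn2, one_pow, one_mul, pow_one] at e
    exact SU2.negOne_ne_one e
  have hg1 := pow_orderOf_eq_one g
  generalize orderOf g = k at *
  generalize orderOf (SU2.negOne * g) = l at *
  -- If k is odd, then −g has order 2k. Orders 7, 9 and 11 are impossible because the order of −g is
  -- also at most 11.
  have hcases : k = 1 ∨ k = 2 ∨ k = 3 ∨ k = 4 ∨ k = 5 ∨ k = 6 ∨ k = 8 ∨ k = 10 := by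
    by_contra! hc
    have : k = 7 ∨ k = 9 ∨ k = 11 := by omega
    rcases this with rfl | rfl | rfl <;> interval_cases l <;> revert h1 h2 h3 <;> decide
  have hpow (n : ℕ) (hn : k ∣ n) : g ^ n = 1 := by
    obtain ⟨c, rfl⟩ := hn
    rw [pow_mul, hg1, one_pow]
  rcases hcases with h | h | h | h | h | h | h | h
  · exact Or.inl (Or.inl (hpow 3 (by rw [h]; norm_num)))
  · exact Or.inr (Or.inl (Or.inl (hpow 4 (by rw [h]; norm_num))))
  · exact Or.inl (Or.inl (hpow 3 (by rw [h])))
  · exact Or.inr (Or.inl (Or.inl (hpow 4 (by rw [h]))))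
  · exact Or.inr (Or.inr (Or.inl (hpow 5 (by rw [h]))))
  · exact Or.inl (SU2.isSign_of_pow (hpow 6 (by rw [h])))
  · exact Or.inr (Or.inl (SU2.isSign_of_pow (hpow 8 (by rw [h]))))
  · exact Or.inr (Or.inr (SU2.isSign_of_pow (hpow 10 (by rw [h]))))

theorem SU2.pow_five_of_tr {g : SU2}
    (h : SU2.tr g = Real.goldenRatio ∨ SU2.tr g = 1 - Real.goldenRatio) : g ^ 5 = SU2.negOne := by
  apply Subtype.ext
  rw [SU2.coe_pow, pow_five_fin_two, SU2.trace_coe, (Matrix.mem_specialUnitaryGroup_iff.1 g.2).2]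
  have hs := Real.goldenRatio_sq
  have h2 : SU2.tr g ^ 2 = SU2.tr g + 1 := by
    rcases h with h | h <;> rw [h] <;> linear_combination hs
  have h2' : (SU2.tr g : ℂ) ^ 2 = SU2.tr g + 1 := by exact_mod_cast h2
  have e1 : (SU2.tr g : ℂ) ^ 4 - 3 * (SU2.tr g : ℂ) ^ 2 * 1 + 1 ^ 2 = 0 := by
    linear_combination ((SU2.tr g : ℂ) ^ 2 + SU2.tr g - 1) * h2'
  have e2 : -((SU2.tr g : ℂ) * ((SU2.tr g : ℂ) ^ 2 - 2 * 1) * 1) = -1 := by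
    linear_combination -((SU2.tr g : ℂ) + 1) * h2'
  rw [e1, e2]
  simp

theorem SU2.tr_of_pow_five_eq_negOne {g : SU2} (h : g ^ 5 = SU2.negOne) (hg : g ≠ SU2.negOne) :
    SU2.tr g = Real.goldenRatio ∨ SU2.tr g = 1 - Real.goldenRatio := by
  have hs : ¬ SU2.IsSign g := by
    rintro (rfl | rfl)
    · rw [one_pow] at h; exact SU2.negOne_ne_one h.symm
    · exact hg rfl
  have h1 := SU2.tr_of_pow_five hs (Or.inr h)
  have h2 := congrArg Subtype.val h
  rw [SU2.coe_pow, pow_five_fin_two, SU2.trace_coe,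
    (Matrix.mem_specialUnitaryGroup_iff.1 g.2).2] at h2
  have h1' : (SU2.tr g : ℂ) ^ 4 - 3 * (SU2.tr g : ℂ) ^ 2 * 1 + 1 ^ 2 = 0 := by
    have : ((SU2.tr g ^ 4 - 3 * SU2.tr g ^ 2 + 1 : ℝ) : ℂ) = 0 := by rw [h1]; simp
    push_cast at this; linear_combination this
  rw [h1', zero_smul, zero_add] at h2
  have h3 := congrFun (congrFun h2 0) 0
  simp at h3
  have h4 : SU2.tr g * (SU2.tr g ^ 2 - 2) = 1 := by exact_mod_cast h3
  have h5 : SU2.tr g ^ 2 - SU2.tr g - 1 = 0 := by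
    linear_combination SU2.tr g * h4 - h1
  have h6 : (SU2.tr g - Real.goldenRatio) * (SU2.tr g - (1 - Real.goldenRatio)) = 0 := by
    linear_combination h5 - Real.goldenRatio_sq
  rcases mul_eq_zero.1 h6 with h' | h'
  · exact Or.inl (by linarith)
  · exact Or.inr (by linarith)

theorem SU2.not_isSign_of_tr {g : SU2} (h : SU2.tr g ^ 2 ≠ 4) : ¬ SU2.IsSign g := by
  rintro (rfl | rfl) <;> norm_num at h

theorem SU2.tr_pow_two (g : SU2) : SU2.tr (g ^ 2) = SU2.tr g ^ 2 - 2 := by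
  have := SU2.tr_mul_add g g
  rw [mul_inv_cancel, SU2.tr_one, ← pow_two] at this
  linarith

theorem SU2.commute_of_sq_commute {a m : SU2} (ha : ¬ SU2.IsSign (a ^ 2))
    (h : m * a ^ 2 = a ^ 2 * m) : m * a = a * m :=
  SU2.commute_of_commute (fun e => ha (Or.inl e)) (fun e => ha (Or.inr e)) h.symm
    (by rw [← pow_succ, ← pow_succ'])

/-- In a group containing non-commuting elements of trace `φ`, every `m ≠ ±1` fails to commute with
some conjugate. -/
theorem exists_conj_not_commute {G : Subgroup SU2} {a b m : SU2} (ha : a ∈ G) (hb : b ∈ G)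
    (hab : a * b ≠ b * a) (ha2 : ¬ SU2.IsSign (a ^ 2)) (hb2 : ¬ SU2.IsSign (b ^ 2))
    (hm : ¬ SU2.IsSign m) : ∃ h ∈ G, m * (h * m * h⁻¹) ≠ h * m * h⁻¹ * m := by
  by_contra! hc
  -- A conjugate of m commuting with m is m or m⁻¹, so g² centralizes m. As g² is not central, g
  -- centralizes m too.
  have key (g : SU2) (hg : g ∈ G) (hg2 : ¬ SU2.IsSign (g ^ 2)) : m * g = g * m := by
    apply SU2.commute_of_sq_commute hg2
    have h2 : g ^ 2 * m * (g ^ 2)⁻¹ = m := by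
      have e : g ^ 2 * m * (g ^ 2)⁻¹ = g * (g * m * g⁻¹) * g⁻¹ := by
        simp only [pow_two, _root_.mul_inv_rev, mul_assoc]
      rcases SU2.eq_or_eq_inv_of_commute (hc g hg) (by simp) with h1 | h1
      · rw [e, h1, h1]
      · rw [e, h1, ← conj_inv, h1, inv_inv]
    calc m * g ^ 2 = g ^ 2 * m * (g ^ 2)⁻¹ * g ^ 2 := by rw [h2]
      _ = g ^ 2 * m := by group
  exact hab (SU2.commute_of_commute (fun e => hm (Or.inl e)) (fun e => hm (Or.inr e))
    (key a ha ha2) (key b hb hb2))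

theorem SU2.not_isSign_sq_of_tr {g : SU2} (h : SU2.tr g = Real.goldenRatio) :
    ¬ SU2.IsSign (g ^ 2) := by
  apply SU2.not_isSign_of_tr
  rw [SU2.tr_pow_two, h, Real.goldenRatio_sq]
  have := goldenRatio_bounds
  nlinarith

theorem negOne_mem_of_tr {G : Subgroup SU2} {a : SU2} (ha : a ∈ G)
    (hta : SU2.tr a = Real.goldenRatio) : SU2.negOne ∈ G := by
  rw [← SU2.pow_five_of_tr (Or.inl hta)]
  exact G.pow_mem ha 5

theorem traceBounded_of_tr_goldenRatio {G : Subgroup SU2} [Finite G] {a b : SU2} (ha : a ∈ G)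
    (hb : b ∈ G) (hta : SU2.tr a = Real.goldenRatio) (htb : SU2.tr b = Real.goldenRatio)
    (hab : a * b ≠ b * a) : TraceBounded G := by
  obtain ⟨m, hm, hm1, hmax⟩ := exists_max_tr G ha (SU2.ne_of_not_commute hab).1
  have hmt := hmax a ha (SU2.ne_of_not_commute hab).1
  have hms : ¬ SU2.IsSign m := by
    rintro (h | rfl)
    · exact hm1 h
    · rw [SU2.tr_negOne, hta] at hmt
      have := goldenRatio_bounds
      linarith
  obtain ⟨h, hh, hne⟩ := exists_conj_not_commute ha hb hab (SU2.not_isSign_sq_of_tr hta)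
    (SU2.not_isSign_sq_of_tr htb) hms
  exact traceBounded_of_max hm hh hmax hne

theorem TraceBounded.tr_cases {G : Subgroup SU2} [Finite G] (hG : TraceBounded G)
    (hneg : SU2.negOne ∈ G) {g : SU2} (hg : g ∈ G) (hs : ¬ SU2.IsSign g) :
    SU2.tr g ^ 2 = 1 ∨ SU2.tr g = 0 ∨ SU2.tr g ^ 2 = 2 ∨
      SU2.tr g ^ 4 - 3 * SU2.tr g ^ 2 + 1 = 0 := by
  rcases hG.isSign_pow hneg hg with h | h | h
  · exact Or.inl (SU2.tr_sq_eq_one hs h)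
  · rcases SU2.tr_of_pow_four hs h with h | h
    · exact Or.inr (Or.inl h)
    · exact Or.inr (Or.inr (Or.inl h))
  · exact Or.inr (Or.inr (Or.inr (SU2.tr_of_pow_five hs h)))

/-- The product of two non-commuting elements of trace `φ` has trace `1` or `φ`. -/
theorem TraceBounded.tr_mul {G : Subgroup SU2} [Finite G] (hG : TraceBounded G) {a b : SU2}
    (ha : a ∈ G) (hb : b ∈ G) (hta : SU2.tr a = Real.goldenRatio)
    (htb : SU2.tr b = Real.goldenRatio) (hab : a * b ≠ b * a) :
    SU2.tr (a * b) = 1 ∨ SU2.tr (a * b) = Real.goldenRatio := by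
  have hneg := negOne_mem_of_tr ha hta
  have hs1 : ¬ SU2.IsSign (a * b) := by
    intro h
    apply hab
    calc a * b = a⁻¹ * (a * (a * b)) := by group
      _ = b * a := by rw [← h.mul_comm a]; group
  have hs2 : ¬ SU2.IsSign (a * b⁻¹) := by
    intro h
    apply hab
    calc a * b = (a * b⁻¹ * b) * b := by group
      _ = b * a := by rw [h.mul_comm b]; group
  have hsum := SU2.tr_mul_add a b
  rw [hta, htb] at hsum
  have hz := hG _ (G.mul_mem ha hb) fun e => hs1 (Or.inl e)
  have hw := hG _ (G.mul_mem ha (G.inv_mem hb)) fun e => hs2 (Or.inl e)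
  have hzc := hG.tr_cases hneg (G.mul_mem ha hb) hs1
  have hwc := hG.tr_cases hneg (G.mul_mem ha (G.inv_mem hb)) hs2
  have h3 : Real.sqrt 3 < 1.7321 := by
    rw [Real.sqrt_lt' (by norm_num)]; norm_num
  have hφ := goldenRatio_bounds
  have hφ2 := Real.goldenRatio_sq
  set z := SU2.tr (a * b)
  set w := SU2.tr (a * b⁻¹)
  -- The two traces z and w sum to φ² ≈ 2.618 and are each below √3, so both exceed 0.88. Of the
  -- possible values only 1, √2 and φ remain.
  have hz0 : 0.88 < z := by nlinarith
  have hw0 : 0.88 < w := by nlinarith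
  rcases hzc with h | h | h | h
  · left; nlinarith
  · linarith
  -- If z = √2, then w = φ² − √2 ≈ 1.204, which is not a possible trace.
  · exfalso
    have hz1 : 1.414 < z := by nlinarith
    have hz2 : z < 1.415 := by nlinarith
    have hw1 : 1.2 < w := by nlinarith
    have hw2 : w < 1.21 := by nlinarith
    rcases hwc with h' | h' | h' | h'
    · nlinarith
    · linarith
    · nlinarith
    · have : 1.44 < w ^ 2 := by nlinarith
      have : w ^ 2 < 1.4641 := by nlinarith
      nlinarith
  · right
    have h1 : (z ^ 2 - z - 1) * (z ^ 2 + z - 1) = 0 := by linear_combination h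
    have h2 : z ^ 2 + z - 1 ≠ 0 := by nlinarith
    have h3 := (mul_eq_zero.1 h1).resolve_right h2
    have h4 : (z - Real.goldenRatio) * (z + Real.goldenRatio - 1) = 0 := by
      linear_combination h3 - hφ2
    rcases mul_eq_zero.1 h4 with h' | h'
    · linarith
    · linarith

end SpinCode

end

noncomputable section

namespace SpinCode

open Matrix

/-! ### Explicit computations in the binary icosahedral group -/

/-- The quaternion `w + x i + y j + z k` as a `2 × 2` matrix. -/
def quat (w x y z : ℝ) : Matrix (Fin 2) (Fin 2) ℂ :=
  !![w + x * Complex.I, y + z * Complex.I; -y + z * Complex.I, w - x * Complex.I]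

theorem quat_mul (w x y z a b c d : ℝ) : quat w x y z * quat a b c d =
    quat (w * a - x * b - y * c - z * d) (w * b + x * a + y * d - z * c)
      (w * c - x * d + y * a + z * b) (w * d + x * c - y * b + z * a) := by
  have hI := Complex.I_mul_I
  ext i j
  fin_cases i <;> fin_cases j <;> simp [quat, Matrix.mul_apply, Fin.sum_univ_two]
  · linear_combination (x * b + z * d : ℂ) * hI
  · linear_combination (x * d - z * b : ℂ) * hI
  · linear_combination (z * b - x * d : ℂ) * hI
  · linear_combination (z * d + x * b : ℂ) * hI

theorem quat_mem {w x y z : ℝ} (h : w ^ 2 + x ^ 2 + y ^ 2 + z ^ 2 = 1) :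
    quat w x y z ∈ Matrix.specialUnitaryGroup (Fin 2) ℂ := by
  have hI := Complex.I_mul_I
  have h' : (w : ℂ) ^ 2 + x ^ 2 + y ^ 2 + z ^ 2 = 1 := by exact_mod_cast h
  have hm := mem_SU2 (w + x * Complex.I) (-y + z * Complex.I) (by
    simp only [Complex.star_def, map_add, map_neg, map_mul, Complex.conj_ofReal, Complex.conj_I]
    linear_combination h' - ((x : ℂ) ^ 2 + z ^ 2) * hI)
  convert hm using 1
  ext i j
  fin_cases i <;> fin_cases j <;> simp [quat]
  · ring
  · ring

theorem SU2.exists_quat (g : SU2) : ∃ w x y z : ℝ, g.1 = quat w x y z ∧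
    w ^ 2 + x ^ 2 + y ^ 2 + z ^ 2 = 1 := by
  refine ⟨(g.1 0 0).re, (g.1 0 0).im, -(g.1 1 0).re, (g.1 1 0).im, ?_, ?_⟩
  · have h0 := SU2.coe_zero_one g
    have h1 := SU2.coe_one_one g
    ext i j
    fin_cases i <;> fin_cases j
    · simp [quat]
    · simp [quat, h0]; apply Complex.ext <;> simp
    · simp [quat]
    · simp [quat, h1]; apply Complex.ext <;> simp
  · have := SU2.normSq_add g
    rw [Complex.normSq_apply, Complex.normSq_apply] at this
    linarith

theorem SU2.tr_of_quat {g : SU2} {w x y z : ℝ} (h : g.1 = quat w x y z) : SU2.tr g = 2 * w := by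
  simp [SU2.tr, h, quat]

theorem SU2.inv_of_quat {g : SU2} {w x y z : ℝ} (h : g.1 = quat w x y z) :
    (g⁻¹).1 = quat w (-x) (-y) (-z) := by
  rw [SU2.inv_eq, SU2.tr_of_quat h, h]
  ext i j
  fin_cases i <;> fin_cases j <;> simp [quat] <;> ring

theorem SU2.mul_of_quat {g h : SU2} {w x y z a b c d : ℝ} (hg : g.1 = quat w x y z)
    (hh : h.1 = quat a b c d) : (g * h).1 =
    quat (w * a - x * b - y * c - z * d) (w * b + x * a + y * d - z * c)
      (w * c - x * d + y * a + z * b) (w * d + x * c - y * b + z * a) := by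
  rw [← quat_mul, ← hg, ← hh]; rfl

theorem quat_congr {w x y z a b c d : ℝ} (h0 : w = a) (h1 : x = b) (h2 : y = c) (h3 : z = d) :
    quat w x y z = quat a b c d := by
  rw [h0, h1, h2, h3]

theorem quat_injective {w x y z a b c d : ℝ} (h : quat w x y z = quat a b c d) :
    w = a ∧ x = b ∧ y = c ∧ z = d := by
  have h0 := congrFun (congrFun h 0) 0
  have h1 := congrFun (congrFun h 0) 1
  simp only [quat, Matrix.of_apply, Matrix.cons_val', Matrix.cons_val_zero, Matrix.cons_val_one,
    Matrix.cons_val_fin_one] at h0 h1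
  have a0 := congrArg Complex.re h0
  have a1 := congrArg Complex.im h0
  have a2 := congrArg Complex.re h1
  have a3 := congrArg Complex.im h1
  simp at a0 a1 a2 a3
  exact ⟨a0, a1, a2, a3⟩

def elX : SU2 := ⟨matX, matX_mem⟩
def elZ : SU2 := ⟨matZ, matZ_mem⟩
def elF : SU2 := ⟨matF, matF_mem⟩
def elPhi : SU2 := ⟨matPhi, matPhi_mem⟩

theorem elX_coe : elX.1 = quat 0 0 0 (-1) := by
  ext i j
  fin_cases i <;> fin_cases j <;> simp [elX, matX, quat]

theorem elZ_coe : elZ.1 = quat 0 (-1) 0 0 := by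
  ext i j
  fin_cases i <;> fin_cases j <;> simp [elZ, matZ, quat]

theorem elF_coe : elF.1 = quat (1 / 2) (-1 / 2) (-1 / 2) (-1 / 2) := by
  have hI := Complex.I_mul_I
  ext i j
  fin_cases i <;> fin_cases j <;> simp [elF, matF, quat]
  · ring
  · linear_combination (1 / 2 : ℂ) * hI
  · ring
  · linear_combination (-1 / 2 : ℂ) * hI

theorem inv_goldenRatio_eq : (Real.goldenRatio)⁻¹ = Real.goldenRatio - 1 := by
  rw [Real.inv_goldenRatio]
  linear_combination - Real.goldenRatio_add_goldenConj

theorem elPhi_coe : elPhi.1 =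
    quat (Real.goldenRatio / 2) ((Real.goldenRatio - 1) / 2) (1 / 2) 0 := by
  have hp : (Real.goldenRatio : ℂ)⁻¹ = (Real.goldenRatio : ℂ) - 1 := by
    rw [← Complex.ofReal_inv, inv_goldenRatio_eq]; simp
  change matPhi = _
  rw [matPhi, hp]
  generalize Real.goldenRatio = r
  ext i j
  fin_cases i <;> fin_cases j <;> simp [quat] <;> ring

theorem twoI_eq : twoI = Subgroup.closure {elX, elZ, elF, elPhi} := rfl

theorem elX_mem : elX ∈ twoI := Subgroup.subset_closure (by simp [elX])
theorem elZ_mem : elZ ∈ twoI := Subgroup.subset_closure (by simp [elZ])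
theorem elF_mem : elF ∈ twoI := Subgroup.subset_closure (by simp [elF])
theorem elPhi_mem : elPhi ∈ twoI := Subgroup.subset_closure (by simp [elPhi])

/-- The conjugate of `Φ` by `F`. -/
def elPsi : SU2 := elF * elPhi * elF⁻¹

theorem elPsi_mem : elPsi ∈ twoI :=
  twoI.mul_mem (twoI.mul_mem elF_mem elPhi_mem) (twoI.inv_mem elF_mem)

theorem elPhi_tr : SU2.tr elPhi = Real.goldenRatio := by
  rw [SU2.tr_of_quat elPhi_coe]; ring

theorem elPsi_tr : SU2.tr elPsi = Real.goldenRatio := by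
  rw [elPsi, SU2.tr_conj, elPhi_tr]

theorem elPhi_mul_elPsi_tr : SU2.tr (elPhi * elPsi) = 1 := by
  have h := Real.goldenRatio_sq
  rw [elPsi, SU2.tr_of_quat (SU2.mul_of_quat elPhi_coe (SU2.mul_of_quat
    (SU2.mul_of_quat elF_coe elPhi_coe) (SU2.inv_of_quat elF_coe)))]
  linear_combination (1 / 2 : ℝ) * h

theorem elX_conj_elPhi : elX * elPhi * elX⁻¹ = elPhi⁻¹ := by
  apply Subtype.ext
  rw [SU2.mul_of_quat (SU2.mul_of_quat elX_coe elPhi_coe) (SU2.inv_of_quat elX_coe),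
    SU2.inv_of_quat elPhi_coe]
  apply quat_congr <;> ring

/-- This and the next two lemmas write the other generators as words in `elPhi` and `elPsi`. Each is
rearranged into an identity that is checked in quaternion coordinates modulo φ² = φ + 1. -/
theorem elF_eq : elF = elPhi⁻¹ * elPsi⁻¹ := by
  have h := Real.goldenRatio_sq
  have key : elPhi * elF * elF * elPhi = elF := by
    apply Subtype.ext
    rw [SU2.mul_of_quat (SU2.mul_of_quat (SU2.mul_of_quat elPhi_coe elF_coe) elF_coe) elPhi_coe,
      elF_coe]
    generalize Real.goldenRatio = r at h
    apply quat_congr <;> grind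
  calc elF = elPhi⁻¹ * (elPhi * elF * elF * elPhi) * elPhi⁻¹ * elF⁻¹ := by group
    _ = elPhi⁻¹ * elPsi⁻¹ := by rw [key, elPsi]; group

theorem elZ_eq : elZ = elPsi⁻¹ * elPsi⁻¹ * elPhi⁻¹ := by
  have h := Real.goldenRatio_sq
  have key : elPhi * elPhi * elF⁻¹ * elZ * elPhi = elF⁻¹ := by
    apply Subtype.ext
    rw [SU2.mul_of_quat (SU2.mul_of_quat (SU2.mul_of_quat (SU2.mul_of_quat elPhi_coe elPhi_coe)
      (SU2.inv_of_quat elF_coe)) elZ_coe) elPhi_coe, SU2.inv_of_quat elF_coe]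
    generalize Real.goldenRatio = r at h
    apply quat_congr <;> grind
  calc elZ = elF * elPhi⁻¹ * elPhi⁻¹ * (elPhi * elPhi * elF⁻¹ * elZ * elPhi) * elPhi⁻¹ :=
        by group
    _ = elPsi⁻¹ * elPsi⁻¹ * elPhi⁻¹ := by rw [key, elPsi]; group

theorem elX_eq : elX = elPsi * elPhi⁻¹ * elPhi⁻¹ * elPsi⁻¹ * elPsi⁻¹ := by
  have h := Real.goldenRatio_sq
  have key : elX * elF * elPhi * elPhi = elF * elPhi * elF⁻¹ * elPhi⁻¹ * elPhi⁻¹ * elF := by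
    apply Subtype.ext
    rw [SU2.mul_of_quat (SU2.mul_of_quat (SU2.mul_of_quat elX_coe elF_coe) elPhi_coe) elPhi_coe,
      SU2.mul_of_quat (SU2.mul_of_quat (SU2.mul_of_quat (SU2.mul_of_quat (SU2.mul_of_quat
      elF_coe elPhi_coe) (SU2.inv_of_quat elF_coe)) (SU2.inv_of_quat elPhi_coe))
      (SU2.inv_of_quat elPhi_coe)) elF_coe]
    generalize Real.goldenRatio = r at h
    apply quat_congr <;> grind
  calc elX = elX * elF * elPhi * elPhi * elPhi⁻¹ * elPhi⁻¹ * elF⁻¹ := by group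
    _ = _ := by rw [key, elPsi]; group

theorem twoI_eq_closure_pair : twoI = Subgroup.closure {elPhi, elPsi} := by
  have h1 : elPhi ∈ Subgroup.closure {elPhi, elPsi} := Subgroup.subset_closure (by simp)
  have h2 : elPsi ∈ Subgroup.closure {elPhi, elPsi} := Subgroup.subset_closure (by simp)
  apply le_antisymm
  · rw [twoI_eq, Subgroup.closure_le]
    rintro g (rfl | rfl | rfl | rfl)
    · rw [elX_eq]
      exact mul_mem (mul_mem (mul_mem (mul_mem h2 (inv_mem h1)) (inv_mem h1)) (inv_mem h2))
        (inv_mem h2)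
    · rw [elZ_eq]
      exact mul_mem (mul_mem (inv_mem h2) (inv_mem h2)) (inv_mem h1)
    · rw [elF_eq]
      exact mul_mem (inv_mem h1) (inv_mem h2)
    · exact h1
  · rw [Subgroup.closure_le]
    rintro g (rfl | rfl)
    · exact elPhi_mem
    · exact elPsi_mem

/-- Among the six conjugates `h Φ h⁻¹` (one for each five-fold axis), every `c` of trace `φ` has
one with trace of the product not equal to `1` or `φ`. -/
theorem exists_axis (c : SU2) (hc : SU2.tr c = Real.goldenRatio) : ∃ h ∈ twoI,
    SU2.tr (c * (h * elPhi * h⁻¹)) ≠ 1 ∧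
      SU2.tr (c * (h * elPhi * h⁻¹)) ≠ Real.goldenRatio := by
  have hφ := Real.goldenRatio_sq
  obtain ⟨w, x, y, z, hq, hn⟩ := SU2.exists_quat c
  have hw : w = Real.goldenRatio / 2 := by
    rw [SU2.tr_of_quat hq] at hc; linarith
  subst hw
  by_contra! hall
  -- The excluded traces are symmetric about φ²/2, since 2 − φ² = 1 − φ and 2φ − φ² = φ − 1. Either
  -- one prescribes the same squared inner product of (x, y, z) with the axis.
  have sq (h : SU2) (hh : h ∈ twoI) : (2 * SU2.tr (c * (h * elPhi * h⁻¹)) -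
      Real.goldenRatio ^ 2) ^ 2 = (Real.goldenRatio - 1) ^ 2 := by
    by_cases h1 : SU2.tr (c * (h * elPhi * h⁻¹)) = 1
    · rw [h1]
      linear_combination (Real.goldenRatio ^ 2 + Real.goldenRatio - 3) * hφ
    · rw [hall h hh h1]
      linear_combination (Real.goldenRatio ^ 2 - 3 * Real.goldenRatio + 1) * hφ
  have hF2 := SU2.mul_of_quat elF_coe elF_coe
  have hFZ := SU2.mul_of_quat elF_coe elZ_coe
  have hF2Z := SU2.mul_of_quat hF2 elZ_coe
  have hone : (1 : SU2).1 = quat 1 0 0 0 := by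
    ext i j
    fin_cases i <;> fin_cases j <;> simp [quat]
  have trq (h : SU2) {a b e d : ℝ} (hh : h.1 = quat a b e d) := SU2.tr_of_quat
    (SU2.mul_of_quat hq (SU2.mul_of_quat (SU2.mul_of_quat hh elPhi_coe) (SU2.inv_of_quat hh)))
  have s1 := sq 1 twoI.one_mem
  have s2 := sq elZ elZ_mem
  have s3 := sq elF elF_mem
  have s4 := sq (elF * elF) (twoI.mul_mem elF_mem elF_mem)
  have s5 := sq (elF * elZ) (twoI.mul_mem elF_mem elZ_mem)
  have s6 := sq (elF * elF * elZ) (twoI.mul_mem (twoI.mul_mem elF_mem elF_mem) elZ_mem)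
  have t1 : SU2.tr (c * (1 * elPhi * 1⁻¹)) =
      Real.goldenRatio ^ 2 / 2 - ((Real.goldenRatio - 1) * x + y) := by
    rw [trq 1 hone]; ring
  have t2 : SU2.tr (c * (elZ * elPhi * elZ⁻¹)) =
      Real.goldenRatio ^ 2 / 2 - ((Real.goldenRatio - 1) * x - y) := by
    rw [trq _ elZ_coe]; ring
  have t3 : SU2.tr (c * (elF * elPhi * elF⁻¹)) =
      Real.goldenRatio ^ 2 / 2 - (x + (Real.goldenRatio - 1) * z) := by
    rw [trq _ elF_coe]; ring
  have t4 : SU2.tr (c * (elF * elF * elPhi * (elF * elF)⁻¹)) =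
      Real.goldenRatio ^ 2 / 2 - ((Real.goldenRatio - 1) * y + z) := by
    rw [trq _ hF2]; ring
  have t5 : SU2.tr (c * (elF * elZ * elPhi * (elF * elZ)⁻¹)) =
      Real.goldenRatio ^ 2 / 2 - (-x + (Real.goldenRatio - 1) * z) := by
    rw [trq _ hFZ]; ring
  have t6 : SU2.tr (c * (elF * elF * elZ * elPhi * (elF * elF * elZ)⁻¹)) =
      Real.goldenRatio ^ 2 / 2 - ((Real.goldenRatio - 1) * y - z) := by
    rw [trq _ hF2Z]; ring
  rw [t1] at s1
  rw [t2] at s2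
  rw [t3] at s3
  rw [t4] at s4
  rw [t5] at s5
  rw [t6] at s6
  -- The six axes form a tight frame, so the squared inner products add up to a multiple of x² + y²
  -- + z². That norm is fixed by the trace of c and does not fit.
  have hsum : 8 * (1 + (Real.goldenRatio - 1) ^ 2) * (x ^ 2 + y ^ 2 + z ^ 2) =
      6 * (Real.goldenRatio - 1) ^ 2 := by
    linear_combination s1 + s2 + s3 + s4 + s5 + s6
  have hxyz : x ^ 2 + y ^ 2 + z ^ 2 = 1 - (Real.goldenRatio / 2) ^ 2 := by linarith
  rw [hxyz] at hsum
  have hb := goldenRatio_bounds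
  nlinarith

end SpinCode

end

noncomputable section

namespace SpinCode

open Matrix


/-! ### The Galois conjugate embedding -/

/-- An element of the icosian order, with coordinates `n` and `r` a root of `r² = r + 1`. -/
def icosian (r : ℝ) (n : Fin 8 → ℤ) : Matrix (Fin 2) (Fin 2) ℂ :=
  quat ((2 * (n 0 + n 1 * r) + (n 4 + n 5 * r) + r * (n 6 + n 7 * r)) / 2)
    ((-(n 4 + n 5 * r) + (r - 1) * (n 6 + n 7 * r)) / 2)
    ((-(n 4 + n 5 * r) + (n 6 + n 7 * r)) / 2)
    ((-2 * (n 2 + n 3 * r) - (n 4 + n 5 * r)) / 2)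

/-- The coordinates of `icosian` refer to the ℤ[r]-basis 1, X, F, Φ. Left multiplication by each
generator and its inverse acts on them by integer formulas that are the same for both roots r; this
makes the Galois conjugation multiplicative. -/
theorem quat_mul_icosian_X {r : ℝ} (hr : r ^ 2 = r + 1) (n : Fin 8 → ℤ) :
    quat 0 0 0 (-1) * icosian r n = icosian r
    ![-(n 2) - 2 * n 4 - 3 * n 5 + 2 * n 6 + 2 * n 7,
      -(n 3) - 3 * n 4 - 5 * n 5 + 2 * n 6 + 4 * n 7, n 0 - n 5 + n 6 + n 7,
      n 1 - n 4 - n 5 + n 6 + 2 * n 7, n 4 + 2 * n 5 - 2 * n 6 - n 7,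
      2 * n 4 + 3 * n 5 - n 6 - 3 * n 7, 2 * n 4 + 2 * n 5 - n 6 - 2 * n 7,
      2 * n 4 + 4 * n 5 - 2 * n 6 - 3 * n 7] := by
  rw [icosian, icosian, quat_mul]
  simp
  apply quat_congr <;> grind

theorem quat_mul_icosian_Xinv {r : ℝ} (hr : r ^ 2 = r + 1) (n : Fin 8 → ℤ) :
    quat 0 (-(0)) (-(0)) (-(-1)) * icosian r n = icosian r
    ![n 2 + 2 * n 4 + 3 * n 5 - 2 * n 6 - 2 * n 7, n 3 + 3 * n 4 + 5 * n 5 - 2 * n 6 - 4 * n 7,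
      -(n 0) + n 5 - n 6 - n 7, -(n 1) + n 4 + n 5 - n 6 - 2 * n 7,
      -(n 4) - 2 * n 5 + 2 * n 6 + n 7, -(2 * n 4) - 3 * n 5 + n 6 + 3 * n 7,
      -(2 * n 4) - 2 * n 5 + n 6 + 2 * n 7, -(2 * n 4) - 4 * n 5 + 2 * n 6 + 3 * n 7] := by
  rw [icosian, icosian, quat_mul]
  simp
  apply quat_congr <;> grind

theorem quat_mul_icosian_Z {r : ℝ} (hr : r ^ 2 = r + 1) (n : Fin 8 → ℤ) :
    quat 0 (-1) 0 0 * icosian r n = icosian r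
    ![-(2 * n 0) - 3 * n 1 + n 2 + 3 * n 3 - n 4 - 2 * n 6 - 2 * n 7,
      -(3 * n 0) - 5 * n 1 + 3 * n 2 + 4 * n 3 - n 5 - 2 * n 6 - 4 * n 7,
      -(n 0) - n 1 + n 3 - n 4 - n 7, -(n 0) - 2 * n 1 + n 2 + n 3 - n 5 - n 6 - n 7,
      2 * n 0 + 2 * n 1 - 2 * n 3 + n 4 + n 6 + 2 * n 7,
      2 * n 0 + 4 * n 1 - 2 * n 2 - 2 * n 3 + n 5 + 2 * n 6 + 3 * n 7,
      2 * n 0 + 2 * n 1 - 2 * n 2 - 2 * n 3 + n 6 + 2 * n 7,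
      2 * n 0 + 4 * n 1 - 2 * n 2 - 4 * n 3 + 2 * n 6 + 3 * n 7] := by
  rw [icosian, icosian, quat_mul]
  simp
  apply quat_congr <;> grind

theorem quat_mul_icosian_Zinv {r : ℝ} (hr : r ^ 2 = r + 1) (n : Fin 8 → ℤ) :
    quat 0 (-(-1)) (-(0)) (-(0)) * icosian r n = icosian r
    ![2 * n 0 + 3 * n 1 - n 2 - 3 * n 3 + n 4 + 2 * n 6 + 2 * n 7,
      3 * n 0 + 5 * n 1 - 3 * n 2 - 4 * n 3 + n 5 + 2 * n 6 + 4 * n 7,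
      n 0 + n 1 - n 3 + n 4 + n 7, n 0 + 2 * n 1 - n 2 - n 3 + n 5 + n 6 + n 7,
      -(2 * n 0) - 2 * n 1 + 2 * n 3 - n 4 - n 6 - 2 * n 7,
      -(2 * n 0) - 4 * n 1 + 2 * n 2 + 2 * n 3 - n 5 - 2 * n 6 - 3 * n 7,
      -(2 * n 0) - 2 * n 1 + 2 * n 2 + 2 * n 3 - n 6 - 2 * n 7,
      -(2 * n 0) - 4 * n 1 + 2 * n 2 + 4 * n 3 - 2 * n 6 - 3 * n 7] := by
  rw [icosian, icosian, quat_mul]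
  simp
  apply quat_congr <;> grind

theorem quat_mul_icosian_F {r : ℝ} (hr : r ^ 2 = r + 1) (n : Fin 8 → ℤ) :
    quat (1 / 2) (-1 / 2) (-1 / 2) (-1 / 2) * icosian r n = icosian r
    ![n 2 + 3 * n 3 - n 4 + n 6 + n 7, 3 * n 2 + 4 * n 3 - n 5 + n 6 + 2 * n 7,
      n 2 + n 3 + n 6, n 2 + 2 * n 3 + n 7, n 0 - n 2 - 2 * n 3 + n 4 - n 6,
      n 1 - 2 * n 2 - 3 * n 3 + n 5 - n 7, -(2 * n 2) - 2 * n 3 - n 7,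
      -(2 * n 2) - 4 * n 3 - n 6 - n 7] := by
  rw [icosian, icosian, quat_mul]
  simp
  apply quat_congr <;> grind

theorem quat_mul_icosian_Finv {r : ℝ} (hr : r ^ 2 = r + 1) (n : Fin 8 → ℤ) :
    quat (1 / 2) (-(-1 / 2)) (-(-1 / 2)) (-(-1 / 2)) * icosian r n = icosian r
    ![n 0 - n 2 - 3 * n 3 + n 4 - n 6 - n 7, n 1 - 3 * n 2 - 4 * n 3 + n 5 - n 6 - 2 * n 7,
      -(n 3) - n 6, -(n 2) - n 3 - n 7, -(n 0) + n 2 + 2 * n 3 + n 6,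
      -(n 1) + 2 * n 2 + 3 * n 3 + n 7, 2 * n 2 + 2 * n 3 + n 6 + n 7,
      2 * n 2 + 4 * n 3 + n 6 + 2 * n 7] := by
  rw [icosian, icosian, quat_mul]
  simp
  apply quat_congr <;> grind

theorem quat_mul_icosian_P {r : ℝ} (hr : r ^ 2 = r + 1) (n : Fin 8 → ℤ) :
    quat (r / 2) ((r - 1) / 2) (1 / 2) 0 * icosian r n = icosian r
    ![-(2 * n 2) - 2 * n 3 - n 4 - n 5 - n 6, -(2 * n 2) - 4 * n 3 - n 4 - 2 * n 5 - n 7,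
      -(n 2) - n 4, -(n 3) - n 5, 2 * n 2 + n 3 + n 4 + n 5, n 2 + 3 * n 3 + n 4 + 2 * n 5,
      n 0 + n 2 + 2 * n 3 + n 4 + n 5 + n 7,
      n 1 + 2 * n 2 + 3 * n 3 + n 4 + 2 * n 5 + n 6 + n 7] := by
  rw [icosian, icosian, quat_mul]
  simp
  apply quat_congr <;> grind

theorem quat_mul_icosian_Pinv {r : ℝ} (hr : r ^ 2 = r + 1) (n : Fin 8 → ℤ) :
    quat (r / 2) (-((r - 1) / 2)) (-(1 / 2)) (-(0)) * icosian r n = icosian r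
    ![n 1 + 2 * n 2 + 2 * n 3 + n 4 + n 5 + n 6,
      n 0 + n 1 + 2 * n 2 + 4 * n 3 + n 4 + 2 * n 5 + n 7, n 2 + n 3 + n 4,
      n 2 + 2 * n 3 + n 5, -(2 * n 2) - n 3 - n 4, -(n 2) - 3 * n 3 - n 5,
      -(n 0) - n 2 - 2 * n 3 - n 4 - n 5, -(n 1) - 2 * n 2 - 3 * n 3 - n 4 - 2 * n 5] := by
  rw [icosian, icosian, quat_mul]
  simp
  apply quat_congr <;> grind

end SpinCode

end

noncomputable section

namespace SpinCode

open Matrix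

/-! ### Maximality and characterization of binary icosahedral groups -/

theorem elPhi_not_commute_elPsi : elPhi * elPsi ≠ elPsi * elPhi := by
  intro h
  have hb := goldenRatio_bounds
  have ht := elPhi_mul_elPsi_tr
  rcases SU2.eq_or_eq_inv_of_commute h (elPsi_tr.trans elPhi_tr.symm) with e | e
  · rw [e, ← pow_two, SU2.tr_pow_two, elPhi_tr, Real.goldenRatio_sq] at ht
    linarith
  · rw [e, mul_inv_cancel, SU2.tr_one] at ht
    linarith

theorem SU2.IsSign.pow_two {g : SU2} (h : SU2.IsSign g) : g ^ 2 = 1 := by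
  rcases h with rfl | rfl
  · simp
  · rw [_root_.pow_two]; simp

theorem elPhi_pow_ten : elPhi ^ 10 = 1 := by
  rw [show 10 = 5 * 2 by norm_num, pow_mul, SU2.pow_five_of_tr (Or.inl elPhi_tr), pow_two]; simp

theorem elPhi_pow_ne {n : ℕ} (hn : Nat.gcd n 10 = 2) : elPhi ^ n ≠ 1 := by
  intro h
  have := pow_gcd_eq_one.2 ⟨h, elPhi_pow_ten⟩
  rw [hn] at this
  exact SU2.not_isSign_sq_of_tr elPhi_tr (Or.inl this)

theorem negOne_mem_twoI : SU2.negOne ∈ twoI := negOne_mem_of_tr elPhi_mem elPhi_tr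

/-- The rotation w has the same axis as Φ, and the restrictions on w and wΦ make it a tenth root of
unity around that axis, hence a power of Φ. -/
theorem mem_twoI_of_commute {w : SU2} (hw : w * elPhi = elPhi * w)
    (h1 : SU2.IsSign (w ^ 3) ∨ SU2.IsSign (w ^ 4) ∨ SU2.IsSign (w ^ 5))
    (h2 : SU2.IsSign ((w * elPhi) ^ 3) ∨ SU2.IsSign ((w * elPhi) ^ 4) ∨
      SU2.IsSign ((w * elPhi) ^ 5)) : w ∈ twoI := by
  have hc : Commute w elPhi := hw
  -- Otherwise w and wΦ both have trivial 24th power, hence so has Φ, whose order is 10.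
  have h10 : w ^ 10 = 1 := by
    by_contra hne
    have hw24 : w ^ 24 = 1 := by
      rcases h1 with h | h | h
      · have := h.pow_two
        rw [← pow_mul] at this
        rw [show 24 = 3 * 2 * 4 by norm_num, pow_mul, this, one_pow]
      · have := h.pow_two
        rw [← pow_mul] at this
        rw [show 24 = 4 * 2 * 3 by norm_num, pow_mul, this, one_pow]
      · have := h.pow_two
        rw [← pow_mul] at this
        exact absurd this hne
    have hp24 : (w * elPhi) ^ 24 = 1 := by
      rcases h2 with h | h | h
      · have := h.pow_two
        rw [← pow_mul] at this
        rw [show 24 = 3 * 2 * 4 by norm_num, pow_mul, this, one_pow]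
      · have := h.pow_two
        rw [← pow_mul] at this
        rw [show 24 = 4 * 2 * 3 by norm_num, pow_mul, this, one_pow]
      · have := h.pow_two
        rw [← pow_mul, hc.mul_pow] at this
        simp only [Nat.reduceMul] at this
        rw [elPhi_pow_ten, mul_one] at this
        exact absurd this hne
    rw [hc.mul_pow, hw24, one_mul] at hp24
    exact elPhi_pow_ne (by norm_num) hp24
  have h5 : SU2.IsSign (w ^ 5) := SU2.isSign_of_pow h10
  by_cases hs : SU2.IsSign w
  · rcases hs with rfl | rfl
    · exact twoI.one_mem
    · exact negOne_mem_twoI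
  have ht := SU2.tr_of_pow_five hs h5
  have hφ := Real.goldenRatio_sq
  have key (s p : SU2) (hp : p ∈ twoI) (hsp : p * s = s * p) (hst : SU2.tr s = SU2.tr p) :
      s ∈ twoI := by
    rcases SU2.eq_or_eq_inv_of_commute hsp hst with rfl | rfl
    · exact hp
    · exact twoI.inv_mem hp
  have hcneg : (SU2.negOne * w) * elPhi = elPhi * (SU2.negOne * w) := by
    rw [mul_assoc, hw, ← mul_assoc, SU2.negOne_comm, mul_assoc]
  have hneg (h : SU2.negOne * w ∈ twoI) : w ∈ twoI := by
    have := twoI.mul_mem negOne_mem_twoI h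
    rwa [← mul_assoc, SU2.negOne_mul_self, one_mul] at this
  -- The four roots are the traces of ±Φ and ±Φ². An element commuting with Φ and having the trace
  -- of one of these is that element or its inverse.
  have hfac : (SU2.tr w - Real.goldenRatio) * (SU2.tr w + Real.goldenRatio) *
      ((SU2.tr w - (Real.goldenRatio - 1)) * (SU2.tr w + (Real.goldenRatio - 1))) = 0 := by
    linear_combination ht + (-(2 * SU2.tr w ^ 2) + Real.goldenRatio ^ 2 - Real.goldenRatio + 1) * hφ
  have ht2 : SU2.tr (elPhi ^ 2) = Real.goldenRatio - 1 := by
    rw [SU2.tr_pow_two, elPhi_tr]; linarith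
  have hsq (s : SU2) (h : s * elPhi = elPhi * s) : elPhi ^ 2 * s = s * elPhi ^ 2 :=
    ((show Commute s elPhi from h).pow_right 2).symm
  rcases mul_eq_zero.1 hfac with h | h <;> rcases mul_eq_zero.1 h with h | h
  · exact key w elPhi elPhi_mem hw.symm (by rw [elPhi_tr]; linarith)
  · exact hneg (key _ elPhi elPhi_mem hcneg.symm (by rw [elPhi_tr, SU2.tr_negOne_mul]; linarith))
  · exact key w (elPhi ^ 2) (twoI.pow_mem elPhi_mem 2) (hsq w hw) (by rw [ht2]; linarith)
  · exact hneg (key _ (elPhi ^ 2) (twoI.pow_mem elPhi_mem 2) (hsq _ hcneg)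
      (by rw [ht2, SU2.tr_negOne_mul]; linarith))

/-- `2I` is a maximal finite subgroup of `SU(2)`. -/
theorem eq_twoI_of_le (G : Subgroup SU2) [Finite G] (h : twoI ≤ G) : G = twoI := by
  have hG : TraceBounded G := traceBounded_of_tr_goldenRatio (h elPhi_mem) (h elPsi_mem) elPhi_tr
    elPsi_tr elPhi_not_commute_elPsi
  have hneg := h negOne_mem_twoI
  refine le_antisymm (fun g hg => ?_) h
  have hct : SU2.tr (g * elPhi * g⁻¹) = Real.goldenRatio := by rw [SU2.tr_conj, elPhi_tr]
  -- For this k the trace of the product is one that `TraceBounded.tr_mul` forbids for noncommuting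
  -- elements. So g carries the axis of Φ to a five-fold axis of 2I.
  obtain ⟨k, hk, hk1, hk2⟩ := exists_axis (g * elPhi * g⁻¹) hct
  have hcomm : (g * elPhi * g⁻¹) * (k * elPhi * k⁻¹) = (k * elPhi * k⁻¹) * (g * elPhi * g⁻¹) := by
    by_contra hne
    rcases hG.tr_mul (G.mul_mem (G.mul_mem hg (h elPhi_mem)) (G.inv_mem hg))
      (G.mul_mem (G.mul_mem (h hk) (h elPhi_mem)) (G.inv_mem (h hk))) hct
      (by rw [SU2.tr_conj, elPhi_tr]) hne with e | e
    · exact hk1 e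
    · exact hk2 e
  obtain ⟨l, hl, hle⟩ : ∃ l ∈ twoI, g * elPhi * g⁻¹ = l * elPhi * l⁻¹ := by
    rcases SU2.eq_or_eq_inv_of_commute hcomm.symm (by simp) with e | e
    · exact ⟨k, hk, e⟩
    -- X reverses the axis of Φ, which absorbs the inverse.
    · refine ⟨k * elX, twoI.mul_mem hk elX_mem, ?_⟩
      rw [e, conj_inv, ← elX_conj_elPhi]; group
  have hw : (l⁻¹ * g) * elPhi = elPhi * (l⁻¹ * g) := by
    calc (l⁻¹ * g) * elPhi = l⁻¹ * (g * elPhi * g⁻¹) * g := by group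
      _ = elPhi * (l⁻¹ * g) := by rw [hle]; group
  have hwG : l⁻¹ * g ∈ G := G.mul_mem (G.inv_mem (h hl)) hg
  have := mem_twoI_of_commute hw (hG.isSign_pow hneg hwG)
    (hG.isSign_pow hneg (G.mul_mem hwG (h elPhi_mem)))
  have h2 := twoI.mul_mem hl this
  rwa [mul_inv_cancel_left] at h2

theorem finite_map_conj (G : Subgroup SU2) [Finite G] (u : SU2) :
    Finite (G.map (MulAut.conj u).toMonoidHom) :=
  Set.Finite.to_subtype ((Set.toFinite (G : Set SU2)).image _)

theorem map_conj_inv_map_conj (G : Subgroup SU2) (u : SU2) :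
    (G.map (MulAut.conj u).toMonoidHom).map (MulAut.conj u⁻¹).toMonoidHom = G := by
  rw [Subgroup.map_map]
  convert Subgroup.map_id G using 2
  ext1 x
  simp [mul_assoc]

/-- A finite subgroup of `SU(2)` containing two non-commuting elements of trace `φ` is binary
icosahedral. -/
theorem isBinaryIcosahedral_of_tr (G : Subgroup SU2) [Finite G] {a b : SU2} (ha : a ∈ G)
    (hb : b ∈ G) (hta : SU2.tr a = Real.goldenRatio) (htb : SU2.tr b = Real.goldenRatio)
    (hab : a * b ≠ b * a) : IsBinaryIcosahedral G := by
  have hG := traceBounded_of_tr_goldenRatio ha hb hta htb hab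
  obtain ⟨c, hc, htc, htac, hac⟩ : ∃ c ∈ G, SU2.tr c = Real.goldenRatio ∧ SU2.tr (a * c) = 1 ∧
      a * c ≠ c * a := by
    rcases hG.tr_mul ha hb hta htb hab with h | h
    · exact ⟨b, hb, htb, h, hab⟩
    -- The traces of ab and ab⁻¹ add up to φ² = φ + 1, so exactly one choice gives trace 1, the
    -- value of the standard pair.
    · refine ⟨b⁻¹, G.inv_mem hb, by rw [SU2.tr_inv, htb], ?_, ?_⟩
      · have := SU2.tr_mul_add a b
        rw [h, hta, htb] at this
        have hφ := Real.goldenRatio_sq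
        nlinarith
      · intro e
        apply hab
        calc a * b = b * (b⁻¹ * a) * b := by group
          _ = b * a := by rw [← e]; group
  obtain ⟨u, hu1, hu2⟩ := SU2.exists_conj_pair (hta.trans elPhi_tr.symm)
    (htc.trans elPsi_tr.symm) (htac.trans elPhi_mul_elPsi_tr.symm) hac
  have := finite_map_conj G u
  have hle : twoI ≤ G.map (MulAut.conj u).toMonoidHom := by
    rw [twoI_eq_closure_pair, Subgroup.closure_le]
    rintro g (rfl | rfl)
    · exact ⟨a, ha, hu1⟩
    · exact ⟨c, hc, hu2⟩
  refine ⟨u⁻¹, ?_⟩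
  rw [← eq_twoI_of_le _ hle, map_conj_inv_map_conj]

/-- Standard generators of a binary icosahedral group. -/
theorem IsBinaryIcosahedral.exists_generators {G : Subgroup SU2} (hG : IsBinaryIcosahedral G) :
    ∃ a b h x : SU2, a ∈ G ∧ h ∈ G ∧ x ∈ G ∧ b = h * a * h⁻¹ ∧ x * a * x⁻¹ = a⁻¹ ∧
      SU2.tr a = Real.goldenRatio ∧ SU2.tr (a * b) = 1 ∧ a * b ≠ b * a ∧
      G = Subgroup.closure {a, b} := by
  obtain ⟨u, rfl⟩ := hG
  have hm {g : SU2} (hg : g ∈ twoI) : u * g * u⁻¹ ∈ twoI.map (MulAut.conj u).toMonoidHom :=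
    ⟨g, hg, rfl⟩
  refine ⟨u * elPhi * u⁻¹, u * elPsi * u⁻¹, u * elF * u⁻¹, u * elX * u⁻¹, hm elPhi_mem, hm elF_mem,
    hm elX_mem, ?_, ?_, ?_, ?_, ?_, ?_⟩
  · rw [elPsi]; group
  · rw [show (u * elPhi * u⁻¹)⁻¹ = u * elPhi⁻¹ * u⁻¹ by group, ← elX_conj_elPhi]; group
  · rw [SU2.tr_conj, elPhi_tr]
  · rw [show u * elPhi * u⁻¹ * (u * elPsi * u⁻¹) = u * (elPhi * elPsi) * u⁻¹ by group, SU2.tr_conj,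
      elPhi_mul_elPsi_tr]
  · intro e
    apply elPhi_not_commute_elPsi
    have : u * (elPhi * elPsi) * u⁻¹ = u * (elPsi * elPhi) * u⁻¹ := by
      calc u * (elPhi * elPsi) * u⁻¹ = u * elPhi * u⁻¹ * (u * elPsi * u⁻¹) := by group
        _ = u * elPsi * u⁻¹ * (u * elPhi * u⁻¹) := e
        _ = _ := by group
    exact mul_left_cancel (mul_right_cancel this)
  · rw [twoI_eq_closure_pair, MonoidHom.map_closure, Set.image_pair]
    rfl

end SpinCode

end

noncomputable section

namespace SpinCode

open Matrix

/-! ### Embeddings and automorphisms of binary icosahedral groups -/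

theorem SU2.tr_pow_three (g : SU2) : SU2.tr (g ^ 3) = SU2.tr g ^ 3 - 3 * SU2.tr g := by
  have h := SU2.tr_mul_add (g ^ 2) g
  rw [← pow_succ, SU2.tr_pow_two, pow_two, mul_inv_cancel_right] at h
  linarith

theorem SU2.pow_three_of_tr {g : SU2} (h : SU2.tr g = 1) : g ^ 3 = SU2.negOne := by
  apply SU2.eq_negOne_of_tr
  rw [SU2.tr_pow_three, h]; norm_num

theorem SU2.tr_of_pow_three_eq_negOne {g : SU2} (h : g ^ 3 = SU2.negOne) (hg : g ≠ SU2.negOne) :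
    SU2.tr g = 1 := by
  have h1 := SU2.tr_pow_three g
  rw [h, SU2.tr_negOne] at h1
  have h2 : (SU2.tr g - 1) * ((SU2.tr g - 1) * (SU2.tr g + 2)) = 0 := by linear_combination -h1
  have h3 : SU2.tr g + 2 ≠ 0 := fun e => hg (SU2.eq_negOne_of_tr g (by linarith))
  rcases mul_eq_zero.1 h2 with h' | h'
  · linarith
  · linarith [(mul_eq_zero.1 h').resolve_right h3]

theorem map_negOne_of_injective {G : Subgroup SU2} (f : G →* SU2) (hf : Function.Injective f)
    (hneg : SU2.negOne ∈ G) : f ⟨SU2.negOne, hneg⟩ = SU2.negOne := by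
  have h1 : f ⟨SU2.negOne, hneg⟩ * f ⟨SU2.negOne, hneg⟩ = 1 := by
    rw [← map_mul, ← map_one f]
    exact congrArg f (Subtype.ext SU2.negOne_mul_self)
  rcases SU2.eq_one_or_negOne_of_sq _ h1 with h | h
  · rw [← map_one f] at h
    exact absurd (congrArg Subtype.val (hf h)) SU2.negOne_ne_one
  · exact h

theorem map_ne_negOne_of_injective {G : Subgroup SU2} (f : G →* SU2) (hf : Function.Injective f)
    (hneg : SU2.negOne ∈ G) {a : G} (ha : (a : SU2) ≠ SU2.negOne) : f a ≠ SU2.negOne := by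
  intro h
  rw [← map_negOne_of_injective f hf hneg] at h
  exact ha (congrArg Subtype.val (hf h))

theorem tr_map_goldenRatio {G : Subgroup SU2} (f : G →* SU2) (hf : Function.Injective f) (a : G)
    (ha : SU2.tr (a : SU2) = Real.goldenRatio) :
    SU2.tr (f a) = Real.goldenRatio ∨ SU2.tr (f a) = 1 - Real.goldenRatio := by
  have hneg := negOne_mem_of_tr a.2 ha
  apply SU2.tr_of_pow_five_eq_negOne
  · rw [← map_pow, ← map_negOne_of_injective f hf hneg]
    exact congrArg f (Subtype.ext (SU2.pow_five_of_tr (Or.inl ha)))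
  · apply map_ne_negOne_of_injective f hf hneg
    intro e
    rw [e, SU2.tr_negOne] at ha
    linarith [goldenRatio_bounds]

theorem tr_map_one {G : Subgroup SU2} (f : G →* SU2) (hf : Function.Injective f)
    (hneg : SU2.negOne ∈ G) (c : G) (hc : SU2.tr (c : SU2) = 1) : SU2.tr (f c) = 1 := by
  apply SU2.tr_of_pow_three_eq_negOne
  · rw [← map_pow, ← map_negOne_of_injective f hf hneg]
    exact congrArg f (Subtype.ext (SU2.pow_three_of_tr hc))
  · apply map_ne_negOne_of_injective f hf hneg
    intro e
    rw [e, SU2.tr_negOne] at hc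
    linarith

theorem mem_map_conj_iff {G : Subgroup SU2} {u g : SU2} :
    g ∈ G.map (MulAut.conj u).toMonoidHom ↔ u⁻¹ * g * u ∈ G := by
  constructor
  · rintro ⟨x, hx, rfl⟩
    simpa [mul_assoc] using hx
  · intro h
    exact ⟨_, h, by simp [mul_assoc]⟩

/-- An injective homomorphism from a finite binary icosahedral group to `SU(2)` is, up to
conjugation, an automorphism. -/
theorem IsBinaryIcosahedral.exists_mulAut {G : Subgroup SU2} [Finite G]
    (hG : IsBinaryIcosahedral G) (f : G →* SU2) (hf : Function.Injective f) :
    ∃ (u : SU2) (α : MulAut G), ∀ g : G, f g = u * (α g : SU2) * u⁻¹ := by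
  obtain ⟨a, b, h, x, ha, hh, hx, hb, -, hta, htab, hne, hcl⟩ := hG.exists_generators
  have hbG : b ∈ G := by rw [hb]; exact G.mul_mem (G.mul_mem hh ha) (G.inv_mem hh)
  set a' : G := ⟨a, ha⟩
  set b' : G := ⟨b, hbG⟩
  have hb' : b' = ⟨h, hh⟩ * a' * ⟨h, hh⟩⁻¹ := Subtype.ext hb
  have htb : SU2.tr (f b') = SU2.tr (f a') := by rw [hb']; simp
  have hne' : f a' * f b' ≠ f b' * f a' := by
    intro e
    rw [← map_mul, ← map_mul] at e
    exact hne (congrArg Subtype.val (hf e))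
  have : Finite f.range := Set.Finite.to_subtype (Set.finite_range f)
  have hrange : IsBinaryIcosahedral f.range := by
    rcases tr_map_goldenRatio f hf a' hta with ht | ht
    · exact isBinaryIcosahedral_of_tr f.range ⟨a', rfl⟩ ⟨b', rfl⟩ ht (htb.trans ht) hne'
    -- Cubing turns trace 1 − φ into trace φ. It loses nothing, since such g satisfies g¹⁰ = 1 and
    -- hence g²¹ = g.
    · have h3 (g : SU2) (hg : SU2.tr g = 1 - Real.goldenRatio) :
          SU2.tr (g ^ 3) = Real.goldenRatio ∧ (g ^ 3) ^ 7 = g := by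
        constructor
        · rw [SU2.tr_pow_three, hg]
          linear_combination (2 - Real.goldenRatio) * Real.goldenRatio_sq
        · rw [← pow_mul, show 3 * 7 = 5 * 2 * 2 + 1 by norm_num, pow_succ, pow_mul, pow_mul,
            SU2.pow_five_of_tr (Or.inr hg)]
          simp [pow_two]
      have hA := h3 _ ht
      have hB := h3 _ (htb.trans ht)
      refine isBinaryIcosahedral_of_tr f.range ⟨a' ^ 3, map_pow _ _ _⟩ ⟨b' ^ 3, map_pow _ _ _⟩
        hA.1 hB.1 fun e => hne' ?_
      have hc : Commute (f a' ^ 3) (f b' ^ 3) := e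
      have := hc.pow_pow 7 7
      rwa [hA.2, hB.2] at this
  obtain ⟨w, hw⟩ := hrange
  obtain ⟨v, hv⟩ := hG
  have hmem (g : G) : (w * v⁻¹)⁻¹ * f g * (w * v⁻¹) ∈ G := by
    refine (Subgroup.ext_iff.1 hv _).2 (mem_map_conj_iff.2 ?_)
    have : f g ∈ f.range := ⟨g, rfl⟩
    rw [hw, mem_map_conj_iff] at this
    convert this using 1
    group
  let β : G →* G :=
    { toFun := fun g => ⟨_, hmem g⟩
      map_one' := by apply Subtype.ext; simp
      map_mul' := fun g k => by
        apply Subtype.ext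
        simp only [map_mul, Subgroup.coe_mul]
        group }
  have hβ : Function.Injective β := by
    intro g k e
    have e' := congrArg Subtype.val e
    exact hf (mul_left_cancel (mul_right_cancel e'))
  refine ⟨w * v⁻¹, MulEquiv.ofBijective β (Finite.injective_iff_bijective.1 hβ), fun g => ?_⟩
  change f g = w * v⁻¹ * ((w * v⁻¹)⁻¹ * f g * (w * v⁻¹)) * (w * v⁻¹)⁻¹
  group

theorem IsBinaryIcosahedral.eq_of_le {G H : Subgroup SU2} [Finite H] (hG : IsBinaryIcosahedral G)
    (h : G ≤ H) : H = G := by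
  obtain ⟨u, rfl⟩ := hG
  have := finite_map_conj H u⁻¹
  have h1 := eq_twoI_of_le (H.map (MulAut.conj u⁻¹).toMonoidHom) (by
    intro g hg
    rw [mem_map_conj_iff]
    exact h ⟨g, hg, by simp⟩)
  have h2 := map_conj_inv_map_conj H u⁻¹
  rw [h1, inv_inv] at h2
  exact h2.symm

/-- Finite binary icosahedral groups are self-normalizing in `SU(2)`. -/
theorem IsBinaryIcosahedral.mem_of_normalizes {G : Subgroup SU2} [Finite G]
    (hG : IsBinaryIcosahedral G) {u : SU2} (hu : ∀ g ∈ G, u * g * u⁻¹ ∈ G) : u ∈ G := by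
  obtain ⟨a, b, h, x, ha, hh, hx, hb, -, hta, htab, hne, hcl⟩ := hG.exists_generators
  have hbG : b ∈ G := by rw [hb]; exact G.mul_mem (G.mul_mem hh ha) (G.inv_mem hh)
  -- The conjugates of a and b determine v up to sign, because only scalars commute with both. Hence
  -- the normalizer is finite and maximality applies.
  have hfin : {v : SU2 | v * a * v⁻¹ ∈ G ∧ v * b * v⁻¹ ∈ G}.Finite := by
    refine Set.Finite.preimage' (f := fun v : SU2 => (v * a * v⁻¹, v * b * v⁻¹))
      (s := (G : Set SU2) ×ˢ (G : Set SU2)) (Set.Finite.prod (Set.toFinite _) (Set.toFinite _)) ?_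
    rintro ⟨p, q⟩ -
    by_cases hex : ∃ v : SU2, (v * a * v⁻¹, v * b * v⁻¹) = (p, q)
    · obtain ⟨v, hv⟩ := hex
      refine (Set.toFinite {v, v * SU2.negOne}).subset fun w hw => ?_
      have hw' : (w * a * w⁻¹, w * b * w⁻¹) = (v * a * v⁻¹, v * b * v⁻¹) := Eq.trans hw hv.symm
      have h1 := congrArg Prod.fst hw'
      have h2 := congrArg Prod.snd hw'
      have hc (c : SU2) (hc : w * c * w⁻¹ = v * c * v⁻¹) :
          (v⁻¹ * w).1 * c.1 = c.1 * (v⁻¹ * w).1 := by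
        have : (v⁻¹ * w) * c = c * (v⁻¹ * w) := by
          calc (v⁻¹ * w) * c = v⁻¹ * (w * c * w⁻¹) * w := by group
            _ = c * (v⁻¹ * w) := by rw [hc]; group
        exact congrArg Subtype.val this
      obtain ⟨k, hk⟩ := exists_eq_smul_one_of_commute
        (fun e => hne (Subtype.ext e) : a.1 * b.1 ≠ b.1 * a.1) (hc a h1) (hc b h2)
      by_contra hn
      simp only [Set.mem_insert_iff, Set.mem_singleton_iff, not_or] at hn
      refine SU2.coe_ne_smul_one (g := v⁻¹ * w) ?_ ?_ k hk
      · intro e; exact hn.1 (inv_mul_eq_one.1 e).symm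
      · intro e; exact hn.2 (by rw [← e]; group)
    · convert Set.finite_empty
      ext v
      simp only [Set.mem_preimage, Set.mem_singleton_iff, Set.mem_empty_iff_false, iff_false]
      exact fun e => hex ⟨v, e⟩
  let H : Subgroup SU2 := Subgroup.normalizer G
  have : Finite H := by
    refine Set.Finite.to_subtype (hfin.subset fun v hv => ?_)
    exact ⟨(Subgroup.mem_normalizer_iff.1 hv a).1 ha, (Subgroup.mem_normalizer_iff.1 hv b).1 hbG⟩
  rw [← hG.eq_of_le (H := H) Subgroup.le_normalizer]
  rw [Subgroup.mem_normalizer_iff]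
  have hle : G.map (MulAut.conj u).toMonoidHom ≤ G := by
    rintro _ ⟨g, hg, rfl⟩
    exact hu g hg
  have := finite_map_conj G u
  intro g
  refine ⟨hu g, fun hg => ?_⟩
  have hbi : IsBinaryIcosahedral (G.map (MulAut.conj u).toMonoidHom) := by
    obtain ⟨v, rfl⟩ := hG
    refine ⟨u * v, ?_⟩
    rw [Subgroup.map_map]
    congr 1
    ext1 y
    simp [mul_assoc]
  rw [hbi.eq_of_le hle, mem_map_conj_iff] at hg
  simpa [mul_assoc] using hg

/-- A non-inner automorphism of a binary icosahedral group exchanges the traces `φ` and `1 - φ`. -/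
theorem IsBinaryIcosahedral.tr_of_not_inner {G : Subgroup SU2} [Finite G]
    (hG : IsBinaryIcosahedral G) (α : MulAut G) (hα : ∀ h : G, α ≠ MulAut.conj h) {a b h : SU2}
    (ha : a ∈ G) (hh : h ∈ G) (hb : b = h * a * h⁻¹) (hta : SU2.tr a = Real.goldenRatio)
    (htab : SU2.tr (a * b) = 1) (hne : a * b ≠ b * a) (hcl : G = Subgroup.closure {a, b}) :
    SU2.tr (α ⟨a, ha⟩ : SU2) = 1 - Real.goldenRatio := by
  have hneg := negOne_mem_of_tr ha hta
  have hbG : b ∈ G := by rw [hb]; exact G.mul_mem (G.mul_mem hh ha) (G.inv_mem hh)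
  set f : G →* SU2 := G.subtype.comp α.toMonoidHom with hfdef
  have hf : Function.Injective f := G.subtype_injective.comp α.injective
  refine (tr_map_goldenRatio f hf ⟨a, ha⟩ hta).resolve_left fun ht => ?_
  have hb' : (⟨b, hbG⟩ : G) = ⟨h, hh⟩ * ⟨a, ha⟩ * ⟨h, hh⟩⁻¹ := Subtype.ext hb
  have htb : SU2.tr b = Real.goldenRatio := by rw [hb, SU2.tr_conj, hta]
  have htb' : SU2.tr (f ⟨b, hbG⟩) = Real.goldenRatio := by
    rw [hb', map_mul, map_mul, map_inv, SU2.tr_conj, ht]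
  have hab := tr_map_one f hf hneg (⟨a, ha⟩ * ⟨b, hbG⟩) htab
  rw [map_mul] at hab
  -- If α preserved the trace of a, it would preserve those of b and ab as well. Then α would be
  -- conjugation by some u in SU(2), and u lies in G because G is self-normalizing.
  obtain ⟨u, hu1, hu2⟩ := SU2.exists_conj_pair (hta.trans ht.symm) (htb.trans htb'.symm)
    (htab.trans hab.symm) hne
  have hall : ∀ g (hg : g ∈ Subgroup.closure {a, b}), f ⟨g, hcl ▸ hg⟩ = u * g * u⁻¹ := by
    intro g hg
    induction hg using Subgroup.closure_induction with
    | mem g hg =>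
      rcases hg with rfl | rfl
      · exact hu1.symm
      · exact hu2.symm
    | one => rw [show (⟨1, _⟩ : G) = 1 from rfl, map_one]; simp
    | mul g k hg hk ihg ihk =>
      have e : (⟨g * k, hcl ▸ Subgroup.mul_mem _ hg hk⟩ : G) =
        ⟨g, hcl ▸ hg⟩ * ⟨k, hcl ▸ hk⟩ := rfl
      rw [e, map_mul, ihg, ihk]; group
    | inv g hg ih =>
      have e : (⟨g⁻¹, hcl ▸ Subgroup.inv_mem _ hg⟩ : G) = ⟨g, hcl ▸ hg⟩⁻¹ := rfl
      rw [e, map_inv, ih]; group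
  have hall' (g : G) : f g = u * g * u⁻¹ := hall g (hcl ▸ g.2)
  have hu : u ∈ G := hG.mem_of_normalizes fun g hg => by
    rw [← hall' ⟨g, hg⟩]
    exact (α ⟨g, hg⟩).2
  apply hα ⟨u, hu⟩
  ext1 g
  apply Subtype.ext
  exact hall' g

end SpinCode

end

/-! ### Finiteness of 2I and its outer automorphism from Galois conjugation -/

noncomputable section

namespace SpinCode

open Matrix

/-- The Galois conjugate of `Φ`. -/
def elPhiConj : SU2 :=
  ⟨quat ((1 - Real.goldenRatio) / 2) ((1 - Real.goldenRatio - 1) / 2) (1 / 2) 0,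
    quat_mem (by linear_combination (1 / 2 : ℝ) * Real.goldenRatio_sq)⟩

theorem elPhiConj_coe : elPhiConj.1 =
    quat ((1 - Real.goldenRatio) / 2) ((1 - Real.goldenRatio - 1) / 2) (1 / 2) 0 := rfl

theorem elPhiConj_tr : SU2.tr elPhiConj = 1 - Real.goldenRatio := by
  rw [SU2.tr_of_quat elPhiConj_coe]; ring

/-- The graph of the Galois conjugation on `2I`. -/
def galoisGraph : Subgroup (SU2 × SU2) :=
  Subgroup.closure {(elX, elX), (elZ, elZ), (elF, elF), (elPhi, elPhiConj)}

theorem exists_icosian_of_mem {p : SU2 × SU2} (hp : p ∈ galoisGraph) :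
    ∃ n : Fin 8 → ℤ, p.1.1 = icosian Real.goldenRatio n ∧
      p.2.1 = icosian (1 - Real.goldenRatio) n := by
  have h1 := Real.goldenRatio_sq
  have h2 : (1 - Real.goldenRatio) ^ 2 = (1 - Real.goldenRatio) + 1 := by linear_combination h1
  induction hp using Subgroup.closure_induction_left with
  | one =>
    refine ⟨![1, 0, 0, 0, 0, 0, 0, 0], ?_, ?_⟩ <;>
    · rw [icosian]
      ext i j
      fin_cases i <;> fin_cases j <;> simp [quat]
  | mul_left g hg k hk ih =>
    obtain ⟨n, hn1, hn2⟩ := ih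
    rcases hg with rfl | rfl | rfl | rfl
    · exact ⟨_, (congrArg₂ (· * ·) elX_coe hn1).trans (quat_mul_icosian_X h1 n),
        (congrArg₂ (· * ·) elX_coe hn2).trans (quat_mul_icosian_X h2 n)⟩
    · exact ⟨_, (congrArg₂ (· * ·) elZ_coe hn1).trans (quat_mul_icosian_Z h1 n),
        (congrArg₂ (· * ·) elZ_coe hn2).trans (quat_mul_icosian_Z h2 n)⟩
    · exact ⟨_, (congrArg₂ (· * ·) elF_coe hn1).trans (quat_mul_icosian_F h1 n),
        (congrArg₂ (· * ·) elF_coe hn2).trans (quat_mul_icosian_F h2 n)⟩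
    · exact ⟨_, (congrArg₂ (· * ·) elPhi_coe hn1).trans (quat_mul_icosian_P h1 n),
        (congrArg₂ (· * ·) elPhiConj_coe hn2).trans (quat_mul_icosian_P h2 n)⟩
  | inv_mul_cancel g hg k hk ih =>
    obtain ⟨n, hn1, hn2⟩ := ih
    rcases hg with rfl | rfl | rfl | rfl
    · exact ⟨_, (congrArg₂ (· * ·) (SU2.inv_of_quat elX_coe) hn1).trans (quat_mul_icosian_Xinv h1 n),
        (congrArg₂ (· * ·) (SU2.inv_of_quat elX_coe) hn2).trans (quat_mul_icosian_Xinv h2 n)⟩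
    · exact ⟨_, (congrArg₂ (· * ·) (SU2.inv_of_quat elZ_coe) hn1).trans (quat_mul_icosian_Zinv h1 n),
        (congrArg₂ (· * ·) (SU2.inv_of_quat elZ_coe) hn2).trans (quat_mul_icosian_Zinv h2 n)⟩
    · exact ⟨_, (congrArg₂ (· * ·) (SU2.inv_of_quat elF_coe) hn1).trans (quat_mul_icosian_Finv h1 n),
        (congrArg₂ (· * ·) (SU2.inv_of_quat elF_coe) hn2).trans (quat_mul_icosian_Finv h2 n)⟩
    · exact ⟨_, (congrArg₂ (· * ·) (SU2.inv_of_quat elPhi_coe) hn1).trans (quat_mul_icosian_Pinv h1 n),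
        (congrArg₂ (· * ·) (SU2.inv_of_quat elPhiConj_coe) hn2).trans (quat_mul_icosian_Pinv h2 n)⟩

/-- The difference of the two conjugates is B(2φ − 1) = B√5. An element of ℤ[φ] with both conjugates
bounded lies in a finite set. -/
theorem int_bound_of_goldenRatio {A B : ℤ} (h1 : |(A : ℝ) + B * Real.goldenRatio| ≤ 2)
    (h2 : |(A : ℝ) + B * (1 - Real.goldenRatio)| ≤ 2) : -4 ≤ A ∧ A ≤ 4 ∧ -4 ≤ B ∧ B ≤ 4 := by
  have hb := goldenRatio_bounds
  rw [abs_le] at h1 h2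
  generalize Real.goldenRatio = r at *
  have hB1 : (B : ℝ) < 2 := by nlinarith
  have hB2 : (-2 : ℝ) < B := by nlinarith
  have hB1' : B < 2 := by exact_mod_cast hB1
  have hB2' : -2 < B := by exact_mod_cast hB2
  have hA1 : (A : ℝ) < 5 := by nlinarith
  have hA2 : (-5 : ℝ) < A := by nlinarith
  have hA1' : A < 5 := by exact_mod_cast hA1
  have hA2' : -5 < A := by exact_mod_cast hA2
  omega

theorem SU2.abs_le_of_quat {g : SU2} {w x y z : ℝ} (h : g.1 = quat w x y z) :
    |2 * w| ≤ 2 ∧ |2 * x| ≤ 2 ∧ |2 * y| ≤ 2 ∧ |2 * z| ≤ 2 := by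
  obtain ⟨a, b, c, d, hq, hn⟩ := SU2.exists_quat g
  obtain ⟨rfl, rfl, rfl, rfl⟩ := quat_injective (h.symm.trans hq)
  simp only [abs_le]
  refine ⟨⟨?_, ?_⟩, ⟨?_, ?_⟩, ⟨?_, ?_⟩, ⟨?_, ?_⟩⟩ <;>
    nlinarith [sq_nonneg w, sq_nonneg x, sq_nonneg y, sq_nonneg z]

/-- Twice the coordinates of an icosian, as elements of `ℤ[r]`. -/
theorem icosian_coords {r : ℝ} (hr : r ^ 2 = r + 1) (n : Fin 8 → ℤ) : icosian r n =
    quat ((((2 * n 0 + n 4 + n 7 : ℤ) : ℝ) + ((2 * n 1 + n 5 + n 6 + n 7 : ℤ) : ℝ) * r) / 2)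
      ((((n 7 - n 6 - n 4 : ℤ) : ℝ) + ((n 6 - n 5 : ℤ) : ℝ) * r) / 2)
      ((((n 6 - n 4 : ℤ) : ℝ) + ((n 7 - n 5 : ℤ) : ℝ) * r) / 2)
      ((((-2 * n 2 - n 4 : ℤ) : ℝ) + ((-2 * n 3 - n 5 : ℤ) : ℝ) * r) / 2) := by
  rw [icosian]
  push_cast
  apply quat_congr
  · linear_combination ((n 7 : ℝ) / 2) * hr
  · linear_combination ((n 7 : ℝ) / 2) * hr
  · ring
  · ring

theorem icosian_bound {p : SU2 × SU2} {n : Fin 8 → ℤ} (h1 : p.1.1 = icosian Real.goldenRatio n)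
    (h2 : p.2.1 = icosian (1 - Real.goldenRatio) n) (i : Fin 8) : -40 ≤ n i ∧ n i ≤ 40 := by
  have hr1 := Real.goldenRatio_sq
  have hr2 : (1 - Real.goldenRatio) ^ 2 = (1 - Real.goldenRatio) + 1 := by linear_combination hr1
  rw [icosian_coords hr1] at h1
  rw [icosian_coords hr2] at h2
  obtain ⟨a1, a2, a3, a4⟩ := SU2.abs_le_of_quat h1
  obtain ⟨b1, b2, b3, b4⟩ := SU2.abs_le_of_quat h2
  rw [mul_div_cancel₀ _ (two_ne_zero)] at a1 a2 a3 a4 b1 b2 b3 b4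
  have c1 := int_bound_of_goldenRatio a1 b1
  have c2 := int_bound_of_goldenRatio a2 b2
  have c3 := int_bound_of_goldenRatio a3 b3
  have c4 := int_bound_of_goldenRatio a4 b4
  fin_cases i <;> simp only [Fin.zero_eta, Fin.mk_one, Fin.reduceFinMk] <;> omega

/-- Both components are unit quaternions, so both conjugates of every doubled coordinate have
absolute value at most 2. This bounds the eight integers that determine the pair; the constant 40 is
generous. -/
theorem finite_galoisGraph : Finite galoisGraph := by
  choose n hn1 hn2 using fun p : galoisGraph => exists_icosian_of_mem p.2
  have hfin : Finite (Set.Icc (fun _ : Fin 8 => (-40 : ℤ)) (fun _ => 40)) :=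
    (Set.finite_Icc _ _).to_subtype
  refine Finite.of_injective (β := Set.Icc (fun _ : Fin 8 => (-40 : ℤ)) (fun _ => 40))
    (fun p => ⟨n p, fun i => (icosian_bound (hn1 p) (hn2 p) i).1,
      fun i => (icosian_bound (hn1 p) (hn2 p) i).2⟩) fun p q h => ?_
  have h' : n p = n q := congrArg Subtype.val h
  apply Subtype.ext
  apply Prod.ext <;> apply Subtype.ext
  · rw [hn1, hn1, h']
  · rw [hn2, hn2, h']

theorem int_eq_of_irrational {r x : ℝ} (hr : Irrational r) {A B C : ℤ}
    (h : x = ((A : ℝ) + B * r) / 2) (hx : 2 * x = C) : A = C ∧ B = 0 := by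
  have h' : (A : ℝ) + B * r = C := by linarith
  have hB : B = 0 := by
    by_contra hB
    have hB' : (B : ℝ) ≠ 0 := by exact_mod_cast hB
    apply hr
    refine ⟨((C - A : ℤ) : ℚ) / (B : ℚ), ?_⟩
    push_cast
    rw [div_eq_iff hB']
    linear_combination -h'
  refine ⟨?_, hB⟩
  rw [hB] at h'
  simpa using h'

theorem one_coe_eq_quat : (1 : SU2).1 = quat 1 0 0 0 := by
  ext i j
  fin_cases i <;> fin_cases j <;> simp [quat]

theorem icosian_eq_one_of_irrational {r s : ℝ} (hr : r ^ 2 = r + 1) (hs : s ^ 2 = s + 1)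
    (hirr : Irrational r) {n : Fin 8 → ℤ} (h : icosian r n = (1 : SU2).1) :
    icosian s n = (1 : SU2).1 := by
  rw [icosian_coords hr, one_coe_eq_quat] at h
  obtain ⟨a1, a2, a3, a4⟩ := quat_injective h
  obtain ⟨b1, c1⟩ := int_eq_of_irrational (C := 2) hirr a1.symm (by norm_num)
  obtain ⟨b2, c2⟩ := int_eq_of_irrational (C := 0) hirr a2.symm (by norm_num)
  obtain ⟨b3, c3⟩ := int_eq_of_irrational (C := 0) hirr a3.symm (by norm_num)
  obtain ⟨b4, c4⟩ := int_eq_of_irrational (C := 0) hirr a4.symm (by norm_num)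
  rw [icosian_coords hs, one_coe_eq_quat, b1, b2, b3, b4, c1, c2, c3, c4]
  apply quat_congr <;> simp

/-- Both roots are irrational, so being 1 is a condition on the integer coordinates alone. This
makes the subgroup the graph of an injective homomorphism. -/
theorem galoisGraph_eq_one_iff {p : SU2 × SU2} (hp : p ∈ galoisGraph) : p.1 = 1 ↔ p.2 = 1 := by
  obtain ⟨n, h1, h2⟩ := exists_icosian_of_mem hp
  have hr1 := Real.goldenRatio_sq
  have hr2 : (1 - Real.goldenRatio) ^ 2 = (1 - Real.goldenRatio) + 1 := by linear_combination hr1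
  have hirr := Real.goldenRatio_irrational
  constructor
  · intro h
    rw [h] at h1
    exact Subtype.ext (h2.trans (icosian_eq_one_of_irrational hr1 hr2 hirr h1.symm))
  · intro h
    rw [h] at h2
    exact Subtype.ext (h1.trans (icosian_eq_one_of_irrational hr2 hr1
      (by exact_mod_cast hirr.ratCast_sub 1) h2.symm))

theorem map_fst_galoisGraph : galoisGraph.map (MonoidHom.fst SU2 SU2) = twoI := by
  rw [galoisGraph, MonoidHom.map_closure, twoI_eq]
  congr 1
  simp [Set.image_insert_eq]

theorem finite_twoI : Finite twoI := by
  have := finite_galoisGraph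
  rw [← map_fst_galoisGraph]
  exact Set.Finite.to_subtype ((Set.toFinite (galoisGraph : Set (SU2 × SU2))).image _)

/-- The Galois conjugate embedding of `2I` in `SU(2)`. -/
theorem exists_galois_conjugate : ∃ f : twoI →* SU2, Function.Injective f ∧
    f ⟨elPhi, elPhi_mem⟩ = elPhiConj := by
  have hex (g : twoI) : ∃ p ∈ galoisGraph, p.1 = g :=
    (Subgroup.ext_iff.1 map_fst_galoisGraph _).2 g.2
  choose p hp hpg using hex
  have huniq {q q' : SU2 × SU2} (hq : q ∈ galoisGraph) (hq' : q' ∈ galoisGraph)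
      (h : q.1 = q'.1) : q.2 = q'.2 := by
    have h1 := (galoisGraph_eq_one_iff (galoisGraph.mul_mem hq (galoisGraph.inv_mem hq'))).1
      (by simp [h])
    exact mul_inv_eq_one.1 h1
  let f : twoI →* SU2 := MonoidHom.mk' (fun g => (p g).2) fun g k =>
    huniq (hp _) (galoisGraph.mul_mem (hp g) (hp k)) (by simp [hpg])
  have hΦ : f ⟨elPhi, elPhi_mem⟩ = elPhiConj :=
    huniq (hp _) (q' := (elPhi, elPhiConj)) (Subgroup.subset_closure (by simp)) (hpg _)
  refine ⟨f, ?_, hΦ⟩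
  rw [injective_iff_map_eq_one]
  intro g hg
  apply Subtype.ext
  rw [← hpg g]
  exact (galoisGraph_eq_one_iff (hp g)).2 hg

end SpinCode

end

/-! ### Binary forms as a model of the spin representations -/

noncomputable section

namespace SpinCode

open Matrix

/-- The images of the variables `y = X 0` and `x = X 1` under the linear substitution `M`. -/
def substVar (M : Matrix (Fin 2) (Fin 2) ℂ) : Fin 2 → MvPolynomial (Fin 2) ℂ :=
  ![MvPolynomial.C (M 0 1) * MvPolynomial.X 1 + MvPolynomial.C (M 1 1) * MvPolynomial.X 0,
    MvPolynomial.C (M 0 0) * MvPolynomial.X 1 + MvPolynomial.C (M 1 0) * MvPolynomial.X 0]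

/-- The action of a matrix on binary forms by linear substitution. -/
def substForm (M : Matrix (Fin 2) (Fin 2) ℂ) : MvPolynomial (Fin 2) ℂ →ₐ[ℂ] MvPolynomial (Fin 2) ℂ :=
  MvPolynomial.aeval (substVar M)

/-- The infinitesimal action of a matrix on binary forms. -/
def derivForm (E : Matrix (Fin 2) (Fin 2) ℂ) :
    Derivation ℂ (MvPolynomial (Fin 2) ℂ) (MvPolynomial (Fin 2) ℂ) :=
  MvPolynomial.mkDerivation ℂ (substVar E)

theorem substForm_X (M : Matrix (Fin 2) (Fin 2) ℂ) (i : Fin 2) :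
    substForm M (MvPolynomial.X i) = substVar M i := MvPolynomial.aeval_X _ _

theorem derivForm_X (M : Matrix (Fin 2) (Fin 2) ℂ) (i : Fin 2) :
    derivForm M (MvPolynomial.X i) = substVar M i := MvPolynomial.mkDerivation_X _ _ _

theorem substForm_C (M : Matrix (Fin 2) (Fin 2) ℂ) (c : ℂ) :
    substForm M (MvPolynomial.C c) = MvPolynomial.C c := MvPolynomial.aeval_C _ _

theorem derivForm_C (M : Matrix (Fin 2) (Fin 2) ℂ) (c : ℂ) :
    derivForm M (MvPolynomial.C c) = 0 := (derivForm M).map_algebraMap c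

theorem eval_substForm (M : Matrix (Fin 2) (Fin 2) ℂ) (w : Fin 2 → ℂ)
    (f : MvPolynomial (Fin 2) ℂ) : MvPolynomial.eval w (substForm M f) =
      MvPolynomial.eval (fun i => MvPolynomial.eval w (substVar M i)) f := by
  induction f using MvPolynomial.induction_on with
  | C a => simp
  | add p q hp hq => simp only [map_add, hp, hq]
  | mul_X p i hp => simp only [map_mul, hp, substForm_X, MvPolynomial.eval_X]

theorem substForm_substVar (M N : Matrix (Fin 2) (Fin 2) ℂ) (i : Fin 2) :
    substForm M (substVar N i) = substVar (M * N) i := by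
  fin_cases i <;>
    simp [substVar, substForm_X, Matrix.mul_apply, Fin.sum_univ_two] <;> ring

theorem substForm_mul (M N : Matrix (Fin 2) (Fin 2) ℂ) (f : MvPolynomial (Fin 2) ℂ) :
    substForm (M * N) f = substForm M (substForm N f) := by
  have h : substForm (M * N) = (substForm M).comp (substForm N) := by
    apply MvPolynomial.algHom_ext
    intro i
    rw [AlgHom.comp_apply, substForm_X, substForm_X, substForm_substVar]
  rw [h]; rfl

theorem substForm_one (f : MvPolynomial (Fin 2) ℂ) : substForm 1 f = f := by
  have h : substForm 1 = AlgHom.id ℂ _ := by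
    apply MvPolynomial.algHom_ext
    intro i
    rw [substForm_X]
    fin_cases i <;> simp [substVar]
  rw [h]; rfl

theorem derivForm_substVar (M N : Matrix (Fin 2) (Fin 2) ℂ) (i : Fin 2) :
    derivForm M (substVar N i) = substVar (M * N) i := by
  fin_cases i <;>
    simp [substVar, derivForm_X, Matrix.mul_apply, Fin.sum_univ_two] <;> ring

/-- For E' = M E M⁻¹ this is the covariance of the Lie algebra action. By the Leibniz rule it is
enough to compare the variables. -/
theorem derivForm_substForm {E E' M : Matrix (Fin 2) (Fin 2) ℂ} (h : E' * M = M * E)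
    (f : MvPolynomial (Fin 2) ℂ) :
    derivForm E' (substForm M f) = substForm M (derivForm E f) := by
  induction f using MvPolynomial.induction_on with
  | C a => rw [substForm_C, derivForm_C, derivForm_C, map_zero]
  | add p q hp hq => simp only [map_add, hp, hq]
  | mul_X p i hp =>
    rw [map_mul, Derivation.leibniz, Derivation.leibniz, hp, map_add, smul_eq_mul, smul_eq_mul,
      smul_eq_mul, smul_eq_mul, map_mul, map_mul, substForm_X, derivForm_substVar, derivForm_X,
      substForm_substVar, h]

theorem substVar_add (M N : Matrix (Fin 2) (Fin 2) ℂ) (i : Fin 2) :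
    substVar (M + N) i = substVar M i + substVar N i := by
  fin_cases i <;> simp [substVar] <;> ring

theorem substVar_smul (c : ℂ) (M : Matrix (Fin 2) (Fin 2) ℂ) (i : Fin 2) :
    substVar (c • M) i = c • substVar M i := by
  fin_cases i <;> simp [substVar, MvPolynomial.smul_eq_C_mul] <;> ring

theorem derivForm_add (M N : Matrix (Fin 2) (Fin 2) ℂ) :
    derivForm (M + N) = derivForm M + derivForm N := by
  apply MvPolynomial.derivation_ext
  intro i
  rw [Derivation.add_apply, derivForm_X, derivForm_X, derivForm_X, substVar_add]

theorem derivForm_smul (c : ℂ) (M : Matrix (Fin 2) (Fin 2) ℂ) :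
    derivForm (c • M) = c • derivForm M := by
  apply MvPolynomial.derivation_ext
  intro i
  rw [Derivation.smul_apply, derivForm_X, derivForm_X, substVar_smul]

/-! ### Spin states as binary forms -/

/-- `√(n choose k)`. -/
def sqrtChoose (n k : ℕ) : ℂ := ((√(n.choose k : ℝ) : ℝ) : ℂ)

theorem sqrtChoose_ne_zero {n k : ℕ} (h : k ≤ n) : sqrtChoose n k ≠ 0 := by
  have h1 : (0 : ℝ) < n.choose k := by exact_mod_cast Nat.choose_pos h
  exact Complex.ofReal_ne_zero.2 (Real.sqrt_pos.2 h1).ne'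

theorem sqrtChoose_mul_self (n k : ℕ) : sqrtChoose n k * sqrtChoose n k = n.choose k := by
  rw [sqrtChoose, ← Complex.ofReal_mul, Real.mul_self_sqrt (by positivity)]
  simp

theorem star_sqrtChoose (n k : ℕ) : star (sqrtChoose n k) = sqrtChoose n k := Complex.conj_ofReal _

/-- The monomial `y ^ k * x ^ (n - k)`. -/
def monoForm (n k : ℕ) : MvPolynomial (Fin 2) ℂ :=
  MvPolynomial.X 0 ^ k * MvPolynomial.X 1 ^ (n - k)

/-- The binary form of degree `n` that a spin `n / 2` state represents. -/
def formOf (n : ℕ) : Spin n →ₗ[ℂ] MvPolynomial (Fin 2) ℂ where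
  toFun c := ∑ k : Fin (n + 1), (c k * sqrtChoose n k) • monoForm n k
  map_add' c d := by simp [add_mul, add_smul, Finset.sum_add_distrib]
  map_smul' a c := by simp [Finset.smul_sum, smul_smul, mul_assoc]

theorem formOf_apply (n : ℕ) (c : Spin n) :
    formOf n c = ∑ k : Fin (n + 1), (c k * sqrtChoose n k) • monoForm n k := rfl

theorem homogenize_eq_sum (p : Polynomial ℂ) (n : ℕ) :
    p.homogenize n = ∑ k : Fin (n + 1), p.coeff k • monoForm n k := by
  rw [Polynomial.homogenize, Finset.Nat.sum_antidiagonal_eq_sum_range_succ_mk, Finset.sum_range]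
  refine Finset.sum_congr rfl fun k _ => ?_
  rw [monoForm, Finsupp.update_eq_add_single (by simp), MvPolynomial.monomial_single_add,
    MvPolynomial.smul_eq_C_mul, MvPolynomial.C_mul_X_pow_eq_monomial.symm]
  simp; ring

theorem formOf_eq_homogenize (n : ℕ) (c : Spin n) : formOf n c =
    (∑ k : Fin (n + 1), Polynomial.monomial k (c k * sqrtChoose n k)).homogenize n := by
  rw [homogenize_eq_sum, formOf_apply]
  refine Finset.sum_congr rfl fun k _ => ?_
  rw [Polynomial.finsetSum_coeff, Finset.sum_eq_single k]
  · simp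
  · intro b _ hb
    rw [Polynomial.coeff_monomial, if_neg (fun h => hb (Fin.ext h))]
  · simp

theorem formOf_injective (n : ℕ) : Function.Injective (formOf n) := by
  rw [injective_iff_map_eq_zero]
  intro c hc
  rw [formOf_eq_homogenize] at hc
  ext k
  have h := congrArg (MvPolynomial.coeff (fun₀ | 0 => (k : ℕ) | 1 => n - k)) hc
  rw [Polynomial.coeff_homogenize] at h
  have hk : (k : ℕ) ≤ n := Nat.lt_succ_iff.1 k.2
  rw [if_pos (by simp; omega), Polynomial.finsetSum_coeff, Finset.sum_eq_single k] at h
  · simpa [sqrtChoose_ne_zero hk] using h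
  · intro b _ hb
    rw [Polynomial.coeff_monomial, if_neg]
    simpa [Fin.ext_iff] using hb
  · simp

theorem exists_formOf_eq {n : ℕ} {f : MvPolynomial (Fin 2) ℂ} (hf : f.IsHomogeneous n) :
    ∃ c : Spin n, formOf n c = f := by
  set p : Polynomial ℂ := MvPolynomial.aeval ![Polynomial.X, 1] f with hp
  refine ⟨WithLp.toLp 2 fun k => p.coeff k / sqrtChoose n k, ?_⟩
  rw [← Polynomial.homogenize_eq_of_isHomogeneous hf hp.symm, homogenize_eq_sum, formOf_apply]
  refine Finset.sum_congr rfl fun k _ => ?_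
  rw [div_mul_cancel₀ _ (sqrtChoose_ne_zero (Nat.lt_succ_iff.1 k.2))]

theorem isHomogeneous_substVar (M : Matrix (Fin 2) (Fin 2) ℂ) (i : Fin 2) :
    (substVar M i).IsHomogeneous 1 := by
  have h : ∀ (a : ℂ) (j : Fin 2), (MvPolynomial.C a * MvPolynomial.X j).IsHomogeneous 1 := by
    intro a j
    simpa using (MvPolynomial.isHomogeneous_C (Fin 2) a).mul (MvPolynomial.isHomogeneous_X ℂ j)
  fin_cases i
  · exact (h _ _).add (h _ _)
  · exact (h _ _).add (h _ _)

theorem toEuclideanLin_coe {n : ℕ} (A : Matrix (Fin (n + 1)) (Fin (n + 1)) ℂ) (c : Spin n)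
    (l : Fin (n + 1)) : A.toEuclideanLin c l = ∑ k, A l k * c k := rfl

theorem derivForm_monoForm (n k : ℕ) (E : Matrix (Fin 2) (Fin 2) ℂ) :
    derivForm E (monoForm n k) =
      (k : MvPolynomial (Fin 2) ℂ) * (MvPolynomial.X 0 ^ (k - 1) * MvPolynomial.X 1 ^ (n - k)) *
        substVar E 0 +
      ((n - k : ℕ) : MvPolynomial (Fin 2) ℂ) *
        (MvPolynomial.X 0 ^ k * MvPolynomial.X 1 ^ (n - k - 1)) * substVar E 1 := by
  rw [monoForm, Derivation.leibniz, Derivation.leibniz_pow, Derivation.leibniz_pow, derivForm_X,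
    derivForm_X]
  simp only [smul_eq_mul, nsmul_eq_mul]
  ring

/-- The Wigner rotation operator. -/
def wignerOp (n : ℕ) (g : SU2) : Spin n →ₗ[ℂ] Spin n := (wignerD n g).toEuclideanLin

/-- The columns of `wignerD` are dehomogenized at x = 1. Homogenizing in degree n recovers the
substituted monomial. -/
theorem homogenize_wigner (n k : ℕ) (hk : k ≤ n) (M : Matrix (Fin 2) (Fin 2) ℂ) :
    ((Polynomial.C (M 0 0) + Polynomial.C (M 1 0) * Polynomial.X) ^ (n - k) *
        (Polynomial.C (M 0 1) + Polynomial.C (M 1 1) * Polynomial.X) ^ k).homogenize n =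
      substForm M (monoForm n k) := by
  rw [monoForm, map_mul, map_pow, map_pow, substForm_X, substForm_X]
  apply Polynomial.homogenize_eq_of_isHomogeneous
  · have h := ((isHomogeneous_substVar M 0).pow k).mul ((isHomogeneous_substVar M 1).pow (n - k))
    convert h using 1
    omega
  · simp [substVar, ← Polynomial.algebraMap_eq]
    ring

/-- Transfers a matrix to an operator on forms by checking its columns on monomials. -/
theorem formOf_toEuclideanLin {n : ℕ} {A : Matrix (Fin (n + 1)) (Fin (n + 1)) ℂ}
    {T : MvPolynomial (Fin 2) ℂ →ₗ[ℂ] MvPolynomial (Fin 2) ℂ}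
    (h : ∀ k : Fin (n + 1), ∑ l : Fin (n + 1), (A l k * sqrtChoose n l) • monoForm n l =
      sqrtChoose n k • T (monoForm n k)) (c : Spin n) :
    formOf n (A.toEuclideanLin c) = T (formOf n c) := by
  simp only [formOf_apply, map_sum, map_smul, mul_smul, ← h, toEuclideanLin_coe, Finset.smul_sum,
    Finset.sum_smul]
  rw [Finset.sum_comm]
  refine Finset.sum_congr rfl fun l _ => Finset.sum_congr rfl fun k _ => ?_
  simp only [smul_smul]
  congr 1
  ring

theorem formOf_wignerOp (n : ℕ) (g : SU2) (c : Spin n) :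
    formOf n (wignerOp n g c) = substForm g.1 (formOf n c) := by
  refine formOf_toEuclideanLin (T := (substForm g.1).toLinearMap) (fun k => ?_) c
  rw [AlgHom.toLinearMap_apply, ← homogenize_wigner n k (Nat.lt_succ_iff.1 k.2), homogenize_eq_sum,
    Finset.smul_sum]
  refine Finset.sum_congr rfl fun l _ => ?_
  rw [smul_smul]
  congr 1
  have hl := sqrtChoose_ne_zero (Nat.lt_succ_iff.1 l.2)
  rw [wignerD, Matrix.of_apply, Complex.ofReal_div, ← sqrtChoose, ← sqrtChoose]
  field_simp

/-- The angular momentum operator that belongs to a traceless matrix. -/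
def spinJ (n : ℕ) (E : Matrix (Fin 2) (Fin 2) ℂ) : Spin n →ₗ[ℂ] Spin n :=
  (2 * E 0 0) • (Jz n).toEuclideanLin + E 0 1 • (Jplus n).toEuclideanLin +
    E 1 0 • (Jminus n).toEuclideanLin

theorem monoForm_zero_mul {n k : ℕ} (hk : k ≤ n) :
    (k : MvPolynomial (Fin 2) ℂ) * (MvPolynomial.X 0 ^ (k - 1) * MvPolynomial.X 1 ^ (n - k)) *
      MvPolynomial.X 0 = (k : ℂ) • monoForm n k := by
  rcases k with _ | k
  · simp
  · simp [monoForm, MvPolynomial.smul_eq_C_mul]; ring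

theorem monoForm_one_mul {n k : ℕ} (hk : k ≤ n) :
    ((n - k : ℕ) : MvPolynomial (Fin 2) ℂ) *
      (MvPolynomial.X 0 ^ k * MvPolynomial.X 1 ^ (n - k - 1)) * MvPolynomial.X 1 =
      ((n : ℂ) - k) • monoForm n k := by
  rw [← Nat.cast_sub hk]
  obtain ⟨m, rfl⟩ := Nat.exists_eq_add_of_le hk
  rcases m with _ | m
  · simp
  · simp [monoForm, MvPolynomial.smul_eq_C_mul, pow_succ]; ring

theorem formOf_Jz (n : ℕ) (c : Spin n) :
    formOf n ((Jz n).toEuclideanLin c) = derivForm !![1 / 2, 0; 0, -1 / 2] (formOf n c) := by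
  refine formOf_toEuclideanLin (T := (derivForm !![1 / 2, 0; 0, -1 / 2]).toLinearMap)
    (fun k => ?_) c
  have hk : (k : ℕ) ≤ n := Nat.lt_succ_iff.1 k.2
  rw [Finset.sum_eq_single k]
  · have h0 := monoForm_zero_mul hk
    have h1 := monoForm_one_mul hk
    rw [Derivation.coeFn_coe, derivForm_monoForm]
    have e : (-1 / 2 : ℂ) = - (1 / 2) := by norm_num
    simp only [Jz, Matrix.diagonal_apply_eq, substVar, Matrix.of_apply, Matrix.cons_val_zero,
      Matrix.cons_val_one, map_zero, zero_mul, zero_add, add_zero, e, map_neg]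
    rw [MvPolynomial.smul_eq_C_mul] at h0 h1 ⊢
    rw [MvPolynomial.smul_eq_C_mul]
    have h2 : MvPolynomial.C (((n : ℂ) / 2 - (k : ℕ)) * sqrtChoose n k) = (MvPolynomial.C
      (sqrtChoose n k) * (MvPolynomial.C (1 / 2) * (MvPolynomial.C ((n : ℂ) - k)
      - MvPolynomial.C (k : ℂ))) : MvPolynomial (Fin 2) ℂ) := by
      rw [← map_sub, ← map_mul, ← map_mul]; congr 1; ring
    rw [h2]
    linear_combination MvPolynomial.C (sqrtChoose n k) * MvPolynomial.C (1 / 2) * (h0 - h1)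
  · intro b _ hb
    simp [Jz, Matrix.diagonal_apply_ne _ hb]
  · simp

theorem sqrtChoose_succ_mul {n k : ℕ} (hk : k < n) :
    ((√(((k + 1 : ℕ) : ℝ) * ((n : ℝ) - (k + 1 : ℕ) + 1)) : ℝ) : ℂ) * sqrtChoose n k =
      sqrtChoose n (k + 1) * (k + 1 : ℕ) := by
  have h1 : ((n : ℝ) - (k + 1 : ℕ) + 1) = (n - k : ℕ) := by
    rw [Nat.cast_sub hk.le]; push_cast; ring
  have h2 : (n.choose (k + 1) : ℝ) * (k + 1 : ℕ) = n.choose k * (n - k : ℕ) := by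
    exact_mod_cast Nat.choose_succ_right_eq n k
  rw [h1, sqrtChoose, sqrtChoose, ← Complex.ofReal_mul, ← Complex.ofReal_natCast,
    ← Complex.ofReal_mul]
  congr 1
  rw [← Real.sqrt_mul (by positivity)]
  have h3 : (((k + 1 : ℕ) : ℝ) * (n - k : ℕ)) * (n.choose k) =
    n.choose (k + 1) * ((k + 1 : ℕ) : ℝ) ^ 2 := by
    linear_combination -((k + 1 : ℕ) : ℝ) * h2
  rw [h3, Real.sqrt_mul (by positivity), Real.sqrt_sq (by positivity)]

theorem sqrtChoose_mul_succ {n k : ℕ} (hk : k < n) :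
    ((√(((n : ℝ) - k) * (k + 1)) : ℝ) : ℂ) * sqrtChoose n (k + 1) =
      sqrtChoose n k * (n - k) := by
  have h1 : ((n : ℝ) - k) = (n - k : ℕ) := by rw [Nat.cast_sub hk.le]
  have h1' : ((n : ℂ) - k) = ((n - k : ℕ) : ℝ) := by
    rw [Complex.ofReal_natCast, Nat.cast_sub hk.le]
  have h2 : (n.choose (k + 1) : ℝ) * ((k : ℝ) + 1) = n.choose k * (n - k : ℕ) := by
    exact_mod_cast Nat.choose_succ_right_eq n k
  rw [h1, h1', sqrtChoose, sqrtChoose, ← Complex.ofReal_mul, ← Complex.ofReal_mul]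
  congr 1
  rw [← Real.sqrt_mul (by positivity)]
  have h3 : (((n - k : ℕ) : ℝ) * (k + 1)) * (n.choose (k + 1)) =
    n.choose k * ((n - k : ℕ) : ℝ) ^ 2 := by
    linear_combination ((n - k : ℕ) : ℝ) * h2
  rw [h3, Real.sqrt_mul (by positivity), Real.sqrt_sq (by positivity)]

theorem formOf_Jplus (n : ℕ) (c : Spin n) :
    formOf n ((Jplus n).toEuclideanLin c) = derivForm !![0, 1; 0, 0] (formOf n c) := by
  refine formOf_toEuclideanLin (T := (derivForm !![0, 1; 0, 0]).toLinearMap) (fun k => ?_) c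
  obtain ⟨k, hk⟩ := k
  rw [Derivation.coeFn_coe, derivForm_monoForm]
  simp only [substVar, Matrix.of_apply, Matrix.cons_val_zero, Matrix.cons_val_one, map_zero,
    zero_mul, add_zero, map_one, one_mul, mul_zero]
  rcases k with _ | k
  · simp [Jplus]
  · have hk' : k < n := by omega
    rw [Finset.sum_eq_single ⟨k, by omega⟩]
    · simp only [Jplus, Matrix.of_apply, if_true]
      rw [sqrtChoose_succ_mul hk', mul_smul]
      congr 1
      obtain ⟨m, rfl⟩ := Nat.exists_eq_add_of_lt hk'
      have e1 : k + m + 1 - (k + 1) = m := by omega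
      have e2 : k + m + 1 - k = m + 1 := by omega
      rw [monoForm, MvPolynomial.smul_eq_C_mul, e1, e2]
      simp; ring
    · intro b _ hb
      simp only [Jplus, Matrix.of_apply]
      rw [if_neg, zero_mul, zero_smul]
      intro h
      exact hb (Fin.ext (by simpa using h))
    · simp

theorem formOf_Jminus (n : ℕ) (c : Spin n) :
    formOf n ((Jminus n).toEuclideanLin c) = derivForm !![0, 0; 1, 0] (formOf n c) := by
  refine formOf_toEuclideanLin (T := (derivForm !![0, 0; 1, 0]).toLinearMap) (fun k => ?_) c
  obtain ⟨k, hk⟩ := k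
  rw [Derivation.coeFn_coe, derivForm_monoForm]
  simp only [substVar, Matrix.of_apply, Matrix.cons_val_zero, Matrix.cons_val_one, map_zero,
    zero_mul, zero_add, map_one, one_mul, mul_zero]
  rcases Nat.lt_or_ge k n with hk' | hk'
  · rw [Finset.sum_eq_single ⟨k + 1, by omega⟩]
    · simp only [Jminus, Matrix.of_apply, if_true]
      rw [sqrtChoose_mul_succ hk', mul_smul]
      congr 1
      obtain ⟨m, rfl⟩ := Nat.exists_eq_add_of_lt hk'
      have e1 : k + m + 1 - (k + 1) = m := by omega
      have e2 : k + m + 1 - k = m + 1 := by omega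
      rw [monoForm, MvPolynomial.smul_eq_C_mul, e1, e2]
      simp; ring
    · intro b _ hb
      simp only [Jminus, Matrix.of_apply]
      rw [if_neg, zero_mul, zero_smul]
      intro h
      exact hb (Fin.ext (by simpa using h))
    · simp
  · obtain rfl : k = n := by omega
    rw [Finset.sum_eq_zero]
    · simp
    · intro l _
      simp only [Jminus, Matrix.of_apply]
      rw [if_neg (by omega), zero_mul, zero_smul]

theorem formOf_spinJ (n : ℕ) {E : Matrix (Fin 2) (Fin 2) ℂ} (hE : E.trace = 0) (c : Spin n) :
    formOf n (spinJ n E c) = derivForm E (formOf n c) := by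
  -- The factor 2 appears because J_z corresponds to diag(1/2, −1/2). The lower right entry is
  -- recovered from the vanishing trace.
  have h : E = (2 * E 0 0) • !![1 / 2, 0; 0, -1 / 2] + E 0 1 • !![0, 1; 0, 0] +
      E 1 0 • !![0, 0; 1, 0] := by
    rw [Matrix.trace_fin_two] at hE
    ext i j
    fin_cases i <;> fin_cases j <;> simp
    · ring
    · linear_combination hE
  conv_rhs => rw [h]
  simp only [spinJ, LinearMap.add_apply, LinearMap.smul_apply, map_add, map_smul, formOf_Jz,
    formOf_Jplus, formOf_Jminus, derivForm_add, derivForm_smul, Derivation.add_apply,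
    Derivation.smul_apply]

theorem wignerOp_mul (n : ℕ) (g h : SU2) (c : Spin n) :
    wignerOp n (g * h) c = wignerOp n g (wignerOp n h c) := by
  apply formOf_injective
  rw [formOf_wignerOp, formOf_wignerOp, formOf_wignerOp, ← substForm_mul]
  rfl

theorem wignerOp_one (n : ℕ) (c : Spin n) : wignerOp n 1 c = c := by
  apply formOf_injective
  rw [formOf_wignerOp]
  exact substForm_one _

theorem trace_conj_eq_zero {E : Matrix (Fin 2) (Fin 2) ℂ} (hE : E.trace = 0) (g : SU2) :
    (g.1 * E * (g⁻¹).1).trace = 0 := by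
  rw [Matrix.trace_mul_comm, ← mul_assoc, SU2.inv_coe, SU2.star_mul_coe, one_mul, hE]

theorem spinJ_wignerOp (n : ℕ) (g : SU2) {E : Matrix (Fin 2) (Fin 2) ℂ} (hE : E.trace = 0)
    (c : Spin n) :
    spinJ n (g.1 * E * (g⁻¹).1) (wignerOp n g c) = wignerOp n g (spinJ n E c) := by
  apply formOf_injective
  rw [formOf_wignerOp, formOf_spinJ n hE, formOf_spinJ n (trace_conj_eq_zero hE g), formOf_wignerOp]
  apply derivForm_substForm
  rw [mul_assoc, SU2.inv_coe, SU2.star_mul_coe, mul_one]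

/-! ### Unitarity of the rotation operators -/

/-- The state whose overlaps are the values of binary forms at `w`. -/
def coherent (n : ℕ) (w : Fin 2 → ℂ) : Spin n :=
  WithLp.toLp 2 fun k => sqrtChoose n k * (star (w 0) ^ (k : ℕ) * star (w 1) ^ (n - (k : ℕ)))

theorem inner_coherent (n : ℕ) (w : Fin 2 → ℂ) (c : Spin n) :
    inner ℂ (coherent n w) c = MvPolynomial.eval w (formOf n c) := by
  rw [formOf_apply, map_sum, PiLp.inner_apply]
  refine Finset.sum_congr rfl fun k _ => ?_
  have h := star_sqrtChoose n k
  rw [Complex.star_def] at h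
  simp [coherent, monoForm, MvPolynomial.smul_eval, h]
  ring

theorem formOf_coherent (n : ℕ) (w : Fin 2 → ℂ) : formOf n (coherent n w) =
    (MvPolynomial.C (star (w 0)) * MvPolynomial.X 0 +
      MvPolynomial.C (star (w 1)) * MvPolynomial.X 1) ^ n := by
  rw [formOf_apply, add_pow, Finset.sum_range]
  refine Finset.sum_congr rfl fun k _ => ?_
  have h := sqrtChoose_mul_self n k
  rw [MvPolynomial.smul_eq_C_mul, monoForm, mul_pow, mul_pow, ← map_pow, ← map_pow]
  have h2 : (coherent n w) k * sqrtChoose n k =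
      star (w 0) ^ (k : ℕ) * star (w 1) ^ (n - (k : ℕ)) * (n.choose k : ℂ) := by
    rw [← h, coherent]
    simp only
    ring
  rw [h2, map_mul, map_mul, map_natCast]
  ring

theorem eq_of_inner_coherent {n : ℕ} {c d : Spin n}
    (h : ∀ w, inner ℂ (coherent n w) c = inner ℂ (coherent n w) d) : c = d := by
  apply formOf_injective
  apply MvPolynomial.funext
  intro w
  rw [← inner_coherent, ← inner_coherent, h]

theorem wignerOp_coherent (n : ℕ) (g : SU2) (w : Fin 2 → ℂ) :
    wignerOp n g⁻¹ (coherent n w) = coherent n fun i => MvPolynomial.eval w (substVar g.1 i) := by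
  apply formOf_injective
  rw [formOf_wignerOp, formOf_coherent, formOf_coherent, map_pow, map_add, map_mul, map_mul,
    substForm_X, substForm_X, substForm_C, substForm_C, SU2.inv_coe]
  congr 1
  simp [substVar, Matrix.star_apply]
  ring

/-- Overlaps with coherent states are the values of a form and so determine the state. D(g⁻¹) moves
coherent states exactly as the substitution g moves the argument of a form. -/
theorem inner_wignerOp_right (n : ℕ) (g : SU2) (c d : Spin n) :
    inner ℂ c (wignerOp n g d) = inner ℂ (wignerOp n g⁻¹ c) d := by
  rw [← LinearMap.adjoint_inner_right]
  congr 1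
  apply eq_of_inner_coherent
  intro w
  rw [LinearMap.adjoint_inner_right, wignerOp_coherent, inner_coherent, inner_coherent,
    formOf_wignerOp, eval_substForm]

end SpinCode

end

noncomputable section

namespace SpinCode

open Matrix

/-! ### Independence of the operators `J(E) D(g)` -/

/-- The linear form that vanishes at `p`. -/
def linForm (p : Fin 2 → ℂ) : MvPolynomial (Fin 2) ℂ :=
  MvPolynomial.C (p 0) * MvPolynomial.X 1 - MvPolynomial.C (p 1) * MvPolynomial.X 0

/-- The dual action of matrices on the arguments of binary forms. -/
def moveArg (M : Matrix (Fin 2) (Fin 2) ℂ) (v : Fin 2 → ℂ) : Fin 2 → ℂ :=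
  fun i => MvPolynomial.eval v (substVar M i)

theorem isHomogeneous_linForm (p : Fin 2 → ℂ) : (linForm p).IsHomogeneous 1 := by
  have h : ∀ (a : ℂ) (j : Fin 2), (MvPolynomial.C a * MvPolynomial.X j).IsHomogeneous 1 := by
    intro a j
    simpa using (MvPolynomial.isHomogeneous_C (Fin 2) a).mul (MvPolynomial.isHomogeneous_X ℂ j)
  exact (h _ _).sub (h _ _)

theorem eval_linForm (p w : Fin 2 → ℂ) :
    MvPolynomial.eval w (linForm p) = p 0 * w 1 - p 1 * w 0 := by
  simp [linForm]

theorem eval_linForm_self (p : Fin 2 → ℂ) : MvPolynomial.eval p (linForm p) = 0 := by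
  rw [eval_linForm]; ring

theorem eval_derivForm_linForm (E : Matrix (Fin 2) (Fin 2) ℂ) (p w : Fin 2 → ℂ) :
    MvPolynomial.eval w (derivForm E (linForm p)) =
      MvPolynomial.eval (moveArg E w) (linForm p) := by
  simp [linForm, moveArg, derivForm_X]

theorem substForm_neg_one_linForm (p : Fin 2 → ℂ) : substForm (-1) (linForm p) = -linForm p := by
  simp [linForm, substForm_X, substVar]
  ring

theorem moveArg_neg (M : Matrix (Fin 2) (Fin 2) ℂ) (v : Fin 2 → ℂ) :
    moveArg (-M) v = -moveArg M v := by
  ext i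
  fin_cases i <;> simp [moveArg, substVar] <;> ring

theorem eval_derivation_eq_zero (D : Derivation ℂ (MvPolynomial (Fin 2) ℂ) (MvPolynomial (Fin 2) ℂ))
    {v : Fin 2 → ℂ} {a b r : MvPolynomial (Fin 2) ℂ} (ha : MvPolynomial.eval v a = 0)
    (hb : MvPolynomial.eval v b = 0) : MvPolynomial.eval v (D (a * (b * r))) = 0 := by
  simp [Derivation.leibniz, ha, hb]

theorem eval_linForm_moveArg (M : Matrix (Fin 2) (Fin 2) ℂ) (t : ℂ) :
    MvPolynomial.eval ![t, 1] (linForm (moveArg M ![t, 1])) =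
      (Polynomial.C (M 0 1) + Polynomial.C (M 1 1 - M 0 0) * Polynomial.X -
        Polynomial.C (M 1 0) * Polynomial.X ^ 2).eval t := by
  simp [eval_linForm, moveArg, substVar]
  ring

theorem eq_smul_one_of_polynomial_eq_zero {M : Matrix (Fin 2) (Fin 2) ℂ}
    (h : Polynomial.C (M 0 1) + Polynomial.C (M 1 1 - M 0 0) * Polynomial.X -
        Polynomial.C (M 1 0) * Polynomial.X ^ 2 = 0) : M = M 0 0 • (1 : Matrix (Fin 2) (Fin 2) ℂ) := by
  have h0 := congrArg (fun p => Polynomial.eval 0 p) h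
  have h1 := congrArg (fun p => Polynomial.eval 1 p) h
  have h2 := congrArg (fun p => Polynomial.eval (-1) p) h
  simp at h0 h1 h2
  ext i j
  fin_cases i <;> fin_cases j <;> simp
  · exact h0
  · linear_combination (-1 / 2 : ℂ) * h1 - (1 / 2 : ℂ) * h2 + h0
  · linear_combination (1 / 2 : ℂ) * h1 - (1 / 2 : ℂ) * h2

/-- Evaluate at v the relation for the form f = ℓ_v · ∏ ℓ_{gv} over g ≠ ±1, where ℓ_p is the linear
form vanishing at p; its degree is |G| − 1. For k ≠ ±1 the form vanishes doubly at kv, through the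
factors for k and −k, so its term dies. What survives is ω(E₁v, v) ∏ ω(gv, v) = 0 for all v, where ω
is the determinant form. Only scalar matrices M make ω(Mv, v) vanish identically, so E₁ is scalar
and, being traceless, zero. -/
theorem eq_zero_of_sum_derivForm_substForm {G : Subgroup SU2} [Fintype G] (hneg : SU2.negOne ∈ G)
    {n : ℕ} (hn : n + 1 = Fintype.card G) {E : G → Matrix (Fin 2) (Fin 2) ℂ}
    (hE : (E 1).trace = 0) (hEneg : E ⟨SU2.negOne, hneg⟩ = -E 1)
    (h : ∀ f : MvPolynomial (Fin 2) ℂ, f.IsHomogeneous n →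
      ∑ k : G, derivForm (E k) (substForm (k : SU2).1 f) = 0) : E 1 = 0 := by
  classical
  set m : G := ⟨SU2.negOne, hneg⟩ with hm
  have hm1 : m ≠ 1 := fun h => SU2.negOne_ne_one (congrArg Subtype.val h)
  have hmm : m * m = 1 := Subtype.ext SU2.negOne_mul_self
  have hmc : (m : SU2).1 = -1 := rfl
  have heven : Even (Fintype.card G) := by
    have h2 : orderOf m = 2 := orderOf_eq_prime (by rw [pow_two, hmm]) hm1
    exact even_iff_two_dvd.2 (h2.symm.dvd.trans orderOf_dvd_card)
  set S : Finset G := (Finset.univ.erase 1).erase m with hS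
  have hmem : ∀ k : G, k ∈ S ↔ k ≠ m ∧ k ≠ 1 := by intro k; simp [hS]
  have hcard : S.card + 1 = n := by
    have h1 : S.card = (Finset.univ.erase (1 : G)).card - 1 :=
      Finset.card_erase_of_mem (by simp [hm1])
    have h2 : (Finset.univ.erase (1 : G)).card = Finset.univ.card - 1 :=
      Finset.card_erase_of_mem (by simp)
    rw [Finset.card_univ] at h2
    have h3 : 0 < (Finset.univ.erase (1 : G)).card := Finset.card_pos.2 ⟨m, by simp [hm1]⟩
    omega
  have hSeven : Even S.card := by
    rw [← hn, ← hcard] at heven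
    simpa [Nat.even_add_one] using heven
  have key : ∀ v : Fin 2 → ℂ, MvPolynomial.eval v (linForm (moveArg (E 1) v)) *
      ∏ g ∈ S, MvPolynomial.eval v (linForm (moveArg (g : SU2).1 v)) = 0 := by
    intro v
    set R := ∏ g ∈ S, linForm (moveArg (g : SU2).1 v) with hR
    have hR' : substForm (-1) R = R := by
      rw [hR, map_prod]
      simp only [substForm_neg_one_linForm]
      rw [Finset.prod_neg, hSeven.neg_one_pow, one_mul]
    have hh := congrArg (MvPolynomial.eval v) (h (linForm v * R) (by
      rw [← hcard, add_comm]
      refine (isHomogeneous_linForm v).mul ?_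
      have := MvPolynomial.IsHomogeneous.prod S (fun g : G => linForm (moveArg (g : SU2).1 v))
        (fun _ => 1) (fun _ _ => isHomogeneous_linForm _)
      simpa using this))
    rw [map_sum, map_zero, ← Finset.add_sum_erase _ _ (Finset.mem_univ (1 : G)),
      ← Finset.add_sum_erase _ _ (Finset.mem_erase.2 ⟨hm1, Finset.mem_univ m⟩),
      Finset.sum_eq_zero (s := S), add_zero] at hh
    · have e1 : MvPolynomial.eval v (derivForm (E 1) (substForm ((1 : G) : SU2).1 (linForm v * R))) =
          MvPolynomial.eval v R * MvPolynomial.eval (moveArg (E 1) v) (linForm v) := by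
        rw [show ((1 : G) : SU2).1 = 1 from rfl, substForm_one, Derivation.leibniz]
        simp only [smul_eq_mul, map_add, map_mul, eval_linForm_self, zero_mul, zero_add,
          eval_derivForm_linForm]
      -- The form has odd degree and `E m` is −`E 1`, so the two signs cancel and the terms of 1 and
      -- −1 reinforce each other.
      have e2 : derivForm (E m) (substForm (m : SU2).1 (linForm v * R)) =
          derivForm (E 1) (substForm ((1 : G) : SU2).1 (linForm v * R)) := by
        rw [show ((1 : G) : SU2).1 = 1 from rfl, substForm_one, hmc, map_mul, hR',
          substForm_neg_one_linForm, hEneg, ← neg_one_smul ℂ (E 1), derivForm_smul]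
        simp only [neg_mul, map_neg, Derivation.smul_apply, neg_smul, one_smul, neg_neg]
      rw [e2, e1] at hh
      have e3 : MvPolynomial.eval (moveArg (E 1) v) (linForm v) =
          -MvPolynomial.eval v (linForm (moveArg (E 1) v)) := by
        rw [eval_linForm, eval_linForm]; ring
      rw [e3, hR, map_prod] at hh
      linear_combination (-1 / 2 : ℂ) * hh
    · intro k hk
      have hk' := (hmem k).1 hk
      have hmk : m * k ∈ S := by
        rw [hmem]
        refine ⟨fun h => hk'.2 (mul_eq_left.1 h), fun h => hk'.1 ?_⟩
        calc k = m * (m * k) := by rw [← mul_assoc, hmm, one_mul]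
          _ = m := by rw [h, mul_one]
      have hne : m * k ≠ k := fun h => hm1 (mul_eq_right.1 h)
      have e0 : linForm v * R = linForm (moveArg (k : SU2).1 v) *
          (linForm (moveArg ((m * k : G) : SU2).1 v) *
            (linForm v * ∏ g ∈ (S.erase k).erase (m * k), linForm (moveArg (g : SU2).1 v))) := by
        rw [hR, ← Finset.mul_prod_erase S _ hk,
          ← Finset.mul_prod_erase (S.erase k) _ (Finset.mem_erase.2 ⟨hne, hmk⟩)]
        ring
      rw [e0, map_mul (substForm (k : SU2).1), map_mul (substForm (k : SU2).1)]
      apply eval_derivation_eq_zero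
      · rw [eval_substForm]
        exact eval_linForm_self _
      · rw [eval_substForm]
        have e4 : ((m * k : G) : SU2).1 = -(k : SU2).1 := by
          change (-1 : Matrix (Fin 2) (Fin 2) ℂ) * _ = _
          rw [neg_one_mul]
        rw [e4, moveArg_neg, eval_linForm]
        simp only [Pi.neg_apply, moveArg]
        ring
  -- Restriction to v = (t, 1) turns the identity into a product of one-variable polynomials, one of
  -- which must vanish.
  have hzero : (Polynomial.C (E 1 0 1) + Polynomial.C (E 1 1 1 - E 1 0 0) * Polynomial.X -
        Polynomial.C (E 1 1 0) * Polynomial.X ^ 2) *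
      ∏ g ∈ S, (Polynomial.C ((g : SU2).1 0 1) + Polynomial.C ((g : SU2).1 1 1 - (g : SU2).1 0 0) *
        Polynomial.X - Polynomial.C ((g : SU2).1 1 0) * Polynomial.X ^ 2) = 0 := by
    apply Polynomial.funext
    intro t
    have := key ![t, 1]
    simp only [eval_linForm_moveArg] at this
    rw [Polynomial.eval_mul, Polynomial.eval_prod, this, Polynomial.eval_zero]
  rcases mul_eq_zero.1 hzero with h0 | h0
  · have h1 := eq_smul_one_of_polynomial_eq_zero h0
    rw [h1] at hE
    simp at hE
    rw [h1, hE, zero_smul]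
  · obtain ⟨g, hg, h1⟩ := Finset.prod_eq_zero_iff.1 h0
    have hg' := (hmem g).1 hg
    exact absurd (eq_smul_one_of_polynomial_eq_zero h1) (SU2.coe_ne_smul_one
      (fun h => hg'.2 (Subtype.ext h)) (fun h => hg'.1 (Subtype.ext h)) _)

end SpinCode

end

noncomputable section

namespace SpinCode

open Matrix

/-! ### Averages over finite subgroups of `SU(2)` -/

/-- Conjugation of a matrix by an element of `SU(2)`. -/
def SU2.ad (g : SU2) : Matrix (Fin 2) (Fin 2) ℂ →ₗ[ℂ] Matrix (Fin 2) (Fin 2) ℂ :=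
  LinearMap.mulLeft ℂ g.1 ∘ₗ LinearMap.mulRight ℂ (g⁻¹).1

theorem SU2.ad_apply (g : SU2) (E : Matrix (Fin 2) (Fin 2) ℂ) :
    SU2.ad g E = g.1 * E * (g⁻¹).1 := by
  rw [mul_assoc]; rfl

theorem SU2.mul_inv_coe (g : SU2) : g.1 * (g⁻¹).1 = 1 := SU2.mul_star_coe g

theorem SU2.inv_mul_coe (g : SU2) : (g⁻¹).1 * g.1 = 1 := SU2.star_mul_coe g

theorem SU2.ad_mul (g h : SU2) (E : Matrix (Fin 2) (Fin 2) ℂ) :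
    SU2.ad (g * h) E = SU2.ad g (SU2.ad h E) := by
  have h1 : ((g * h)⁻¹).1 = (h⁻¹).1 * (g⁻¹).1 := by rw [_root_.mul_inv_rev]; rfl
  have h2 : (g * h).1 = g.1 * h.1 := rfl
  simp only [SU2.ad_apply, h1, h2, mul_assoc]

theorem SU2.ad_one (E : Matrix (Fin 2) (Fin 2) ℂ) : SU2.ad 1 E = E := by
  rw [SU2.ad_apply, inv_one]
  change 1 * E * 1 = E
  simp

theorem SU2.trace_ad (g : SU2) (E : Matrix (Fin 2) (Fin 2) ℂ) :
    (SU2.ad g E).trace = E.trace := by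
  rw [SU2.ad_apply, Matrix.trace_mul_comm, ← mul_assoc, SU2.inv_mul_coe, one_mul]

theorem SU2.ad_eq_self_iff (g : SU2) (E : Matrix (Fin 2) (Fin 2) ℂ) :
    SU2.ad g E = E ↔ g.1 * E = E * g.1 := by
  rw [SU2.ad_apply]
  constructor
  · intro h
    calc g.1 * E = g.1 * E * ((g⁻¹).1 * g.1) := by rw [SU2.inv_mul_coe, mul_one]
      _ = _ := by rw [← mul_assoc, h]
  · intro h
    rw [h, mul_assoc, SU2.mul_inv_coe, mul_one]

theorem eq_zero_of_smul_one_of_trace {M : Matrix (Fin 2) (Fin 2) ℂ} {c : ℂ} (h : M = c • 1)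
    (ht : M.trace = 0) : M = 0 := by
  rw [h] at ht
  simp at ht
  rw [h, ht, zero_smul]

theorem exists_eq_smul_one_of_forall_commute {G : Subgroup SU2} (hG : ∃ a b : G, a * b ≠ b * a)
    {M : Matrix (Fin 2) (Fin 2) ℂ} (h : ∀ g : G, (g : SU2).1 * M = M * (g : SU2).1) :
    ∃ c : ℂ, M = c • (1 : Matrix (Fin 2) (Fin 2) ℂ) := by
  obtain ⟨a, b, hab⟩ := hG
  refine exists_eq_smul_one_of_commute (fun e => hab ?_) (h a).symm (h b).symm
  exact Subtype.ext (Subtype.ext e)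

/-- The sum commutes with the noncommutative group G, hence is scalar, and it is traceless. -/
theorem sum_ad_eq_zero {G : Subgroup SU2} [Fintype G] (hG : ∃ a b : G, a * b ≠ b * a)
    {E : Matrix (Fin 2) (Fin 2) ℂ} (hE : E.trace = 0) : ∑ g : G, SU2.ad (g : SU2) E = 0 := by
  obtain ⟨c, hc⟩ := exists_eq_smul_one_of_forall_commute hG
      (M := ∑ g : G, SU2.ad (g : SU2) E) (by
    intro k
    rw [← SU2.ad_eq_self_iff, map_sum]
    simp only [← SU2.ad_mul]
    exact Fintype.sum_equiv (Equiv.mulLeft k) _ _ fun _ => rfl)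
  refine eq_zero_of_smul_one_of_trace hc ?_
  simp [Matrix.trace_sum, SU2.trace_ad, hE]

/-- This is the trace of the operator Σ w(g) Ad_g on traceless matrices, since Ad_g has trace (tr
g)² − 1 there. The three entries used are the diagonal coefficients in the standard basis. -/
theorem sum_mul_tr_sq_sub_one {G : Subgroup SU2} [Fintype G] {w : G → ℝ}
    (h : ∀ E : Matrix (Fin 2) (Fin 2) ℂ, E.trace = 0 → ∑ g : G, (w g : ℂ) • SU2.ad (g : SU2) E = 0) :
    ∑ g : G, w g * (SU2.tr (g : SU2) ^ 2 - 1) = 0 := by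
  have h1 := congrFun (congrFun (h !![0, 1; 0, 0] (by simp [Matrix.trace_fin_two])) 0) 1
  have h2 := congrFun (congrFun (h !![0, 0; 1, 0] (by simp [Matrix.trace_fin_two])) 1) 0
  have h3 := congrFun (congrFun (h !![1, 0; 0, -1] (by simp [Matrix.trace_fin_two])) 0) 0
  rw [Matrix.sum_apply] at h1 h2 h3
  have h4 := congrArg₂ (· + ·) (congrArg₂ (· + ·) h1 h2) h3
  simp only [← Finset.sum_add_distrib, Matrix.zero_apply, add_zero] at h4
  have h5 : ((∑ g : G, w g * (SU2.tr (g : SU2) ^ 2 - 1) : ℝ) : ℂ) = 0 := by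
    rw [← h4, Complex.ofReal_sum]
    refine Finset.sum_congr rfl fun g _ => ?_
    have hd := SU2.det_coe (g : SU2)
    simp only [SU2.ad_apply, SU2.inv_eq_adjugate, Matrix.adjugate_fin_two, Matrix.smul_apply,
      Matrix.mul_apply, Fin.sum_univ_two, smul_eq_mul, Complex.ofReal_mul, Complex.ofReal_sub,
      Complex.ofReal_pow, Complex.ofReal_one, SU2.tr_eq]
    simp
    linear_combination (w g : ℂ) * hd
  exact_mod_cast h5

theorem sum_tr_eq_zero {G : Subgroup SU2} [Fintype G] {h : G} (h1 : h ≠ 1)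
    (hG : ∃ a b : G, a * b ≠ b * a) : ∑ g : G, SU2.tr (g : SU2) = 0 := by
  set M : Matrix (Fin 2) (Fin 2) ℂ := ∑ g : G, (g : SU2).1 with hM
  have hl : ∀ k : G, (k : SU2).1 * M = M := by
    intro k
    rw [hM, Finset.mul_sum]
    exact Fintype.sum_equiv (Equiv.mulLeft k) _ _ fun _ => rfl
  have hr : ∀ k : G, M * (k : SU2).1 = M := by
    intro k
    rw [hM, Finset.sum_mul]
    exact Fintype.sum_equiv (Equiv.mulRight k) _ _ fun _ => rfl
  obtain ⟨c, hc⟩ := exists_eq_smul_one_of_forall_commute hG (M := M)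
    (fun k => (hl k).trans (hr k).symm)
  have hc0 : c = 0 := by
    by_contra h0
    have h2 := hl h
    rw [hc, Matrix.mul_smul, mul_one] at h2
    exact h1 (Subtype.ext (Subtype.ext (smul_right_injective _ h0 h2)))
  have h3 := congrArg Matrix.trace hc
  rw [hc0, zero_smul, Matrix.trace_zero, hM, Matrix.trace_sum] at h3
  simp only [SU2.trace_coe] at h3
  exact_mod_cast h3

/-- In a group of odd order squaring is a bijection, so Σ tr(g²) = Σ tr g = 0. But tr(g²) = ((tr g)²
− 1) − 1 sums to −|G|. So the order is even, and the only involution in SU(2) is −1. -/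
theorem negOne_mem_of_not_commute {G : Subgroup SU2} [Fintype G] (hG : ∃ a b : G, a * b ≠ b * a) :
    SU2.negOne ∈ G := by
  have hN : 0 < Fintype.card G := Fintype.card_pos
  obtain ⟨a, b, hab⟩ := id hG
  have ha1 : a ≠ 1 := by rintro rfl; simp at hab
  have hs := sum_tr_eq_zero ha1 hG
  have hw := sum_mul_tr_sq_sub_one (G := G) (w := fun _ => 1) fun E hE => by
    simpa using sum_ad_eq_zero hG hE
  have heven : 2 ∣ Fintype.card G := by
    by_contra hodd
    have hco : (Nat.card G).Coprime 2 := by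
      rw [Nat.card_eq_fintype_card, Nat.coprime_comm]
      exact (Nat.Prime.coprime_iff_not_dvd Nat.prime_two).2 hodd
    have h1 : ∑ g : G, SU2.tr ((g ^ 2 : G) : SU2) = ∑ g : G, SU2.tr (g : SU2) :=
      Fintype.sum_equiv (powCoprime hco) _ _ fun _ => rfl
    have h2 : ∀ g : G, SU2.tr ((g ^ 2 : G) : SU2) = 1 * (SU2.tr (g : SU2) ^ 2 - 1) - 1 := by
      intro g
      rw [Subgroup.coe_pow, SU2.tr_pow_two]; ring
    simp only [h2, Finset.sum_sub_distrib] at h1 hw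
    rw [hs] at h1
    simp at h1 hw
    have hN' : (0 : ℝ) < Fintype.card G := by exact_mod_cast hN
    linarith
  have : Fact (Nat.Prime 2) := ⟨Nat.prime_two⟩
  obtain ⟨x, hx⟩ := exists_prime_orderOf_dvd_card 2 heven
  have hx2 : (x : SU2) * (x : SU2) = 1 := by
    have := pow_orderOf_eq_one x
    rw [hx, pow_two] at this
    exact congrArg Subtype.val this
  rcases SU2.eq_one_or_negOne_of_sq _ hx2 with h | h
  · have : x = 1 := Subtype.ext h
    rw [this, orderOf_one] at hx
    omega
  · rw [← h]; exact x.2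

theorem isSign_of_forall_commute {G : Subgroup SU2} (hG : ∃ a b : G, a * b ≠ b * a) {g : SU2}
    (h : ∀ k : G, (k : SU2) * g = g * (k : SU2)) : SU2.IsSign g := by
  by_contra hs
  obtain ⟨c, hc⟩ := exists_eq_smul_one_of_forall_commute hG (M := g.1)
    (fun k => congrArg Subtype.val (h k))
  exact SU2.coe_ne_smul_one (fun e => hs (Or.inl e)) (fun e => hs (Or.inr e)) c hc

end SpinCode

end

noncomputable section

namespace SpinCode

open Matrix

/-! ### Two-dimensional unitary representations -/

section MatrixRep

variable {G : Subgroup SU2} {Λ : G →* Matrix (Fin 2) (Fin 2) ℂ}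

/-- The squared absolute value of the character. -/
def charNormSq (Λ : G →* Matrix (Fin 2) (Fin 2) ℂ) (g : G) : ℝ := Complex.normSq (Λ g).trace

theorem charNormSq_nonneg (Λ : G →* Matrix (Fin 2) (Fin 2) ℂ) (g : G) : 0 ≤ charNormSq Λ g :=
  Complex.normSq_nonneg _

theorem normSq_det_of_unitary (hu : ∀ g, star (Λ g) = Λ g⁻¹) (g : G) :
    Complex.normSq (Λ g).det = 1 := by
  have h : star (Λ g).det * (Λ g).det = 1 := by
    rw [← Matrix.det_conjTranspose, ← Matrix.star_eq_conjTranspose, hu, ← Matrix.det_mul,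
      ← map_mul, inv_mul_cancel, map_one, Matrix.det_one]
  have h2 := Complex.normSq_eq_conj_mul_self (z := (Λ g).det)
  rw [Complex.star_def] at h
  rw [h] at h2
  exact_mod_cast h2

theorem isSign_of_map_eq_smul_one (hG : ∃ a b : G, a * b ≠ b * a) (hinj : Function.Injective Λ)
    {g : G} {c : ℂ} (h : Λ g = c • 1) : SU2.IsSign (g : SU2) := by
  refine isSign_of_forall_commute hG fun k => ?_
  have : k * g = g * k := hinj (by rw [map_mul, map_mul, h]; simp)
  exact congrArg Subtype.val this

theorem map_negOne_eq (hG : ∃ a b : G, a * b ≠ b * a) (hinj : Function.Injective Λ)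
    {m : G} (hm : (m : SU2) = SU2.negOne) : Λ m = -1 := by
  obtain ⟨a, b, hab⟩ := hG
  have hc (k : G) : Λ m * Λ k = Λ k * Λ m := by
    rw [← map_mul, ← map_mul]
    congr 1
    exact Subtype.ext (by simp [hm, SU2.negOne_comm])
  obtain ⟨c, hc⟩ := exists_eq_smul_one_of_commute
    (fun e => hab (hinj (by rw [map_mul, map_mul, e]))) (hc a) (hc b)
  have hmm : m * m = 1 := Subtype.ext (by simp [hm, SU2.negOne_mul_self])
  have h1 : Λ m * Λ m = 1 := by rw [← map_mul, hmm, map_one]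
  rw [hc] at h1
  have h2 := congrFun (congrFun h1 0) 0
  simp at h2
  rcases mul_self_eq_one_iff.1 h2 with h | h
  · exfalso
    rw [h, one_smul, ← map_one Λ] at hc
    have := hinj hc
    rw [this] at hm
    exact SU2.negOne_ne_one hm.symm
  · rw [hc, h]; simp

theorem exists_smul_of_isSign (hG : ∃ a b : G, a * b ≠ b * a) (hinj : Function.Injective Λ)
    {g : G} (h : SU2.IsSign (g : SU2)) : ∃ c : ℂ, Λ g = c • 1 := by
  rcases h with h | h
  · refine ⟨1, ?_⟩
    rw [show g = 1 from Subtype.ext h]; simp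
  · exact ⟨-1, by rw [map_negOne_eq hG hinj h]; simp⟩

theorem charNormSq_of_isSign (hG : ∃ a b : G, a * b ≠ b * a) (hinj : Function.Injective Λ)
    {g : G} (h : SU2.IsSign (g : SU2)) : charNormSq Λ g = 4 := by
  rcases h with h | h
  · rw [charNormSq, show g = 1 from Subtype.ext h]; norm_num
  · rw [charNormSq, map_negOne_eq hG hinj h]; norm_num

/-- Trace zero means g² = −1. Faithfulness carries this to Λ(g)² = −1 with Λ(g) nonscalar, so Λ(g)
has trace zero as well. -/
theorem charNormSq_eq_zero (hG : ∃ a b : G, a * b ≠ b * a) (hinj : Function.Injective Λ)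
    {g : G} (h : SU2.tr (g : SU2) = 0) : charNormSq Λ g = 0 := by
  have hgg : (g : SU2) * (g : SU2) = SU2.negOne := by
    apply Subtype.ext
    change (g : SU2).1 * (g : SU2).1 = -1
    rw [SU2.mul_self_coe, h]; simp
  have h1 : Λ g * Λ g = -1 := by
    rw [← map_mul]; exact map_negOne_eq hG hinj hgg
  rw [mul_self_fin_two] at h1
  have h2 := eq_zero_of_smul_add_smul_eq (M := Λ g) (p := (Λ g).trace) (q := -(Λ g).det) (c := -1)
    (fun c hc => SU2.not_isSign_of_tr (by rw [h]; norm_num) (isSign_of_map_eq_smul_one hG hinj hc))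
    (by rw [neg_smul, ← sub_eq_add_neg, h1]; simp)
  rw [charNormSq, h2, map_zero]

/-- Λ(g) is nonscalar with scalar cube, so its squared trace equals its determinant, which has
modulus 1. Here and for fourth powers faithfulness leaves |χ| no freedom; only elements of order
five modulo ±1 can tell λ from the defining representation. -/
theorem charNormSq_of_pow_three (hG : ∃ a b : G, a * b ≠ b * a) (hinj : Function.Injective Λ)
    (hu : ∀ g, star (Λ g) = Λ g⁻¹) {g : G} (hs : ¬ SU2.IsSign (g : SU2))
    (h : SU2.IsSign ((g : SU2) ^ 3)) : charNormSq Λ g = SU2.tr (g : SU2) ^ 2 := by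
  obtain ⟨c, hc⟩ := exists_smul_of_isSign (g := g ^ 3) hG hinj h
  rw [map_pow, pow_three_fin_two] at hc
  have h2 := eq_zero_of_smul_add_smul_eq
    (fun c hc => hs (isSign_of_map_eq_smul_one hG hinj hc)) hc
  have h3 : (Λ g).trace ^ 2 = (Λ g).det := sub_eq_zero.1 h2
  have h4 := congrArg Complex.normSq h3
  rw [map_pow, normSq_det_of_unitary hu] at h4
  rw [SU2.tr_sq_eq_one hs h, charNormSq]
  nlinarith [Complex.normSq_nonneg (Λ g).trace]

theorem charNormSq_of_pow_four (hG : ∃ a b : G, a * b ≠ b * a) (hinj : Function.Injective Λ)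
    (hu : ∀ g, star (Λ g) = Λ g⁻¹) {g : G} (hs : ¬ SU2.IsSign (g : SU2))
    (h : SU2.IsSign ((g : SU2) ^ 4)) : charNormSq Λ g = SU2.tr (g : SU2) ^ 2 := by
  obtain ⟨c, hc⟩ := exists_smul_of_isSign (g := g ^ 4) hG hinj h
  rw [map_pow, pow_four_fin_two] at hc
  have h2 := eq_zero_of_smul_add_smul_eq
    (fun c hc => hs (isSign_of_map_eq_smul_one hG hinj hc)) hc
  by_cases h0 : SU2.tr (g : SU2) = 0
  · rw [charNormSq_eq_zero hG hinj h0, h0]; norm_num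
  have h3 : SU2.tr (g : SU2) ^ 2 = 2 := (SU2.tr_of_pow_four hs h).resolve_left h0
  rw [h3]
  rcases mul_eq_zero.1 h2 with ht | ht
  -- Trace zero would make Λ(g²) scalar and g² central, but g² has trace 0.
  · exfalso
    have h4 : Λ (g ^ 2) = (-(Λ g).det) • 1 := by
      rw [map_pow, pow_two, mul_self_fin_two, ht]; simp
    refine SU2.not_isSign_of_tr ?_ (isSign_of_map_eq_smul_one hG hinj h4)
    rw [Subgroup.coe_pow, SU2.tr_pow_two, h3]; norm_num
  · have h4 := congrArg Complex.normSq (sub_eq_zero.1 ht)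
    rw [map_pow, map_mul, normSq_det_of_unitary hu] at h4
    norm_num [Complex.normSq_apply] at h4
    rw [← Complex.normSq_apply] at h4
    rw [charNormSq]
    nlinarith [Complex.normSq_nonneg (Λ g).trace]

/-- The determinant of a generator has square 1, because a is conjugate to a⁻¹, and fifth power
det(−1) = 1, because a⁵ = −1. The other generator is a conjugate of a. -/
theorem IsBinaryIcosahedral.det_eq_one (hI : IsBinaryIcosahedral G)
    (hG : ∃ a b : G, a * b ≠ b * a) (hinj : Function.Injective Λ) (g : G) : (Λ g).det = 1 := by
  obtain ⟨a, b, h, x, ha, hh, hx, hb, hxa, hta, -, -, hcl⟩ := hI.exists_generators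
  have hbm : b ∈ G := by rw [hb]; exact G.mul_mem (G.mul_mem hh ha) (G.inv_mem hh)
  set δ : G →* ℂ := Matrix.detMonoidHom.comp Λ with hδ
  have hconj (p q : G) : δ (p * q * p⁻¹) = δ q := by
    rw [map_mul, map_mul, mul_comm (δ p), mul_assoc, ← map_mul, mul_inv_cancel, map_one, mul_one]
  have hda : δ ⟨a, ha⟩ = 1 := by
    have h1 : δ ⟨a, ha⟩ * δ ⟨a, ha⟩ = 1 := by
      have e : (⟨a, ha⟩ : G)⁻¹ = ⟨x, hx⟩ * ⟨a, ha⟩ * (⟨x, hx⟩ : G)⁻¹ := Subtype.ext hxa.symm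
      nth_rewrite 1 [← hconj ⟨x, hx⟩ ⟨a, ha⟩]
      rw [← e, ← map_mul, inv_mul_cancel, map_one]
    have h2 : δ ⟨a, ha⟩ ^ 5 = 1 := by
      rw [← map_pow, hδ, MonoidHom.comp_apply,
        map_negOne_eq (m := (⟨a, ha⟩ : G) ^ 5) hG hinj (SU2.pow_five_of_tr (Or.inl hta))]
      simp [Matrix.detMonoidHom, Matrix.det_neg]
    calc δ ⟨a, ha⟩ = δ ⟨a, ha⟩ * (δ ⟨a, ha⟩ * δ ⟨a, ha⟩) * (δ ⟨a, ha⟩ * δ ⟨a, ha⟩) := by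
          rw [h1]; ring
      _ = δ ⟨a, ha⟩ ^ 5 := by ring
      _ = 1 := h2
  have hdb : δ ⟨b, hbm⟩ = 1 := by
    have e : (⟨b, hbm⟩ : G) = ⟨h, hh⟩ * ⟨a, ha⟩ * (⟨h, hh⟩ : G)⁻¹ := Subtype.ext hb
    rw [e, hconj, hda]
  have hle : G ≤ δ.ker.map G.subtype := by
    conv_lhs => rw [hcl]
    rw [Subgroup.closure_le]
    rintro y (rfl | rfl)
    · exact ⟨⟨y, ha⟩, hda, rfl⟩
    · exact ⟨⟨y, hbm⟩, hdb, rfl⟩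
  obtain ⟨y, hy, hyg⟩ := hle g.2
  have : y = g := Subtype.ext hyg
  rw [← this]
  exact hy

variable [Fintype G]

/-- If a commuted with all its conjugates, each g would fix or invert a. The inverting g have trace
zero and hence weight zero, so the average would multiply the traceless part of a by Σ |χ|² > 0. -/
theorem exists_conj_not_commute_of_sum_eq_zero (hG : ∃ a b : G, a * b ≠ b * a)
    (hinj : Function.Injective Λ)
    (h : ∀ E : Matrix (Fin 2) (Fin 2) ℂ, E.trace = 0 →
      ∑ g : G, (charNormSq Λ g : ℂ) • SU2.ad (g : SU2) E = 0)
    {a : SU2} (hs : ¬ SU2.IsSign a) :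
    ∃ k ∈ G, a * (k * a * k⁻¹) ≠ k * a * k⁻¹ * a := by
  by_contra! hc
  set E : Matrix (Fin 2) (Fin 2) ℂ := a.1 - ((SU2.tr a / 2 : ℝ) : ℂ) • 1 with hE
  have hEt : E.trace = 0 := by
    rw [hE, Matrix.trace_sub, SU2.trace_coe, Matrix.trace_smul, Matrix.trace_one]
    simp
  have key (g : G) : (charNormSq Λ g : ℂ) • SU2.ad (g : SU2) E = (charNormSq Λ g : ℂ) • E := by
    rcases SU2.eq_or_eq_inv_of_commute (hc g g.2) (SU2.tr_conj _ _) with h1 | h1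
    · congr 1
      rw [SU2.ad_eq_self_iff, hE, mul_sub, sub_mul, Matrix.mul_smul, Matrix.smul_mul, mul_one,
        one_mul]
      congr 1
      exact congrArg Subtype.val (mul_inv_eq_iff_eq_mul.1 h1)
    · rw [charNormSq_eq_zero hG hinj (SU2.tr_eq_zero_of_conj_eq_inv (fun e => hs (Or.inl e))
        (fun e => hs (Or.inr e)) h1)]
      simp
  have h1 := h E hEt
  simp only [key] at h1
  rw [← Finset.sum_smul] at h1
  rcases smul_eq_zero.1 h1 with h2 | h2
  · have h3 : ∑ g : G, charNormSq Λ g = 0 := by exact_mod_cast h2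
    rw [Finset.sum_eq_zero_iff_of_nonneg fun g _ => charNormSq_nonneg Λ g] at h3
    have h4 := h3 1 (Finset.mem_univ _)
    rw [charNormSq_of_isSign hG hinj (Or.inl rfl)] at h4
    norm_num at h4
  · exact SU2.coe_ne_smul_one (fun e => hs (Or.inl e)) (fun e => hs (Or.inr e)) _ (sub_eq_zero.1 h2)

/-- With weight (tr g)² the trace of the average, minus that of the unweighted average, is Σ ((tr
g)² − 1)². Its term at g = 1 is positive. -/
theorem not_forall_charNormSq_eq (hG : ∃ a b : G, a * b ≠ b * a)
    (h : ∀ E : Matrix (Fin 2) (Fin 2) ℂ, E.trace = 0 →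
      ∑ g : G, (charNormSq Λ g : ℂ) • SU2.ad (g : SU2) E = 0) :
    ¬ ∀ g : G, charNormSq Λ g = SU2.tr (g : SU2) ^ 2 := by
  intro hy
  have h1 := sum_mul_tr_sq_sub_one h
  have h2 := sum_mul_tr_sq_sub_one (G := G) (w := fun _ => 1) fun E hE => by
    simpa using sum_ad_eq_zero hG hE
  have h3 : ∑ g : G, (SU2.tr (g : SU2) ^ 2 - 1) ^ 2 = 0 := by
    calc ∑ g : G, (SU2.tr (g : SU2) ^ 2 - 1) ^ 2 = ∑ g : G, (charNormSq Λ g *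
          (SU2.tr (g : SU2) ^ 2 - 1) - 1 * (SU2.tr (g : SU2) ^ 2 - 1)) :=
          Finset.sum_congr rfl fun g _ => by rw [hy]; ring
      _ = 0 := by rw [Finset.sum_sub_distrib, h1, h2, sub_zero]
  rw [Finset.sum_eq_zero_iff_of_nonneg fun g _ => sq_nonneg _] at h3
  have h4 := h3 1 (Finset.mem_univ _)
  rw [Subgroup.coe_one, SU2.tr_one] at h4
  norm_num at h4

theorem isBinaryIcosahedral_of_sum_eq_zero (hG : ∃ a b : G, a * b ≠ b * a)
    (hinj : Function.Injective Λ) (hu : ∀ g, star (Λ g) = Λ g⁻¹)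
    (h : ∀ E : Matrix (Fin 2) (Fin 2) ℂ, E.trace = 0 →
      ∑ g : G, (charNormSq Λ g : ℂ) • SU2.ad (g : SU2) E = 0) : IsBinaryIcosahedral G := by
  have hneg := negOne_mem_of_not_commute hG
  obtain ⟨a, b, hab⟩ := id hG
  have ha := SU2.ne_of_not_commute (g := a) (h := b) fun e => hab (Subtype.ext e)
  obtain ⟨m, hm, hm1, hmax⟩ := exists_max_tr G a.2 ha.1
  have hms : ¬ SU2.IsSign m := by
    rintro (e | e)
    · exact hm1 e
    · have h1 := hmax a a.2 ha.1
      rw [e, SU2.tr_negOne] at h1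
      have h2 := SU2.tr_sq_lt _ ha.1 ha.2
      nlinarith
  obtain ⟨k, hk, hkm⟩ := exists_conj_not_commute_of_sum_eq_zero hG hinj h hms
  have hb : TraceBounded G := traceBounded_of_max hm hk hmax hkm
  have hex : ∃ g ∈ G, ¬ SU2.IsSign g ∧ SU2.IsSign (g ^ 5) := by
    by_contra! hc
    refine not_forall_charNormSq_eq hG h fun g => ?_
    by_cases hs : SU2.IsSign (g : SU2)
    · rw [charNormSq_of_isSign hG hinj hs]
      rcases hs with e | e <;> rw [e] <;> norm_num
    · rcases hb.isSign_pow hneg g.2 with h3 | h3 | h3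
      · exact charNormSq_of_pow_three hG hinj hu hs h3
      · exact charNormSq_of_pow_four hG hinj hu hs h3
      · exact absurd h3 (hc g g.2 hs)
  obtain ⟨g, hg, hgs, hg5⟩ : ∃ g ∈ G, ¬ SU2.IsSign g ∧ g ^ 5 = SU2.negOne := by
    obtain ⟨g, hg, hgs, h5 | h5⟩ := hex
    -- A sign change turns fifth power 1 into fifth power −1.
    · refine ⟨SU2.negOne * g, G.mul_mem hneg hg, ?_, ?_⟩
      · rintro (e | e)
        · exact hgs (Or.inr (by rw [← mul_one SU2.negOne, ← e, ← mul_assoc, SU2.negOne_mul_self, one_mul]))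
        · exact hgs (Or.inl (mul_eq_left.1 e))
      · rw [Commute.mul_pow (SU2.negOne_comm g), h5, mul_one, pow_succ, pow_mul SU2.negOne 2 2,
          SU2.IsSign.pow_two (Or.inr rfl), one_pow, one_mul]
    · exact ⟨g, hg, hgs, h5⟩
  obtain ⟨c, hc, htc⟩ : ∃ c ∈ G, SU2.tr c = Real.goldenRatio := by
    rcases SU2.tr_of_pow_five_eq_negOne hg5 (fun e => hgs (Or.inr e)) with ht | ht
    · exact ⟨g, hg, ht⟩
    -- For t = 1 − φ, the trace 2 − t² of −g² is φ.
    · refine ⟨SU2.negOne * g ^ 2, G.mul_mem hneg (G.pow_mem hg 2), ?_⟩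
      rw [SU2.tr_negOne_mul, SU2.tr_pow_two, ht]
      linear_combination -Real.goldenRatio_sq
  have hcs : ¬ SU2.IsSign c := by
    apply SU2.not_isSign_of_tr
    rw [htc, Real.goldenRatio_sq]
    have := goldenRatio_bounds
    intro e
    linarith
  obtain ⟨k, hk, hkc⟩ := exists_conj_not_commute_of_sum_eq_zero hG hinj h hcs
  exact isBinaryIcosahedral_of_tr G hc (G.mul_mem (G.mul_mem hk hc) (G.inv_mem hk)) htc
    (by rw [SU2.tr_conj, htc]) hkc

theorem exists_mulAut_of_sum_eq_zero (hG : ∃ a b : G, a * b ≠ b * a)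
    (hinj : Function.Injective Λ) (hu : ∀ g, star (Λ g) = Λ g⁻¹)
    (h : ∀ E : Matrix (Fin 2) (Fin 2) ℂ, E.trace = 0 →
      ∑ g : G, (charNormSq Λ g : ℂ) • SU2.ad (g : SU2) E = 0) :
    ∃ (u : SU2) (α : MulAut G), (∀ k, α ≠ MulAut.conj k) ∧
      ∀ g, Λ g = u.1 * ((α g : G) : SU2).1 * (u⁻¹).1 := by
  have hI := isBinaryIcosahedral_of_sum_eq_zero hG hinj hu h
  have hmem (g : G) : Λ g ∈ Matrix.specialUnitaryGroup (Fin 2) ℂ := by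
    rw [Matrix.mem_specialUnitaryGroup_iff, Matrix.mem_unitaryGroup_iff']
    exact ⟨by rw [hu, ← map_mul, inv_mul_cancel, map_one], hI.det_eq_one hG hinj g⟩
  set f : G →* SU2 := Λ.codRestrict (Matrix.specialUnitaryGroup (Fin 2) ℂ) hmem with hf
  have hfc (g : G) : (f g).1 = Λ g := rfl
  obtain ⟨u, α, hα⟩ := hI.exists_mulAut f fun x y hxy => hinj (congrArg Subtype.val hxy)
  refine ⟨u, α, fun k hk => ?_, fun g => by rw [← hfc, hα]; rfl⟩
  refine not_forall_charNormSq_eq hG h fun g => ?_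
  rw [charNormSq, ← hfc, SU2.trace_coe, Complex.normSq_ofReal, hα, SU2.tr_conj, hk]
  change SU2.tr ((k : SU2) * g * (k : SU2)⁻¹) * SU2.tr ((k : SU2) * g * (k : SU2)⁻¹) = _
  rw [SU2.tr_conj, pow_two]

end MatrixRep

end SpinCode

end

noncomputable section

namespace SpinCode

open Matrix

/-! ### Unitary form of a two-dimensional representation -/

open scoped ComplexOrder MatrixOrder Matrix.Norms.L2Operator in
theorem exists_eq_star_mul_self_of_posDef {H : Matrix (Fin 2) (Fin 2) ℂ} (h : H.PosDef) :
    ∃ B : Matrix (Fin 2) (Fin 2) ℂ, IsUnit B ∧ H = star B * B := by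
  obtain ⟨B, hB⟩ := CStarAlgebra.nonneg_iff_eq_star_mul_self.1 h.posSemidef.nonneg
  refine ⟨B, ?_, hB⟩
  have := h.isUnit
  rw [hB] at this
  rw [Matrix.isUnit_iff_isUnit_det] at this ⊢
  rw [Matrix.det_mul] at this
  exact isUnit_of_mul_isUnit_right this

open scoped ComplexOrder in
theorem exists_unitary_conj {G : Type*} [Group G] [Fintype G]
    (Λ : G →* Matrix (Fin 2) (Fin 2) ℂ) : ∃ B C : Matrix (Fin 2) (Fin 2) ℂ, B * C = 1 ∧ C * B = 1 ∧
      ∀ g, star (B * Λ g * C) = B * Λ g⁻¹ * C := by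
  -- Weyl averaging: H is a G-invariant positive definite form, and a factor B with H = B*B changes
  -- coordinates to an orthonormal basis for it.
  set H : Matrix (Fin 2) (Fin 2) ℂ := ∑ g : G, star (Λ g) * Λ g with hH
  have hinv (g : G) : star (Λ g) * H * Λ g = H := by
    rw [hH, Finset.mul_sum, Finset.sum_mul]
    refine Fintype.sum_equiv (Equiv.mulRight g) _ _ fun k => ?_
    rw [Equiv.coe_mulRight, map_mul, star_mul]
    simp only [mul_assoc]
  have hpos : H.PosDef := by
    classical
    rw [hH, ← Finset.add_sum_erase _ _ (Finset.mem_univ (1 : G)), map_one]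
    refine Matrix.PosDef.add_posSemidef ?_ (Matrix.posSemidef_sum _ fun g _ =>
      Matrix.posSemidef_conjTranspose_mul_self _)
    simpa using Matrix.PosDef.one
  obtain ⟨B, hB, hHB⟩ := exists_eq_star_mul_self_of_posDef hpos
  obtain ⟨U, rfl⟩ := hB
  set C : Matrix (Fin 2) (Fin 2) ℂ := ↑(U⁻¹ : (Matrix (Fin 2) (Fin 2) ℂ)ˣ)
  have h1 : (U : Matrix (Fin 2) (Fin 2) ℂ) * C = 1 := U.mul_inv
  have h2 : C * (U : Matrix (Fin 2) (Fin 2) ℂ) = 1 := U.inv_mul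
  refine ⟨U, C, h1, h2, fun g => ?_⟩
  have h3 : star (U * Λ g * C) * (U * Λ g * C) = 1 := by
    have h4 : star (C : Matrix (Fin 2) (Fin 2) ℂ) * star (U : Matrix (Fin 2) (Fin 2) ℂ) = 1 := by
      rw [← star_mul, h1, star_one]
    calc star (U * Λ g * C) * (U * Λ g * C)
        = star C * (star (Λ g) * (star (U : Matrix (Fin 2) (Fin 2) ℂ) * U) * Λ g) * C := by
          rw [star_mul, star_mul]; simp only [mul_assoc]
      _ = star C * (star (U : Matrix (Fin 2) (Fin 2) ℂ) * U) * C := by rw [← hHB, hinv]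
      _ = (star C * star (U : Matrix (Fin 2) (Fin 2) ℂ)) * (U * C) := by simp only [mul_assoc]
      _ = 1 := by rw [h4, h1, one_mul]
  have h5 : (U * Λ g * C) * (U * Λ g⁻¹ * C) = 1 := by
    calc (U * Λ g * C) * (U * Λ g⁻¹ * C) = U * (Λ g * (C * U) * Λ g⁻¹) * C := by
          simp only [mul_assoc]
      _ = 1 := by rw [h2, mul_one, ← map_mul, mul_inv_cancel, map_one, mul_one, h1]
  exact left_inv_eq_right_inv h3 h5

theorem exists_unitary_form {G : Subgroup SU2} [Fintype G] {V : Type*} [AddCommGroup V]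
    [Module ℂ V] (lam : Representation ℂ G V) (hV : Module.finrank ℂ V = 2) :
    ∃ (e : V ≃ₗ[ℂ] (Fin 2 → ℂ)) (Λ : G →* Matrix (Fin 2) (Fin 2) ℂ),
      (∀ g v, e (lam g v) = Λ g *ᵥ e v) ∧ ∀ g, star (Λ g) = Λ g⁻¹ := by
  have : FiniteDimensional ℂ V := FiniteDimensional.of_finrank_pos (by omega)
  set e₀ : V ≃ₗ[ℂ] (Fin 2 → ℂ) := LinearEquiv.ofFinrankEq _ _ (by simp [hV]) with he
  set Λ₀ : G →* Matrix (Fin 2) (Fin 2) ℂ :=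
    { toFun := fun g => LinearMap.toMatrix' (e₀.conj (lam g))
      map_one' := by
        rw [map_one, Module.End.one_eq_id, LinearEquiv.conj_id, LinearMap.toMatrix'_id]
      map_mul' := fun g h => by
        rw [map_mul, Module.End.mul_eq_comp, LinearEquiv.conj_comp, LinearMap.toMatrix'_comp] }
    with hΛ
  obtain ⟨B, C, h1, h2, h3⟩ := exists_unitary_conj Λ₀
  refine ⟨e₀ ≪≫ₗ Matrix.toLin'OfInv h2 h1,
    { toFun := fun g => B * Λ₀ g * C
      map_one' := by rw [map_one, mul_one, h1]
      map_mul' := fun g h => by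
        rw [map_mul]
        calc B * (Λ₀ g * Λ₀ h) * C = B * Λ₀ g * 1 * Λ₀ h * C := by
              simp only [mul_assoc, mul_one]
          _ = _ := by rw [← h2]; simp only [mul_assoc] }, fun g v => ?_, h3⟩
  have h4 : Λ₀ g *ᵥ e₀ v = e₀ (lam g v) := by
    rw [← Matrix.toLin'_apply]
    simp [hΛ, LinearEquiv.conj_apply]
  change B *ᵥ e₀ (lam g v) = (B * Λ₀ g * C) *ᵥ (B *ᵥ e₀ v)
  rw [Matrix.mulVec_mulVec, mul_assoc, h2, mul_one, ← Matrix.mulVec_mulVec, h4]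

theorem exists_not_commute_of_isIrreducible {G : Subgroup SU2} {V : Type*} [AddCommGroup V]
    [Module ℂ V] {lam : Representation ℂ G V} (hirr : lam.IsIrreducible)
    (hV : Module.finrank ℂ V = 2) : ∃ a b : G, a * b ≠ b * a := by
  by_contra! hc
  have : FiniteDimensional ℂ V := FiniteDimensional.of_finrank_pos (by omega)
  have : IsMulCommutative G := ⟨⟨hc⟩⟩
  have := Representation.IsIrreducible.finrank_eq_one_of_isMulCommutative lam
  omega

theorem character_eq_trace {G : Subgroup SU2} {V : Type*} [AddCommGroup V]
    [Module ℂ V] {lam : Representation ℂ G V} {e : V ≃ₗ[ℂ] (Fin 2 → ℂ)}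
    {g : G} {M : Matrix (Fin 2) (Fin 2) ℂ} (h : ∀ v, e (lam g v) = M *ᵥ e v) :
    lam.character g = M.trace := by
  rw [Representation.character, ← LinearMap.trace_conj' (lam g) e, ← Matrix.trace_toLin'_eq]
  congr 1
  refine LinearMap.ext fun v => ?_
  rw [LinearEquiv.conj_apply_apply, h, LinearEquiv.apply_symm_apply, Matrix.toLin'_apply]

theorem map_injective_of_intertwine {G : Subgroup SU2} {V : Type*} [AddCommGroup V]
    [Module ℂ V] {lam : Representation ℂ G V} (hinj : Function.Injective lam)
    {e : V ≃ₗ[ℂ] (Fin 2 → ℂ)} {Λ : G →* Matrix (Fin 2) (Fin 2) ℂ}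
    (he : ∀ g v, e (lam g v) = Λ g *ᵥ e v) : Function.Injective Λ := by
  intro g h hgh
  apply hinj
  ext v
  apply e.injective
  rw [he, he, hgh]

theorem isPiTwoBar_of_eq_conj {G : Subgroup SU2} {V : Type*} [AddCommGroup V]
    [Module ℂ V] {lam : Representation ℂ G V} {e : V ≃ₗ[ℂ] (Fin 2 → ℂ)}
    {Λ : G →* Matrix (Fin 2) (Fin 2) ℂ} (he : ∀ g v, e (lam g v) = Λ g *ᵥ e v)
    {u : SU2} {α : MulAut G} (hα : ∀ k, α ≠ MulAut.conj k)
    (h : ∀ g, Λ g = u.1 * ((α g : G) : SU2).1 * (u⁻¹).1) : IsPiTwoBar lam := by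
  refine ⟨α, hα, ⟨Representation.Equiv.mk
    (e ≪≫ₗ Matrix.toLin'OfInv (SU2.mul_inv_coe u) (SU2.inv_mul_coe u)) fun g => ?_⟩⟩
  ext v : 1
  change (u⁻¹).1 *ᵥ e (lam g v) = ((α g : G) : SU2).1 *ᵥ ((u⁻¹).1 *ᵥ e v)
  rw [he, h, Matrix.mulVec_mulVec, Matrix.mulVec_mulVec, ← mul_assoc, ← mul_assoc,
    SU2.inv_mul_coe, one_mul]

end SpinCode

end

noncomputable section

namespace SpinCode

open Matrix

/-! ### Equivariant maps out of the traceless matrices -/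

theorem SU2.ad_ad (g : SU2) (X : Matrix (Fin 2) (Fin 2) ℂ) :
    SU2.ad g (SU2.ad g X) = (SU2.tr g : ℂ) ^ 2 • SU2.ad g X - (SU2.tr g : ℂ) • (g.1 * X) -
      (SU2.tr g : ℂ) • (X * (g⁻¹).1) + X := by
  have h1 := SU2.mul_self_coe g
  have h2 := SU2.mul_self_coe g⁻¹
  rw [SU2.tr_inv] at h2
  have h3 : SU2.ad g (SU2.ad g X) = (g.1 * g.1) * X * ((g⁻¹).1 * (g⁻¹).1) := by
    simp only [SU2.ad_apply, mul_assoc]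
  rw [h3, h1, h2, SU2.ad_apply]
  simp only [sub_mul, mul_sub, Matrix.smul_mul, Matrix.mul_smul, mul_one, one_mul, mul_assoc]
  module

/-- The eigenvalues of Ad_g are 1 and the squares of the eigenvalues of g, so Ad_g is annihilated by
(x − 1)(x² − (t² − 2)x + 1), where t = tr g. -/
theorem SU2.ad_ad_ad (g : SU2) (X : Matrix (Fin 2) (Fin 2) ℂ) :
    SU2.ad g (SU2.ad g (SU2.ad g X)) = ((SU2.tr g : ℂ) ^ 2 - 1) • SU2.ad g (SU2.ad g X) -
      ((SU2.tr g : ℂ) ^ 2 - 1) • SU2.ad g X + X := by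
  have h1 : g.1 * SU2.ad g X = (SU2.tr g : ℂ) • SU2.ad g X - X * (g⁻¹).1 := by
    rw [SU2.ad_apply, ← mul_assoc, ← mul_assoc, SU2.mul_self_coe]
    simp only [sub_mul, Matrix.smul_mul, one_mul]
  have h2 : SU2.ad g X * (g⁻¹).1 = (SU2.tr g : ℂ) • SU2.ad g X - g.1 * X := by
    rw [SU2.ad_apply, mul_assoc, SU2.mul_self_coe, SU2.tr_inv]
    simp only [mul_sub, Matrix.mul_smul, mul_one]
  rw [SU2.ad_ad g (SU2.ad g X), h1, h2, SU2.ad_ad g X]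
  module

/-- Ad_c satisfies its own cubic and, on the image of T, that of Ad_a too. Their difference is a
nonzero multiple of x² − x, so Ad_c fixes the image. -/
theorem commute_of_equivariant {a c : SU2} (hac : SU2.tr a ^ 2 ≠ SU2.tr c ^ 2)
    {T : Matrix (Fin 2) (Fin 2) ℂ →ₗ[ℂ] Matrix (Fin 2) (Fin 2) ℂ}
    (hT : ∀ E, E.trace = 0 → T (SU2.ad a E) = SU2.ad c (T E))
    {E : Matrix (Fin 2) (Fin 2) ℂ} (hE : E.trace = 0) : c.1 * T E = T E * c.1 := by
  have h0 : (SU2.ad a E).trace = 0 := by rw [SU2.trace_ad, hE]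
  have h1 := congrArg T (SU2.ad_ad_ad a E)
  have h2 := SU2.ad_ad_ad c (T E)
  simp only [map_add, map_sub, map_smul] at h1
  rw [hT _ (by rw [SU2.trace_ad, h0]), hT _ h0, hT _ hE, h2] at h1
  have h3 : ((SU2.tr c : ℂ) ^ 2 - (SU2.tr a : ℂ) ^ 2) •
      (SU2.ad c (SU2.ad c (T E)) - SU2.ad c (T E)) = 0 := by
    rw [← sub_eq_zero] at h1
    rw [← h1]
    module
  rcases smul_eq_zero.1 h3 with h4 | h4
  · exfalso
    apply hac
    have : (SU2.tr c ^ 2 - SU2.tr a ^ 2 : ℝ) = 0 := by exact_mod_cast h4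
    linarith
  · rw [← SU2.ad_eq_self_iff]
    have h5 := congrArg (SU2.ad c⁻¹) (sub_eq_zero.1 h4)
    simpa only [← SU2.ad_mul, inv_mul_cancel, SU2.ad_one, inv_mul_cancel_left] using h5

/-- Since α changes the squared traces of the generators a and b, values of T commute with α(a) and
α(b) and are scalar. So T is constant on orbits of Ad, and the orbit sums vanish. -/
theorem IsBinaryIcosahedral.equivariant_eq_zero {G : Subgroup SU2} [Fintype G]
    (hI : IsBinaryIcosahedral G) (hG : ∃ a b : G, a * b ≠ b * a) {α : MulAut G}
    (hα : ∀ k, α ≠ MulAut.conj k)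
    {T : Matrix (Fin 2) (Fin 2) ℂ →ₗ[ℂ] Matrix (Fin 2) (Fin 2) ℂ}
    (hT : ∀ (g : G) E, E.trace = 0 → T (SU2.ad (g : SU2) E) = SU2.ad ((α g : G) : SU2) (T E))
    {E : Matrix (Fin 2) (Fin 2) ℂ} (hE : E.trace = 0) : T E = 0 := by
  obtain ⟨a, b, h, x, ha, hh, hx, hb, hxa, hta, htab, hab, hcl⟩ := hI.exists_generators
  have hbm : b ∈ G := by rw [hb]; exact G.mul_mem (G.mul_mem hh ha) (G.inv_mem hh)
  have hαa : SU2.tr (α ⟨a, ha⟩ : G) = 1 - Real.goldenRatio :=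
    hI.tr_of_not_inner α hα ha hh hb hta htab hab hcl
  have hαb : SU2.tr (α ⟨b, hbm⟩ : G) = 1 - Real.goldenRatio := by
    have e : (⟨b, hbm⟩ : G) = ⟨h, hh⟩ * ⟨a, ha⟩ * (⟨h, hh⟩ : G)⁻¹ := Subtype.ext hb
    rw [e, map_mul, map_mul, map_inv]
    exact (SU2.tr_conj _ _).trans hαa
  have htb : SU2.tr b = Real.goldenRatio := by rw [hb, SU2.tr_conj, hta]
  have hne : Real.goldenRatio ^ 2 ≠ (1 - Real.goldenRatio) ^ 2 := by
    have := goldenRatio_bounds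
    intro e
    nlinarith
  have hscalar : ∀ F : Matrix (Fin 2) (Fin 2) ℂ, F.trace = 0 →
      ∃ c : ℂ, T F = c • (1 : Matrix (Fin 2) (Fin 2) ℂ) := by
    intro F hF
    refine exists_eq_smul_one_of_commute (A := ((α ⟨a, ha⟩ : G) : SU2).1)
      (B := ((α ⟨b, hbm⟩ : G) : SU2).1) (fun e => hab ?_) ?_ ?_
    · have e1 : α ⟨a, ha⟩ * α ⟨b, hbm⟩ = α ⟨b, hbm⟩ * α ⟨a, ha⟩ := Subtype.ext (Subtype.ext e)
      rw [← map_mul, ← map_mul] at e1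
      exact congrArg Subtype.val (α.injective e1)
    · exact (commute_of_equivariant (a := a) (by rw [hta, hαa]; exact hne) (hT ⟨a, ha⟩) hF).symm
    · exact (commute_of_equivariant (a := b) (by rw [htb, hαb]; exact hne) (hT ⟨b, hbm⟩) hF).symm
  obtain ⟨c, hc⟩ := hscalar E hE
  have h1 : ∀ g : G, T (SU2.ad (g : SU2) E) = c • (1 : Matrix (Fin 2) (Fin 2) ℂ) := by
    intro g
    rw [hT g E hE, SU2.ad_eq_self_iff _ _ |>.2, hc]
    rw [hc]; simp
  have h2 := congrArg T (sum_ad_eq_zero hG hE)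
  rw [map_sum, map_zero] at h2
  simp only [h1, Finset.sum_const, Finset.card_univ, ← Nat.cast_smul_eq_nsmul ℂ] at h2
  rw [hc]
  exact (smul_eq_zero.1 h2).resolve_left (by exact_mod_cast Fintype.card_ne_zero)

/-! ### The twisted representation satisfies both conditions -/

variable {G : Subgroup SU2} {V : Type*} [AddCommGroup V] [Module ℂ V]
  {lam : Representation ℂ G V}

theorem IsPiTwoBar.exists_equiv (h : IsPiTwoBar lam) : ∃ (e : V ≃ₗ[ℂ] (Fin 2 → ℂ)) (α : MulAut G),
    (∀ k, α ≠ MulAut.conj k) ∧ ∀ g v, e (lam g v) = ((α g : G) : SU2).1 *ᵥ e v := by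
  obtain ⟨α, hα, ⟨ε⟩⟩ := h
  exact ⟨ε.toLinearEquiv, α, hα, fun g v => LinearMap.congr_fun (ε.isIntertwining' g) v⟩

/-- The matrix coefficients of `spinJ` between the images of the basis vectors, as a linear map. -/
def coeffMap {n : ℕ} (ψ : (Fin 2 → ℂ) →ₗ[ℂ] Spin n) :
    Matrix (Fin 2) (Fin 2) ℂ →ₗ[ℂ] Matrix (Fin 2) (Fin 2) ℂ where
  toFun E := Matrix.of fun i j => inner ℂ (ψ (Pi.single i 1)) (spinJ n E (ψ (Pi.single j 1)))
  map_add' E F := by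
    ext i j
    simp only [spinJ, Matrix.of_apply, Matrix.add_apply, LinearMap.add_apply, LinearMap.smul_apply,
      inner_add_right, inner_smul_right]
    ring
  map_smul' c E := by
    ext i j
    simp only [spinJ, Matrix.of_apply, Matrix.smul_apply, LinearMap.add_apply,
      LinearMap.smul_apply, inner_add_right, inner_smul_right, smul_eq_mul, RingHom.id_apply]
    ring

theorem inner_spinJ_eq {n : ℕ} (ψ : (Fin 2 → ℂ) →ₗ[ℂ] Spin n) (E : Matrix (Fin 2) (Fin 2) ℂ)
    (u v : Fin 2 → ℂ) :
    inner ℂ (ψ u) (spinJ n E (ψ v)) = ∑ i, ∑ j, star (u i) * coeffMap ψ E i j * v j := by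
  have hu : ∀ u : Fin 2 → ℂ, ψ u = ∑ i, u i • ψ (Pi.single i 1) := by
    intro u
    simp only [← map_smul, ← map_sum]
    congr 1
    ext i
    fin_cases i <;> simp
  rw [hu u, hu v]
  simp only [map_sum, sum_inner, inner_sum, map_smul, inner_smul_left, inner_smul_right, coeffMap,
    LinearMap.coe_mk, AddHom.coe_mk, Matrix.of_apply, Finset.mul_sum]
  rw [Finset.sum_comm]
  refine Finset.sum_congr rfl fun i _ => Finset.sum_congr rfl fun j _ => ?_
  rw [Complex.star_def]
  ring

/-- Unitarity of D(g) and covariance of J make the compression of J(E) to a code an equivariant map,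
so that `IsBinaryIcosahedral.equivariant_eq_zero` applies. -/
theorem coeffMap_ad {n : ℕ} {ψ : (Fin 2 → ℂ) →ₗ[ℂ] Spin n} {g c : SU2}
    (h : ∀ v, wignerOp n g (ψ v) = ψ (c.1 *ᵥ v)) {E : Matrix (Fin 2) (Fin 2) ℂ}
    (hE : E.trace = 0) : coeffMap ψ (SU2.ad g E) = SU2.ad c (coeffMap ψ E) := by
  have h1 : (c⁻¹).1 * coeffMap ψ (SU2.ad g E) * c.1 = coeffMap ψ E := by
    ext i j
    have h2 : coeffMap ψ E i j = inner ℂ (ψ (c.1 *ᵥ Pi.single i 1))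
        (spinJ n (SU2.ad g E) (ψ (c.1 *ᵥ Pi.single j 1))) := by
      rw [← h, ← h, SU2.ad_apply, spinJ_wignerOp n g hE, inner_wignerOp_right, ← wignerOp_mul,
        inv_mul_cancel, wignerOp_one]
      rfl
    rw [h2, inner_spinJ_eq]
    simp only [Matrix.mul_apply, Fin.sum_univ_two, SU2.inv_coe, Matrix.star_apply,
      Matrix.mulVec_single_one, Matrix.col_apply]
    ring
  rw [← h1, SU2.ad_apply c]
  simp only [← mul_assoc, SU2.mul_inv_coe, one_mul]
  rw [mul_assoc, SU2.mul_inv_coe, mul_one]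

variable [Fintype G]

theorem autoRankOne_of_isPiTwoBar (hI : IsBinaryIcosahedral G) (hG : ∃ a b : G, a * b ≠ b * a)
    (hlam : IsPiTwoBar lam) : AutoRankOne lam := by
  obtain ⟨ε, α, hα, hε⟩ := hlam.exists_equiv
  rintro n K ⟨e, he⟩
  set ψ : (Fin 2 → ℂ) →ₗ[ℂ] Spin n := K.subtype ∘ₗ (ε.symm ≪≫ₗ e).toLinearMap with hψ
  have hψe (v : V) : ψ (ε v) = e v := by simp [hψ]
  have h (g : G) (v : Fin 2 → ℂ) : wignerOp n g (ψ v) = ψ (((α g : G) : SU2).1 *ᵥ v) := by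
    obtain ⟨v, rfl⟩ := ε.surjective v
    rw [← hε, hψe, hψe]
    exact he g v
  have hzero {E : Matrix (Fin 2) (Fin 2) ℂ} (hE : E.trace = 0) {u v : Spin n} (hu : u ∈ K)
      (hv : v ∈ K) : inner ℂ u (spinJ n E v) = 0 := by
    have h1 : coeffMap ψ E = 0 := hI.equivariant_eq_zero hG hα (fun g F hF => coeffMap_ad (h g) hF) hE
    obtain ⟨u', hu'⟩ := e.surjective ⟨u, hu⟩
    obtain ⟨v', hv'⟩ := e.surjective ⟨v, hv⟩
    have e1 : u = ψ (ε u') := by rw [hψe, hu']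
    have e2 : v = ψ (ε v') := by rw [hψe, hv']
    rw [e1, e2, inner_spinJ_eq, h1]
    simp
  rintro J (rfl | rfl | rfl)
  · refine ⟨0, fun u hu v hv => ?_⟩
    have := hzero (E := !![1 / 2, 0; 0, -1 / 2]) (by simp [Matrix.trace_fin_two]; ring) hu hv
    rw [zero_mul, ← this]
    simp [spinJ]
  · refine ⟨0, fun u hu v hv => ?_⟩
    have := hzero (E := !![0, 1; 0, 0]) (by simp [Matrix.trace_fin_two]) hu hv
    rw [zero_mul, ← this]
    simp [spinJ]
  · refine ⟨0, fun u hu v hv => ?_⟩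
    have := hzero (E := !![0, 0; 1, 0]) (by simp [Matrix.trace_fin_two]) hu hv
    rw [zero_mul, ← this]
    simp [spinJ]

theorem gammaTilde_eq_zero_of_isPiTwoBar (hI : IsBinaryIcosahedral G)
    (hG : ∃ a b : G, a * b ≠ b * a) (hlam : IsPiTwoBar lam) (g' : G)
    {E : Matrix (Fin 2) (Fin 2) ℂ} (hE : E.trace = 0) : gammaTilde lam g' E = 0 := by
  obtain ⟨ε, α, hα, hε⟩ := hlam.exists_equiv
  have hχ (g : G) : lam.character g = ((α g : G) : SU2).1.trace := character_eq_trace (hε g)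
  ext p q
  -- As a function of E the sum intertwines Ad_h with Ad_{α(h)}, by the substitution g ↦ gh, so it
  -- vanishes.
  have key (A : Matrix (Fin 2) (Fin 2) ℂ) :
      ∑ g : G, (SU2.ad (g : SU2) E) p q • SU2.ad ((α g : G) : SU2)⁻¹ A = 0 := by
    set T : Matrix (Fin 2) (Fin 2) ℂ →ₗ[ℂ] Matrix (Fin 2) (Fin 2) ℂ :=
      ∑ g : G, (Matrix.entryLinearMap ℂ ℂ p q ∘ₗ SU2.ad (g : SU2)).smulRight
        (SU2.ad ((α g : G) : SU2)⁻¹ A) with hT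
    have hTa (F : Matrix (Fin 2) (Fin 2) ℂ) :
        T F = ∑ g : G, (SU2.ad (g : SU2) F) p q • SU2.ad ((α g : G) : SU2)⁻¹ A := by
      simp [hT]
    rw [← hTa]
    refine hI.equivariant_eq_zero hG hα (fun h F _ => ?_) hE
    rw [hTa, hTa, map_sum]
    refine Fintype.sum_equiv (Equiv.mulRight h) _ _ fun g => ?_
    rw [map_smul, ← SU2.ad_mul, ← SU2.ad_mul, Equiv.coe_mulRight, map_mul]
    congr 2
    congr 1
    change _ = ((α h : G) : SU2) * (((α g : G) : SU2) * ((α h : G) : SU2))⁻¹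
    group
  -- With P = α(g), Q = α(g)⁻¹ and M = α(g'), the (k, i) entry of Q M e_{ki} P is (QM)_{kk} P_{ii}.
  -- Summing over i and k produces the product of characters χ(g⁻¹g') χ(g).
  have h2 := fun i k => congrFun (congrFun (key (((α g' : G) : SU2).1 * Matrix.single k i 1)) k) i
  have h3 := congrArg₂ (· + ·) (congrArg₂ (· + ·) (h2 0 0) (h2 0 1))
    (congrArg₂ (· + ·) (h2 1 0) (h2 1 1))
  simp only [Matrix.sum_apply, ← Finset.sum_add_distrib, Matrix.zero_apply, add_zero] at h3
  rw [gammaTilde, Matrix.sum_apply, Matrix.zero_apply, ← h3]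
  refine Finset.sum_congr rfl fun g _ => ?_
  have e1 : star (lam.character g) = lam.character g := by
    rw [hχ, SU2.trace_coe]; exact Complex.conj_ofReal _
  have e2 : star (lam.character (g⁻¹ * g')) = lam.character (g⁻¹ * g') := by
    rw [hχ, SU2.trace_coe]; exact Complex.conj_ofReal _
  have e3 : ((α (g⁻¹ * g') : G) : SU2).1 = (((α g : G) : SU2)⁻¹).1 * ((α g' : G) : SU2).1 := by
    rw [map_mul, map_inv]; rfl
  have e4 : (g : SU2).1 * E * ((g⁻¹ : G) : SU2).1 = SU2.ad (g : SU2) E :=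
    (SU2.ad_apply (g : SU2) E).symm
  rw [e1, e2, hχ, hχ, e3, e4]
  simp only [Matrix.smul_apply, smul_eq_mul, SU2.ad_apply ((α g : G) : SU2)⁻¹, inv_inv]
  generalize ((α g : G) : SU2).1 = P
  generalize (((α g : G) : SU2)⁻¹).1 = Q
  generalize ((α g' : G) : SU2).1 = M
  generalize (SU2.ad (g : SU2) E) p q = z
  simp only [Matrix.trace_fin_two, Matrix.mul_apply, Fin.sum_univ_two, Matrix.single_apply]
  simp
  ring

end SpinCode

end

noncomputable section

namespace SpinCode

open Matrix

/-! ### Rank-1 protection forces the weighted averages to vanish -/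

section Averages

variable {G : Subgroup SU2} [Fintype G] {V : Type*} [AddCommGroup V] [Module ℂ V]
  {lam : Representation ℂ G V}

theorem spinJ_add (n : ℕ) (E F : Matrix (Fin 2) (Fin 2) ℂ) :
    spinJ n (E + F) = spinJ n E + spinJ n F := by
  simp only [spinJ, Matrix.add_apply, mul_add, add_smul]
  abel

theorem spinJ_smul (n : ℕ) (c : ℂ) (E : Matrix (Fin 2) (Fin 2) ℂ) :
    spinJ n (c • E) = c • spinJ n E := by
  simp only [spinJ, Matrix.smul_apply, smul_eq_mul, smul_add, smul_smul]
  congr 3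
  ring

/-- `spinJ` as a linear map. -/
def spinJLin (n : ℕ) : Matrix (Fin 2) (Fin 2) ℂ →ₗ[ℂ] (Spin n →ₗ[ℂ] Spin n) where
  toFun := spinJ n
  map_add' := spinJ_add n
  map_smul' := spinJ_smul n

theorem RankOneKL.exists_spinJ {n : ℕ} {K : Submodule ℂ (Spin n)} (h : RankOneKL K)
    (E : Matrix (Fin 2) (Fin 2) ℂ) :
    ∃ c : ℂ, ∀ u ∈ K, ∀ v ∈ K, inner ℂ u (spinJ n E v) = c * inner ℂ u v := by
  obtain ⟨c1, h1⟩ := h (Jz n) (by simp)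
  obtain ⟨c2, h2⟩ := h (Jplus n) (by simp)
  obtain ⟨c3, h3⟩ := h (Jminus n) (by simp)
  refine ⟨2 * E 0 0 * c1 + E 0 1 * c2 + E 1 0 * c3, fun u hu v hv => ?_⟩
  simp only [spinJ, LinearMap.add_apply, LinearMap.smul_apply, inner_add_right, inner_smul_right,
    h1 u hu v hv, h2 u hu v hv, h3 u hu v hv]
  ring

theorem inner_spinJ_wignerOp {n : ℕ} (g : SU2) {E : Matrix (Fin 2) (Fin 2) ℂ} (hE : E.trace = 0)
    (u v : Spin n) :
    inner ℂ (wignerOp n g u) (spinJ n (SU2.ad g E) (wignerOp n g v)) = inner ℂ u (spinJ n E v) := by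
  rw [SU2.ad_apply, spinJ_wignerOp n g hE, inner_wignerOp_right, ← wignerOp_mul,
    inv_mul_cancel, wignerOp_one]

theorem inner_wignerOp_wignerOp {n : ℕ} (g : SU2) (u v : Spin n) :
    inner ℂ (wignerOp n g u) (wignerOp n g v) = inner ℂ u v := by
  rw [inner_wignerOp_right, ← wignerOp_mul, inv_mul_cancel, wignerOp_one]

/-- By irreducibility ψ is zero or embeds λ as a code. In the latter case unitarity makes ⟨ψu|J(Ad_g
E)|ψv⟩ independent of g, and Σ Ad_g E = 0. -/
theorem AutoRankOne.inner_eq_zero (hG : ∃ a b : G, a * b ≠ b * a) (hirr : lam.IsIrreducible)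
    (h : AutoRankOne lam) {n : ℕ} {ψ : V →ₗ[ℂ] Spin n}
    (hψ : ∀ (g : G) v, wignerOp n g (ψ v) = ψ (lam g v))
    {E : Matrix (Fin 2) (Fin 2) ℂ} (hE : E.trace = 0) (u v : V) :
    inner ℂ (ψ u) (spinJ n E (ψ v)) = 0 := by
  have hker : LinearMap.ker ψ = ⊥ ∨ LinearMap.ker ψ = ⊤ := by
    rcases eq_bot_or_eq_top (Subrepresentation.mk (ρ := lam) (LinearMap.ker ψ) fun g v hv => by
      rw [LinearMap.mem_ker] at hv ⊢
      rw [← hψ, hv, map_zero]) with h1 | h1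
    · exact Or.inl (congrArg Subrepresentation.toSubmodule h1)
    · exact Or.inr (congrArg Subrepresentation.toSubmodule h1)
  rcases hker with hker | hker
  · have hK : RankOneKL (LinearMap.range ψ) := h n _
      ⟨LinearEquiv.ofInjective ψ (LinearMap.ker_eq_bot.1 hker), fun g w => hψ g w⟩
    obtain ⟨c, hc⟩ := hK.exists_spinJ E
    have h1 (g : G) : inner ℂ (ψ u) (spinJ n (SU2.ad (g : SU2) E) (ψ v)) =
        c * inner ℂ (ψ u) (ψ v) := by
      have e (w : V) : ψ w = wignerOp n g (ψ (lam g⁻¹ w)) := by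
        rw [hψ, ← Module.End.mul_apply, ← map_mul, mul_inv_cancel, map_one, Module.End.one_apply]
      rw [e u, e v, inner_spinJ_wignerOp _ hE, hc _ ⟨_, rfl⟩ _ ⟨_, rfl⟩, inner_wignerOp_wignerOp]
    have h2 : ∑ g : G, inner ℂ (ψ u) (spinJ n (SU2.ad (g : SU2) E) (ψ v)) = 0 := by
      rw [← inner_sum]
      have h3 : ∑ g : G, spinJ n (SU2.ad (g : SU2) E) (ψ v) =
          spinJLin n (∑ g : G, SU2.ad (g : SU2) E) (ψ v) := by
        rw [map_sum, LinearMap.sum_apply]; rfl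
      rw [h3, sum_ad_eq_zero hG hE, map_zero, LinearMap.zero_apply, inner_zero_right]
    simp only [h1, Finset.sum_const, Finset.card_univ, nsmul_eq_mul] at h2
    rw [hc _ ⟨u, rfl⟩ _ ⟨v, rfl⟩]
    exact (mul_eq_zero.1 h2).resolve_left (by exact_mod_cast Fintype.card_ne_zero)
  · have h0 : ψ v = 0 := by
      rw [← LinearMap.mem_ker, hker]; trivial
    rw [h0, map_zero, inner_zero_right]

theorem AutoRankOne.inner_eq_zero_pair (hG : ∃ a b : G, a * b ≠ b * a) (hirr : lam.IsIrreducible)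
    (h : AutoRankOne lam) {n : ℕ} {ψ η : V →ₗ[ℂ] Spin n}
    (hψ : ∀ (g : G) v, wignerOp n g (ψ v) = ψ (lam g v))
    (hη : ∀ (g : G) v, wignerOp n g (η v) = η (lam g v))
    {E : Matrix (Fin 2) (Fin 2) ℂ} (hE : E.trace = 0) (u v : V) :
    inner ℂ (ψ u) (spinJ n E (η v)) = 0 := by
  have h1 := h.inner_eq_zero hG hirr hψ hE u v
  have h2 := h.inner_eq_zero hG hirr hη hE u v
  -- Polarization: the combinations ψ + η and ψ + iη are equivariant too, and together they separate
  -- the two cross terms.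
  have h3 := h.inner_eq_zero hG hirr (ψ := ψ + η) (fun g v => by
    simp only [LinearMap.add_apply, map_add, hψ, hη]) hE u v
  have h4 := h.inner_eq_zero hG hirr (ψ := ψ + Complex.I • η) (fun g v => by
    simp only [LinearMap.add_apply, LinearMap.smul_apply, map_add, map_smul, hψ, hη]) hE u v
  simp only [LinearMap.add_apply, LinearMap.smul_apply, map_add, map_smul, inner_add_left,
    inner_add_right, inner_smul_left, inner_smul_right, h1, h2, Complex.conj_I] at h3 h4
  linear_combination (1 / 2 : ℂ) * h3 - (Complex.I / 2) * h4 +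
    ((inner ℂ (ψ u) (spinJ n E (η v)) - inner ℂ (η u) (spinJ n E (ψ v))) / 2) * Complex.I_mul_I

/-- The equivariant map that a spin state and a coordinate of the representation generate. -/
def orbitMap {n : ℕ} (Λ : G →* Matrix (Fin 2) (Fin 2) ℂ) (e : V ≃ₗ[ℂ] (Fin 2 → ℂ)) (i : Fin 2)
    (f : Spin n) : V →ₗ[ℂ] Spin n :=
  ∑ g : G, ((LinearMap.proj i ∘ₗ Matrix.toLin' (Λ g⁻¹)) ∘ₗ e.toLinearMap).smulRight
    (wignerOp n g f)

theorem orbitMap_apply {n : ℕ} (Λ : G →* Matrix (Fin 2) (Fin 2) ℂ) (e : V ≃ₗ[ℂ] (Fin 2 → ℂ))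
    (i : Fin 2) (f : Spin n) (v : V) :
    orbitMap Λ e i f v = ∑ g : G, (Λ g⁻¹ *ᵥ e v) i • wignerOp n g f := by
  simp [orbitMap]

theorem wignerOp_orbitMap {n : ℕ} {Λ : G →* Matrix (Fin 2) (Fin 2) ℂ} {e : V ≃ₗ[ℂ] (Fin 2 → ℂ)}
    (he : ∀ g v, e (lam g v) = Λ g *ᵥ e v) (i : Fin 2) (f : Spin n) (g : G) (v : V) :
    wignerOp n g (orbitMap Λ e i f v) = orbitMap Λ e i f (lam g v) := by
  rw [orbitMap_apply, orbitMap_apply, map_sum]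
  refine Fintype.sum_equiv (Equiv.mulLeft g) _ _ fun k => ?_
  rw [map_smul, ← wignerOp_mul, he, Equiv.coe_mulLeft, Matrix.mulVec_mulVec, ← map_mul,
    _root_.mul_inv_rev, inv_mul_cancel_right]
  rfl

/-- For arbitrary states d and c, the vanishing matrix element between their orbit maps can be
reindexed as ⟨d| Σ_k J(F_k) D(k) |c⟩ = 0. The independence lemma in degree |G| − 1 then gives F₁ =
0. -/
theorem AutoRankOne.sum_eq_zero (hG : ∃ a b : G, a * b ≠ b * a) (hirr : lam.IsIrreducible)
    (hinj : Function.Injective lam)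
    (h : AutoRankOne lam) {Λ : G →* Matrix (Fin 2) (Fin 2) ℂ} {e : V ≃ₗ[ℂ] (Fin 2 → ℂ)}
    (he : ∀ g v, e (lam g v) = Λ g *ᵥ e v) (i j : Fin 2) (u v : V)
    {E : Matrix (Fin 2) (Fin 2) ℂ} (hE : E.trace = 0) :
    ∑ g : G, (star ((Λ g *ᵥ e u) i) * (Λ g *ᵥ e v) j) • SU2.ad (g : SU2) E = 0 := by
  obtain ⟨n, hn⟩ : ∃ n, n + 1 = Fintype.card G := ⟨Fintype.card G - 1, Nat.sub_add_cancel Fintype.card_pos⟩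
  have hneg := negOne_mem_of_not_commute hG
  set F : G → Matrix (Fin 2) (Fin 2) ℂ := fun k =>
    ∑ g : G, (star ((Λ g *ᵥ e u) i) * (Λ k⁻¹ *ᵥ (Λ g *ᵥ e v)) j) • SU2.ad (g : SU2) E with hF
  have hF1 : F 1 = ∑ g : G, (star ((Λ g *ᵥ e u) i) * (Λ g *ᵥ e v) j) • SU2.ad (g : SU2) E := by
    simp [hF]
  have hFt (k : G) : (F k).trace = 0 := by
    simp [hF, Matrix.trace_sum, Matrix.trace_smul, SU2.trace_ad, hE]
  rw [← hF1]
  refine eq_zero_of_sum_derivForm_substForm hneg hn (hFt 1) ?_ fun f hf => ?_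
  -- A faithful irreducible λ sends −1 to −1, hence the sign relation between the coefficients at −1
  -- and 1.
  · have e1 : Λ (⟨SU2.negOne, hneg⟩ : G)⁻¹ = -1 := by
      apply map_negOne_eq hG (map_injective_of_intertwine hinj he)
      rw [Subgroup.coe_inv, inv_eq_iff_mul_eq_one, SU2.negOne_mul_self]
    rw [hF1]
    simp only [hF, e1, Matrix.neg_mulVec, Matrix.one_mulVec, Pi.neg_apply, mul_neg, neg_smul,
      Finset.sum_neg_distrib]
  · obtain ⟨c, rfl⟩ := exists_formOf_eq hf
    have h1 : ∑ k : G, spinJ n (F k) (wignerOp n k c) = 0 := by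
      apply ext_inner_left ℂ
      intro d
      rw [inner_zero_right]
      have h2 := h.inner_eq_zero_pair hG hirr (wignerOp_orbitMap he i d) (wignerOp_orbitMap he j c)
        hE u v
      rw [orbitMap_apply, orbitMap_apply] at h2
      have h3 (g k : G) : inner ℂ (wignerOp n (g⁻¹ : G) d)
          (spinJ n E (wignerOp n ((g⁻¹ * k : G) : SU2) c)) =
          inner ℂ d (spinJ n (SU2.ad (g : SU2) E) (wignerOp n k c)) := by
        rw [← inner_spinJ_wignerOp (g : SU2) hE, ← wignerOp_mul, ← wignerOp_mul, Subgroup.coe_mul,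
          Subgroup.coe_inv, mul_inv_cancel, wignerOp_one, mul_inv_cancel_left]
      have h4 (k : G) : inner ℂ d (spinJ n (F k) (wignerOp n k c)) =
          ∑ g : G, star ((Λ g *ᵥ e u) i) * (Λ k⁻¹ *ᵥ (Λ g *ᵥ e v)) j *
            inner ℂ d (spinJ n (SU2.ad (g : SU2) E) (wignerOp n k c)) := by
        change inner ℂ d (spinJLin n (F k) (wignerOp n k c)) = _
        simp only [hF, map_sum, map_smul, LinearMap.sum_apply, LinearMap.smul_apply, inner_sum,
          inner_smul_right]
        rfl
      rw [← h2, inner_sum]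
      simp only [h4, sum_inner, map_sum, map_smul, inner_sum, inner_smul_left, inner_smul_right,
        Finset.mul_sum]
      rw [Finset.sum_comm]
      conv_rhs => rw [Finset.sum_comm]
      refine Fintype.sum_equiv (Equiv.inv G) _ _ fun g => ?_
      refine Fintype.sum_equiv (Equiv.mulLeft g⁻¹) _ _ fun k => ?_
      rw [Equiv.inv_apply, Equiv.coe_mulLeft, h3, inv_inv, _root_.mul_inv_rev, inv_inv, map_mul,
        Matrix.mulVec_mulVec, Complex.star_def]
      ring
    have h3 := congrArg (formOf n) h1
    rw [map_sum, map_zero] at h3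
    rw [← h3]
    refine Finset.sum_congr rfl fun k _ => ?_
    rw [formOf_spinJ n (hFt k), formOf_wignerOp]

/-- Summing the coefficient identities for basis vectors i and j yields the weight Σ conj(Λ_ii) Λ_jj
= |χ|². -/
theorem AutoRankOne.sum_charNormSq_eq_zero (hG : ∃ a b : G, a * b ≠ b * a)
    (hirr : lam.IsIrreducible) (hinj : Function.Injective lam)
    (h : AutoRankOne lam) {Λ : G →* Matrix (Fin 2) (Fin 2) ℂ} {e : V ≃ₗ[ℂ] (Fin 2 → ℂ)}
    (he : ∀ g v, e (lam g v) = Λ g *ᵥ e v)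
    {E : Matrix (Fin 2) (Fin 2) ℂ} (hE : E.trace = 0) :
    ∑ g : G, (charNormSq Λ g : ℂ) • SU2.ad (g : SU2) E = 0 := by
  have h1 := fun i j => h.sum_eq_zero hG hirr hinj he i j (e.symm (Pi.single i 1))
    (e.symm (Pi.single j 1)) hE
  have h2 : ∑ i, ∑ j, ∑ g : G, (star ((Λ g *ᵥ e (e.symm (Pi.single i 1))) i) *
      (Λ g *ᵥ e (e.symm (Pi.single j 1))) j) • SU2.ad (g : SU2) E = 0 := by
    simp only [h1, Finset.sum_const_zero]
  rw [← h2]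
  simp only [Fin.sum_univ_two, ← Finset.sum_add_distrib, ← add_smul]
  refine Finset.sum_congr rfl fun g _ => ?_
  congr 1
  simp only [LinearEquiv.apply_symm_apply, Matrix.mulVec_single_one, Matrix.col_apply, charNormSq,
    Complex.normSq_eq_conj_mul_self, Matrix.trace_fin_two, Complex.star_def, map_add]
  ring

end Averages

end SpinCode

end

noncomputable section

namespace SpinCode

open Matrix

/-! ### The two equivalences -/

section Equivalences

variable {G : Subgroup SU2} [Fintype G] {V : Type*} [AddCommGroup V] [Module ℂ V]
  {lam : Representation ℂ G V}

/-- At g' = 1 unitarity gives χ(g⁻¹) = conj χ(g), so the weight in Γ̃ is |χ(g)|². -/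
theorem sum_charNormSq_eq_zero_of_gammaTilde {Λ : G →* Matrix (Fin 2) (Fin 2) ℂ}
    {e : V ≃ₗ[ℂ] (Fin 2 → ℂ)} (he : ∀ g v, e (lam g v) = Λ g *ᵥ e v)
    (hu : ∀ g, star (Λ g) = Λ g⁻¹) {E : Matrix (Fin 2) (Fin 2) ℂ}
    (h : gammaTilde lam 1 E = 0) : ∑ g : G, (charNormSq Λ g : ℂ) • SU2.ad (g : SU2) E = 0 := by
  rw [← h, gammaTilde]
  refine Finset.sum_congr rfl fun g _ => ?_
  rw [SU2.ad_apply, mul_one, character_eq_trace (he g), character_eq_trace (he g⁻¹), ← hu,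
    Matrix.star_eq_conjTranspose, Matrix.trace_conjTranspose, star_star, charNormSq,
    Complex.normSq_eq_conj_mul_self]
  rfl

theorem isBinaryIcosahedral_and_isPiTwoBar (hG : ∃ a b : G, a * b ≠ b * a)
    (hinj : Function.Injective lam) {Λ : G →* Matrix (Fin 2) (Fin 2) ℂ} {e : V ≃ₗ[ℂ] (Fin 2 → ℂ)}
    (he : ∀ g v, e (lam g v) = Λ g *ᵥ e v) (hu : ∀ g, star (Λ g) = Λ g⁻¹)
    (h : ∀ E : Matrix (Fin 2) (Fin 2) ℂ, E.trace = 0 →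
      ∑ g : G, (charNormSq Λ g : ℂ) • SU2.ad (g : SU2) E = 0) :
    IsBinaryIcosahedral G ∧ IsPiTwoBar lam := by
  have hΛ := map_injective_of_intertwine hinj he
  obtain ⟨u, α, hα, hΛα⟩ := exists_mulAut_of_sum_eq_zero hG hΛ hu h
  exact ⟨isBinaryIcosahedral_of_sum_eq_zero hG hΛ hu h, isPiTwoBar_of_eq_conj he hα hΛα⟩

end Equivalences

/-! ### Existence of the twisted representation -/

theorem fundamental_apply (G : Subgroup SU2) (g : G) (v : Fin 2 → ℂ) :
    fundamental G g v = (g : SU2).1 *ᵥ v := rfl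

/-- On a common eigenvector ab and ba agree, so their difference is singular and hence zero. A
noncommutative subgroup therefore has no invariant line. -/
theorem mul_eq_mul_of_invariant {a b : SU2} {v : Fin 2 → ℂ} (hv : v ≠ 0) {c d : ℂ}
    (ha : a.1 *ᵥ v = c • v) (hb : b.1 *ᵥ v = d • v) : a * b = b * a := by
  apply SU2.eq_of_det_sub
  apply Matrix.exists_mulVec_eq_zero_iff.1
  refine ⟨v, hv, ?_⟩
  change (a.1 * b.1 - b.1 * a.1) *ᵥ v = 0
  rw [Matrix.sub_mulVec, ← Matrix.mulVec_mulVec, ← Matrix.mulVec_mulVec, ha, hb,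
    Matrix.mulVec_smul, Matrix.mulVec_smul, ha, hb, smul_smul, smul_smul, mul_comm, sub_self]

theorem isIrreducible_of_not_commute {G : Subgroup SU2} (hG : ∃ a b : G, a * b ≠ b * a)
    {α : MulAut G} :
    Representation.IsIrreducible (ρ := (fundamental G).comp α.toMonoidHom) := by
  obtain ⟨a, b, hab⟩ := hG
  refine { exists_pair_ne := ⟨⊥, ⊤, fun h => ?_⟩, eq_bot_or_eq_top := fun W => ?_ }
  · have h1 : (⊥ : Submodule ℂ (Fin 2 → ℂ)) = ⊤ := congrArg Subrepresentation.toSubmodule h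
    exact bot_ne_top h1
  · have hW (g : G) : ∀ v ∈ W.toSubmodule, ((g : SU2).1 *ᵥ v) ∈ W.toSubmodule := by
      intro v hv
      have := W.apply_mem_toSubmodule (α.symm g) hv
      have e : ((fundamental G).comp α.toMonoidHom) (α.symm g) v = (g : SU2).1 *ᵥ v := by
        change fundamental G (α (α.symm g)) v = _
        rw [MulEquiv.apply_symm_apply, fundamental_apply]
      rwa [e] at this
    have hle : Module.finrank ℂ W.toSubmodule ≤ 2 := by
      simpa using Submodule.finrank_le W.toSubmodule
    have hcases : Module.finrank ℂ W.toSubmodule = 0 ∨ Module.finrank ℂ W.toSubmodule = 1 ∨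
      Module.finrank ℂ W.toSubmodule = 2 := by omega
    rcases hcases with h0 | h1 | h2
    · left
      apply Subrepresentation.toSubmodule_injective
      exact Submodule.finrank_eq_zero.1 h0
    · exfalso
      obtain ⟨⟨v, hv⟩, hv0, hspan⟩ := finrank_eq_one_iff'.1 h1
      obtain ⟨c, hc⟩ := hspan ⟨_, hW a v hv⟩
      obtain ⟨d, hd⟩ := hspan ⟨_, hW b v hv⟩
      refine hab (Subtype.ext (mul_eq_mul_of_invariant (v := v) (fun e => hv0 (Subtype.ext e))
        (congrArg Subtype.val hc).symm (congrArg Subtype.val hd).symm))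
    · right
      apply Subrepresentation.toSubmodule_injective
      exact Submodule.eq_top_of_finrank_eq (by simp [h2])

theorem exists_not_commute_twoI : ∃ a b : twoI, a * b ≠ b * a :=
  ⟨⟨elPhi, elPhi_mem⟩, ⟨elPsi, elPsi_mem⟩,
    fun h => elPhi_not_commute_elPsi (congrArg Subtype.val h)⟩

theorem isBinaryIcosahedral_twoI : IsBinaryIcosahedral twoI := by
  refine ⟨1, ?_⟩
  rw [map_one]
  exact (Subgroup.map_id _).symm

/-- The Galois embedding is an automorphism up to conjugacy in SU(2). It sends Φ to an element of
trace 1 − φ, and inner automorphisms preserve traces. -/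
theorem exists_not_inner_mulAut_twoI : ∃ α : MulAut twoI, ∀ k, α ≠ MulAut.conj k := by
  have := finite_twoI
  obtain ⟨f, hf, hfPhi⟩ := exists_galois_conjugate
  obtain ⟨u, α, hα⟩ := isBinaryIcosahedral_twoI.exists_mulAut f hf
  refine ⟨α, fun k hk => ?_⟩
  have h1 := congrArg SU2.tr (hα ⟨elPhi, elPhi_mem⟩)
  have h2 : SU2.tr (MulAut.conj k (⟨elPhi, elPhi_mem⟩ : twoI) : twoI) = SU2.tr elPhi :=
    SU2.tr_conj _ _
  rw [hfPhi, elPhiConj_tr, SU2.tr_conj, hk, h2, elPhi_tr] at h1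
  have := goldenRatio_bounds
  linarith

theorem exists_isPiTwoBar_twoI : ∃ τ : Representation ℂ twoI (Fin 2 → ℂ),
    τ.IsIrreducible ∧ Function.Injective τ ∧ IsPiTwoBar τ := by
  obtain ⟨α, hα⟩ := exists_not_inner_mulAut_twoI
  refine ⟨(fundamental twoI).comp α.toMonoidHom,
    isIrreducible_of_not_commute exists_not_commute_twoI, fun g h hgh => ?_, α, hα,
    ⟨Representation.Equiv.mk (LinearEquiv.refl ℂ _) fun g => rfl⟩⟩
  apply α.injective
  exact Subtype.ext (Subtype.ext (Matrix.toLin'.injective hgh))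

end SpinCode

end

theorem mainTheorem4 :
    (∃ τ : Representation ℂ SpinCode.twoI (Fin 2 → ℂ),
      τ.IsIrreducible ∧ Function.Injective τ ∧ SpinCode.IsPiTwoBar τ) ∧
    ∀ (G : Subgroup SpinCode.SU2) [Fintype G] (V : Type*) [AddCommGroup V] [Module ℂ V]
      (lam : Representation ℂ G V),
      lam.IsIrreducible → Function.Injective lam → Module.finrank ℂ V = 2 →
      (SpinCode.AutoRankOne lam ↔ SpinCode.IsBinaryIcosahedral G ∧ SpinCode.IsPiTwoBar lam) ∧
      ((∀ (g' : G) (E : Matrix (Fin 2) (Fin 2) ℂ), E.trace = 0 →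
          SpinCode.gammaTilde lam g' E = 0) ↔
        SpinCode.IsBinaryIcosahedral G ∧ SpinCode.IsPiTwoBar lam) := by
  refine ⟨SpinCode.exists_isPiTwoBar_twoI, ?_⟩
  intro G _ V _ _ lam hirr hinj hV
  have hG := SpinCode.exists_not_commute_of_isIrreducible hirr hV
  obtain ⟨e, Λ, he, hu⟩ := SpinCode.exists_unitary_form lam hV
  refine ⟨⟨fun h => ?_, fun h => SpinCode.autoRankOne_of_isPiTwoBar h.1 hG h.2⟩,
    ⟨fun h => ?_, fun h g' E hE => SpinCode.gammaTilde_eq_zero_of_isPiTwoBar h.1 hG h.2 g' hE⟩⟩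
  · exact SpinCode.isBinaryIcosahedral_and_isPiTwoBar hG hinj he hu
      fun E hE => h.sum_charNormSq_eq_zero hG hirr hinj he hE
  · exact SpinCode.isBinaryIcosahedral_and_isPiTwoBar hG hinj he hu
      fun E hE => SpinCode.sum_charNormSq_eq_zero_of_gammaTilde he hu (h 1 E hE)
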